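/- Let $p$ be an odd prime, $F$ a totally real number field, $F'/F$ a Galois extension of degree $p$ with $F'$ totally real and unramified outside $p$, $K$ a totally imaginary quadratic extension of $F$, and $K'=F'K$. Write $\rho$ for the nontrivial automorphism of $K/F$ (and of $K'/F'$), and $X^*={}^tX^{\rho}$ for a square matrix $X$. Let $S$ be a finite set of primes of $F$ that contains all primes above $p$ and all primes ramified in $K/F$. *Local series.* Let $v$ be a prime of $F$, $\mathfrak g$ the ring of integers of $F_v$, $q$ the order of its residue field, $K_v=K\otimes_FF_v$, and $\mathfrak r$ the integral closure of $\mathfrak g$ in $K_v$. Let $S_v$ be the group of hermitian matrices ($h^*=h$) in $M_n(K_v)$, $S_v(\mathfrak r)=S_v\cap M_n(\mathfrak r)$ and $T_v=\{x\in S_v : \mathrm{tr}(S_v(\mathfrak r)x)\subset\mathfrak g\}$. Every $x\in M_n(K_v)$ can be written as $x=d^{-1}c$ with $c,d\in M_n(\mathfrak r)$, $\det d\in K_v^\times$ and $[c\ d]$ primitive (right invertible over $\mathfrak r$); put $\nu_0(x)=\det(d)\,\mathfrak r$, and for $\sigma\in S_v$ define $k(\sigma)$ by $[\mathfrak g:\mathfrak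 g\cap\nu_0(\sigma)]=q^{k(\sigma)}$. Fix an additive character $\chi_v:F_v\to S^1$ with $\mathfrak g=\{a\in F_v : \chi_v(a\mathfrak g)=1\}$. For $\zeta\in T_v$ with $\det\zeta\in K_v^\times$ define $g_\zeta$ by $$\sum_{\sigma\in S_v/S_v(\mathfrak r)}\chi_v(\mathrm{tr}(\zeta\sigma))\,t^{k(\sigma)}=g_\zeta(t)\prod_{i=1}^n\bigl(1-\tau^{i-1}q^{i-1}t\bigr),$$ where $\tau^{i}$ is $1$ if $i$ is even or $K_v\cong F_v\times F_v$, $-1$ if $i$ is odd and $K_v$ is an unramified field extension of $F_v$, and $0$ if $i$ is odd and $K_v/F_v$ is ramified. *Coefficients.* For a positive definite hermitian matrix $\beta\in M_n(K)$ (positive definite at all archimedean places) and $A\in GL_n(\mathbb A_K)$ put $\zeta_v=\omega_vA_v^*\beta A_v$, where $\omega_v$ generates the local different $\mathfrak d(F/\mathbb Q)_v$, and let $g_{\beta,m(A),v}=g_{\zeta_v}$ if $\zeta_v\in T_v$ and $g_{\beta,m(A),v}=0$ otherwise. For a nonzero ideal $\mathfrak a$ of $\mathcal O_F$ let $n_{\mathfrak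 a}(\beta,m(A))$ be the product, over the primes $v\mid\mathfrak a$, of the coefficient of $t^{\mathrm{ord}_v(\mathfrak a)}$ in $g_{\beta,m(A),v}(t)$. Let $n'_{\mathfrak a'}(\beta,m(A))$, for nonzero ideals $\mathfrak a'$ of $\mathcal O_{F'}$, be defined in the same way from $K'/F'$ and the images of $\beta$ and $A$ in $M_n(K')$ and $GL_n(\mathbb A_{K'})$. *Claim.* For every prime $\mathfrak q$ of $F$ that is not in $S$ and every integer $j\ge 0$, the numbers $n_{\mathfrak q^j}(\beta,m(A))$ and $n'_{(\mathfrak q\mathcal O_{F'})^j}(\beta,m(A))$ are integers, and $$n_{\mathfrak q^j}(\beta,m(A))\equiv n'_{(\mathfrak q\mathcal O_{F'})^j}(\beta,m(A))\pmod p .$$ This holds for all choices of the characters and of the generators of the differents over $F$ and $F'$, and it includes both the case where $\mathfrak q$ splits in $F'$ and the case where it is inert. -/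

import Mathlib

open scoped TensorProduct Matrix
open IsDedekindDomain NumberField

noncomputable section

namespace SiegelSeries

/-! ### Local theory

`Fv` is a non-archimedean local field with ring of integers `g`, `Kv` is the quadratic étale
`Fv`-algebra (a quadratic extension field or `Fv × Fv`) and `ρ` is its nontrivial involution. -/

section Local

variable {Fv Kv : Type*} [Field Fv] [CommRing Kv] [Algebra Fv Kv]
variable (g : ValuationSubring Fv) (ρ : Kv →+* Kv) (n : ℕ)

/-- `X ↦ X^*`, the transpose of the conjugate matrix. -/
def adjT {R : Type*} [CommRing R] (σ : R →+* R) {n : ℕ} (X : Matrix (Fin n) (Fin n) R) :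
    Matrix (Fin n) (Fin n) R :=
  (X.map σ)ᵀ

/-- The maximal order `𝔯` of `Kv`: the integral closure of `g`
(for `Kv = Fv × Fv` this is `g × g`). -/
abbrev maxOrder (Kv : Type*) [CommRing Kv] [Algebra Fv Kv] : Subalgebra g Kv :=
  integralClosure g Kv

/-- `S`, the additive group of hermitian `n × n` matrices over `Kv`. -/
def herm : AddSubgroup (Matrix (Fin n) (Fin n) Kv) where
  carrier := {X | adjT ρ X = X}
  zero_mem' := by ext i j; simp [adjT]
  add_mem' {X Y} hX hY := by
    have hX' : adjT ρ X = X := hX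
    have hY' : adjT ρ Y = Y := hY
    have : adjT ρ (X + Y) = adjT ρ X + adjT ρ Y := by ext i j; simp [adjT]
    change adjT ρ (X + Y) = X + Y
    rw [this, hX', hY']
  neg_mem' {X} hX := by
    have hX' : adjT ρ X = X := hX
    have : adjT ρ (-X) = -adjT ρ X := by ext i j; simp [adjT]
    change adjT ρ (-X) = -X
    rw [this, hX']

/-- `S(𝔯)`, the subgroup of `S` of the hermitian matrices with entries in `𝔯`. -/
def intHerm : AddSubgroup (herm ρ n) where
  carrier := {X | ∀ i j, X.1 i j ∈ maxOrder g Kv}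
  zero_mem' := fun _ _ => (maxOrder g Kv).zero_mem
  add_mem' hX hY := fun i j => (maxOrder g Kv).add_mem (hX i j) (hY i j)
  neg_mem' hX := fun i j => (maxOrder g Kv).neg_mem (hX i j)

/-- `T = {x ∈ S | tr(S(𝔯) x) ⊆ g}`. -/
def dualLattice : Set (Matrix (Fin n) (Fin n) Kv) :=
  {x | x ∈ herm ρ n ∧
    ∀ y : herm ρ n, y ∈ intHerm g ρ n → ∃ a ∈ g, (y.1 * x).trace = algebraMap Fv Kv a}

/-- `x = d⁻¹ c` with `c`, `d` integral, `d` invertible over `Kv` and `[c d]` primitive. A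
`n × 2n` matrix over `𝔯` has rank `n` and all its elementary divisors equal to `𝔯` exactly
if it has a right inverse with entries in `𝔯`. For `Kv = Fv × Fv` the condition is the
conjunction of the conditions on the two components. -/
def IsReducedFraction {n : ℕ} (x : Matrix (Fin n) (Fin n) Kv)
    (c d : Matrix (Fin n) (Fin n) (maxOrder g Kv)) : Prop :=
  IsUnit (d.map (algebraMap (maxOrder g Kv) Kv)).det ∧
  d.map (algebraMap (maxOrder g Kv) Kv) * x = c.map (algebraMap (maxOrder g Kv) Kv) ∧
  ∃ u w : Matrix (Fin n) (Fin n) (maxOrder g Kv), c * u + d * w = 1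

/-- The denominator ideal `ν₀(x) = det(d) 𝔯`, where `x = d⁻¹ c` is a reduced fraction. The
ideal `det(d) 𝔯` is the same for all the reduced fractions that represent `x`. -/
def denomIdeal {n : ℕ} (x : Matrix (Fin n) (Fin n) Kv) : Ideal (maxOrder g Kv) :=
  Ideal.span {δ | ∃ c d, IsReducedFraction g x c d ∧ δ = d.det}

/-- `ν[x] = N(g ∩ ν₀(x))`, the index of `g ∩ ν₀(x)` in `g`. -/
def nu {n : ℕ} (x : Matrix (Fin n) (Fin n) Kv) : ℕ :=
  Nat.card (g ⧸ (denomIdeal g x).comap (algebraMap g (maxOrder g Kv)))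

/-- The number of elements of the residue field of `Fv`. -/
def resCard : ℕ := Nat.card (IsLocalRing.ResidueField g)

/-- The additive character `χ` of `Fv` satisfies `g = {a ∈ Fv | χ(a g) = 1}`. -/
def HasConductorOne (χ : AddChar Fv Circle) : Prop :=
  ∀ a : Fv, a ∈ g ↔ ∀ b ∈ g, χ (a * b) = 1

/-- The element of `Fv` with image `x` in `Kv`. It is used for `x = tr(ζ σ)` with `ζ` and `σ`
hermitian, which is fixed by `ρ`, hence in (the image of) `Fv`. -/
def descend (x : Kv) : Fv := Function.invFun (algebraMap Fv Kv) x

/-- The formal series `A_ζ(t) = ∑_{σ ∈ S/S(𝔯)} χ(tr(ζ σ)) t^{k(σ)}`, where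
`ν[σ] = q^{k(σ)}`, for `ζ ∈ T`. Neither `χ(tr(ζ σ))` nor `k(σ)` depends on the representative
of the class, and the number of classes with a given `k(σ)` is finite. -/
def seriesA (χ : AddChar Fv Circle) {n : ℕ} (ζ : Matrix (Fin n) (Fin n) Kv) : PowerSeries ℂ :=
  PowerSeries.mk fun k =>
    ∑ᶠ s : {s : herm ρ n ⧸ intHerm g ρ n // nu g s.out.1 = resCard g ^ k},
      ((χ (descend (ζ * s.1.out.1).trace) : Circle) : ℂ)

/-- The different of `Kv` over `Fv` is trivial, i.e. the dual of `𝔯` for the trace form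
is `𝔯`. -/
def DifferentTrivial (Kv : Type*) [CommRing Kv] [Algebra Fv Kv] : Prop :=
  ∀ x : Kv, (∀ y ∈ maxOrder g Kv, Algebra.trace Fv Kv (x * y) ∈ g) → x ∈ maxOrder g Kv

open Classical in
/-- The symbol `τ^i`: it is `1` if `i` is even or `Kv` is split, `-1` if `i` is odd and `Kv` is
an unramified field extension, `0` if `i` is odd and `Kv` is ramified. -/
def tau (Kv : Type*) [CommRing Kv] [Algebra Fv Kv] (i : ℕ) : ℤ :=
  if Even i ∨ ¬ IsField Kv then 1 else if DifferentTrivial g Kv then -1 else 0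

/-- `f_ζ(t) = ∏_{i=1}^{n} (1 - τ^{i-1} q^{i-1} t)` for `ζ` of full rank `n`. -/
def seriesF (Kv : Type*) [CommRing Kv] [Algebra Fv Kv] (n : ℕ) : PowerSeries ℂ :=
  ∏ i ∈ Finset.range n,
    (1 - PowerSeries.C ((tau g Kv i : ℂ) * (resCard g : ℂ) ^ i) * PowerSeries.X)

open Classical in
/-- `g_ζ(t)`, defined by `A_ζ(t) = f_ζ(t) g_ζ(t)`, for `ζ ∈ T` of full rank; it is
set to be `0` if `ζ ∉ T`. -/
def seriesG (χ : AddChar Fv Circle) {n : ℕ} (ζ : Matrix (Fin n) (Fin n) Kv) : PowerSeries ℂ :=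
  if ζ ∈ dualLattice g ρ n then seriesA g ρ χ ζ * (seriesF g Kv n)⁻¹ else 0

end Local

/-! ### Ring homomorphisms between tensor products over different fields -/

section Tensor

variable {F F' A A' K K' : Type*} [Field F] [Field F'] [CommRing A] [CommRing A'] [CommRing K]
  [CommRing K'] [Algebra F A] [Algebra F K] [Algebra F' A'] [Algebra F' K']

/-- The ring homomorphism `A ⊗_F K → A' ⊗_{F'} K'`, `a ⊗ k ↦ φ(a) ⊗ ψ(k)`, for compatible
ring homomorphisms `ι : F → F'`, `φ : A → A'` and `ψ : K → K'`. -/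
def tensorMap (ι : F →+* F') (φ : A →+* A') (ψ : K →+* K')
    (hφ : ∀ x, φ (algebraMap F A x) = algebraMap F' A' (ι x))
    (hψ : ∀ x, ψ (algebraMap F K x) = algebraMap F' K' (ι x)) :
    A ⊗[F] K →+* A' ⊗[F'] K' :=
  letI : Algebra F (A' ⊗[F'] K') := ((algebraMap F' (A' ⊗[F'] K')).comp ι).toAlgebra
  let f : A →ₐ[F] A' ⊗[F'] K' :=
    { (Algebra.TensorProduct.includeLeftRingHom : A' →+* A' ⊗[F'] K').comp φ with
      commutes' := fun x => by
        change (φ (algebraMap F A x)) ⊗ₜ[F'] (1 : K') = algebraMap F' (A' ⊗[F'] K') (ι x)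
        rw [hφ]; rfl }
  let h : K →ₐ[F] A' ⊗[F'] K' :=
    { (Algebra.TensorProduct.includeRight : K' →ₐ[F'] A' ⊗[F'] K').toRingHom.comp ψ with
      commutes' := fun x => by
        change (1 : A') ⊗ₜ[F'] (ψ (algebraMap F K x)) = algebraMap F' (A' ⊗[F'] K') (ι x)
        rw [hψ, Algebra.TensorProduct.algebraMap_apply'] }
  (Algebra.TensorProduct.productMap f h).toRingHom

theorem tensorMap_tmul (ι : F →+* F') (φ : A →+* A') (ψ : K →+* K')
    (hφ : ∀ x, φ (algebraMap F A x) = algebraMap F' A' (ι x))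
    (hψ : ∀ x, ψ (algebraMap F K x) = algebraMap F' K' (ι x)) (a : A) (k : K) :
    tensorMap ι φ ψ hφ hψ (a ⊗ₜ k) = φ a ⊗ₜ ψ k := by
  change (φ a ⊗ₜ[F'] (1 : K')) * ((1 : A') ⊗ₜ[F'] ψ k) = _
  simp

end Tensor

/-! ### Extension of completions and of finite adeles -/

section Completion

variable (F F' : Type*) [Field F] [NumberField F] [Field F'] [NumberField F'] [Algebra F F']

instance underLiesOver (w : HeightOneSpectrum (𝓞 F')) :
    w.asIdeal.LiesOver (w.under (𝓞 F)).asIdeal := ⟨rfl⟩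

/-- The continuous extension `F_v → F'_w` of the inclusion `F → F'`, where `w` is a prime of `F'`
above the prime `v` of `F`. -/
def completionMap (w : HeightOneSpectrum (𝓞 F')) :
    (w.under (𝓞 F)).adicCompletion F →+* w.adicCompletion F' :=
  ((HeightOneSpectrum.adicCompletion.equiv F' w).symm.toRingHom.comp
    (UniformSpace.Completion.mapRingHom
      (algebraMap (WithVal ((w.under (𝓞 F)).valuation F)) (WithVal (w.valuation F')))
      (HeightOneSpectrum.uniformContinuous_algebraMap_liesOver F F'
        (w.under (𝓞 F)) w).continuous)).comp
    (HeightOneSpectrum.adicCompletion.equiv F (w.under (𝓞 F))).toRingHom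

theorem completionMap_coe (w : HeightOneSpectrum (𝓞 F')) (x : F) :
    completionMap F F' w (algebraMap F _ x) = algebraMap F' _ (algebraMap F F' x) := by
  change HeightOneSpectrum.adicCompletion.ofCompletion (UniformSpace.Completion.mapRingHom
    (algebraMap (WithVal ((w.under (𝓞 F)).valuation F)) (WithVal (w.valuation F')))
    (HeightOneSpectrum.uniformContinuous_algebraMap_liesOver F F' (w.under (𝓞 F)) w).continuous
    (((WithVal.equiv ((w.under (𝓞 F)).valuation F)).symm x :
      WithVal ((w.under (𝓞 F)).valuation F)) : ((w.under (𝓞 F)).valuation F).Completion)) = _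
  rw [UniformSpace.Completion.mapRingHom_coe
    (HeightOneSpectrum.uniformContinuous_algebraMap_liesOver F F' (w.under (𝓞 F)) w).continuous]
  rfl

theorem continuous_completionMap (w : HeightOneSpectrum (𝓞 F')) :
    Continuous (completionMap F F' w) := by
  refine (HeightOneSpectrum.adicCompletion.continuous_ofCompletion F' w).comp ?_
  exact UniformSpace.Completion.continuous_map.comp
    (HeightOneSpectrum.adicCompletion.continuous_toCompletion F _)

theorem completionMap_mapsTo (w : HeightOneSpectrum (𝓞 F')) :
    Set.MapsTo (completionMap F F' w) ((w.under (𝓞 F)).adicCompletionIntegers F)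
      (w.adicCompletionIntegers F') := by
  intro x hx
  have ho : IsOpen (((w.under (𝓞 F)).adicCompletionIntegers F : Set _) ∩
      {y | completionMap F F' w y - completionMap F F' w x ∈ w.adicCompletionIntegers F'}) := by
    refine (Valued.isOpen_valuationSubring _).inter ?_
    exact (Valued.isOpen_valuationSubring (w.adicCompletion F')).preimage
      ((continuous_completionMap F F' w).sub continuous_const)
  obtain ⟨y, hy⟩ := ((w.under (𝓞 F)).denseRange_algebraMap F).exists_mem_open ho
    ⟨x, hx, by simp⟩
  obtain ⟨hy1, hy2⟩ := hy
  have hy3 : completionMap F F' w (algebraMap F _ y) ∈ w.adicCompletionIntegers F' := by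
    rw [completionMap_coe]
    have hy4 : (w.under (𝓞 F)).valuation F y ≤ 1 := by
      rw [← HeightOneSpectrum.valuedAdicCompletion_eq_valuation' (w.under (𝓞 F)) y]
      exact hy1
    change Valued.v (algebraMap F' (w.adicCompletion F') (algebraMap F F' y)) ≤ 1
    have := HeightOneSpectrum.valuedAdicCompletion_eq_valuation' w (algebraMap F F' y)
    refine this.trans_le ?_
    rw [← HeightOneSpectrum.valuation_liesOver F' (w.under (𝓞 F)) w]
    exact pow_le_one' hy4 _
  have := sub_mem hy3 hy2
  simpa using this

theorem tendsto_under :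
    Filter.Tendsto (fun w : HeightOneSpectrum (𝓞 F') => w.under (𝓞 F))
      Filter.cofinite Filter.cofinite := by
  refine Filter.Tendsto.cofinite_of_finite_preimage_singleton fun v => ?_
  refine Set.Finite.of_finite_image (f := HeightOneSpectrum.asIdeal) ?_
    (HeightOneSpectrum.asIdeal_injective.injOn)
  refine (IsDedekindDomain.primesOver_finite v.asIdeal (𝓞 F')).subset ?_
  rintro _ ⟨w, hw, rfl⟩
  have hw' : w.under (𝓞 F) = v := hw
  exact ⟨w.isPrime, ⟨by rw [← hw']; rfl⟩⟩

/-- The inclusion of the finite adeles of `F` in the finite adeles of `F'`. -/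
def finiteAdeleMap : FiniteAdeleRing (𝓞 F) F →+* FiniteAdeleRing (𝓞 F') F' :=
  RestrictedProduct.mapAlongRingHom
    (fun v : HeightOneSpectrum (𝓞 F) => v.adicCompletion F)
    (fun w : HeightOneSpectrum (𝓞 F') => w.adicCompletion F')
    (fun w => w.under (𝓞 F)) (tendsto_under F F') (completionMap F F')
    (Filter.Eventually.of_forall (completionMap_mapsTo F F'))

theorem finiteAdeleMap_apply (x : FiniteAdeleRing (𝓞 F) F) (w : HeightOneSpectrum (𝓞 F')) :
    finiteAdeleMap F F' x w = completionMap F F' w (x (w.under (𝓞 F))) := rfl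

theorem finiteAdeleMap_algebraMap (x : F) :
    finiteAdeleMap F F' (algebraMap F _ x) = algebraMap F' _ (algebraMap F F' x) := by
  refine FiniteAdeleRing.ext _ fun w => ?_
  rw [finiteAdeleMap_apply]
  exact completionMap_coe F F' w x

end Completion

/-! ### Global objects

`K` is a quadratic extension of the number field `F`. The adele ring of `K` is used in the form
`𝔸_K = 𝔸_F ⊗_F K`, and `K_v = F_v ⊗_F K` for a prime `v` of `F`. -/

section Global

variable (F K : Type*) [Field F] [NumberField F] [Field K] [Algebra F K]

/-- `𝔸_K = 𝔸_F ⊗_F K`. -/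
abbrev Adeles : Type _ := AdeleRing (𝓞 F) F ⊗[F] K

/-- `𝔸_{K,f} = 𝔸_{F,f} ⊗_F K`. -/
abbrev FiniteAdeles : Type _ := FiniteAdeleRing (𝓞 F) F ⊗[F] K

/-- `K_v = F_v ⊗_F K`. -/
abbrev LocalAlg (v : HeightOneSpectrum (𝓞 F)) : Type _ := v.adicCompletion F ⊗[F] K

/-- The projection of the adeles of `K` to the finite adeles. -/
def finitePart : Adeles F K →+* FiniteAdeles F K :=
  tensorMap (RingHom.id F) (RingHom.snd (InfiniteAdeleRing F) (FiniteAdeleRing (𝓞 F) F))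
    (RingHom.id K) (fun _ => rfl) (fun _ => rfl)

/-- The evaluation of finite adeles of `F` at `v`. -/
def evalAt (v : HeightOneSpectrum (𝓞 F)) : FiniteAdeleRing (𝓞 F) F →+* v.adicCompletion F where
  toFun a := a v
  map_one' := rfl
  map_mul' _ _ := rfl
  map_zero' := rfl
  map_add' _ _ := rfl

/-- The component at `v` of a finite adele of `K`. -/
def component (v : HeightOneSpectrum (𝓞 F)) : FiniteAdeles F K →+* LocalAlg F K v :=
  tensorMap (RingHom.id F) (evalAt F v) (RingHom.id K) (fun _ => rfl) (fun _ => rfl)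

variable {K} in
/-- The involution of `K_v` that is induced by an automorphism `ρ` of `K` over `F`. -/
def localConj (ρ : K ≃ₐ[F] K) (v : HeightOneSpectrum (𝓞 F)) : LocalAlg F K v →+* LocalAlg F K v :=
  tensorMap (RingHom.id F) (RingHom.id (v.adicCompletion F)) (ρ : K →+* K) (fun _ => rfl)
    (fun x => ρ.commutes x)

variable {F}

/-- `χ_v` is an additive character of `F_v` with `g_v = {a | χ_v(a g_v) = 1}`, for all `v`. -/
def IsCharFamily (χ : ∀ v : HeightOneSpectrum (𝓞 F), AddChar (v.adicCompletion F) Circle) :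
    Prop :=
  ∀ v, HasConductorOne (v.adicCompletionIntegers F) (χ v)

/-- `ω_v` is a generator of the different `𝔡(F/ℚ)_v`, for all `v`. -/
def IsDifferentFamily (ω : ∀ v : HeightOneSpectrum (𝓞 F), v.adicCompletionIntegers F) : Prop :=
  ∀ v, (differentIdeal ℤ (𝓞 F)).map (algebraMap (𝓞 F) (v.adicCompletionIntegers F)) =
    Ideal.span {ω v}

variable {K}

open scoped ComplexOrder in
/-- `β` is a hermitian matrix over `K`, with respect to the automorphism `ρ` of `K`, and it is
positive definite at all the archimedean places. -/
def IsPosDefHermitian (ρ : K ≃ₐ[F] K) {n : ℕ} (β : Matrix (Fin n) (Fin n) K) : Prop :=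
  adjT (ρ : K →+* K) β = β ∧ ∀ φ : K →+* ℂ, (β.map φ).PosDef

/-- `ζ_v = ω_v A_v^* β A_v`. -/
def zeta (ρ : K ≃ₐ[F] K) (ω : ∀ v : HeightOneSpectrum (𝓞 F), v.adicCompletionIntegers F) {n : ℕ}
    (β : Matrix (Fin n) (Fin n) K) (A : GL (Fin n) (FiniteAdeles F K))
    (v : HeightOneSpectrum (𝓞 F)) : Matrix (Fin n) (Fin n) (LocalAlg F K v) :=
  (ω v : v.adicCompletion F) •
    (adjT (localConj F ρ v) (A.1.map (component F K v)) *
      β.map (Algebra.TensorProduct.includeRight : K →ₐ[F] LocalAlg F K v) *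
      A.1.map (component F K v))

/-- `g_{β,m(A),v}(t)`. -/
def siegelG (ρ : K ≃ₐ[F] K)
    (χ : ∀ v : HeightOneSpectrum (𝓞 F), AddChar (v.adicCompletion F) Circle)
    (ω : ∀ v : HeightOneSpectrum (𝓞 F), v.adicCompletionIntegers F) {n : ℕ}
    (β : Matrix (Fin n) (Fin n) K) (A : GL (Fin n) (FiniteAdeles F K))
    (v : HeightOneSpectrum (𝓞 F)) : PowerSeries ℂ :=
  seriesG (v.adicCompletionIntegers F) (localConj F ρ v) (χ v) (zeta ρ ω β A v)

/-- `n_𝔞(β, m(A))`, the coefficient at the ideal `𝔞` of the formal product of the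
`g_{β,m(A),v}(t)` with `t` replaced by the prime `v`: the product, over the primes `v` that
divide `𝔞`, of the coefficient of `t^{ord_v(𝔞)}` in `g_{β,m(A),v}(t)`. -/
def siegelCoeff (ρ : K ≃ₐ[F] K)
    (χ : ∀ v : HeightOneSpectrum (𝓞 F), AddChar (v.adicCompletion F) Circle)
    (ω : ∀ v : HeightOneSpectrum (𝓞 F), v.adicCompletionIntegers F) {n : ℕ}
    (β : Matrix (Fin n) (Fin n) K) (A : GL (Fin n) (FiniteAdeles F K)) (𝔞 : Ideal (𝓞 F)) : ℂ :=
  ∏ᶠ (v : HeightOneSpectrum (𝓞 F)) (_ : v.asIdeal ∣ 𝔞),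
    PowerSeries.coeff (multiplicity v.asIdeal 𝔞) (siegelG ρ χ ω β A v)

end Global

section BaseChange

variable (F K F' K' : Type*) [Field F] [NumberField F] [Field K] [Algebra F K]
  [Field F'] [NumberField F'] [Field K'] [Algebra F' K'] [Algebra F F'] [Algebra K K']
  [Algebra F K'] [IsScalarTower F F' K'] [IsScalarTower F K K']

/-- The inclusion of the finite adeles of `K` in the finite adeles of `K'`. -/
def finiteAdelesMap : FiniteAdeles F K →+* FiniteAdeles F' K' :=
  tensorMap (algebraMap F F') (finiteAdeleMap F F') (algebraMap K K')
    (finiteAdeleMap_algebraMap F F')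
    (fun x => by
      rw [← IsScalarTower.algebraMap_apply F K K', ← IsScalarTower.algebraMap_apply F F' K'])

end BaseChange

end SiegelSeries

end

/-!
Every unit of the ring of integers acts on the classes `σ` with a given value of `k(σ)`, so the
character sum over them is the number of `σ` with `tr(ζσ)` integral minus the number of `σ` with
`tr(ζσ)` in a fixed nontrivial class killed by a uniformizer. It is therefore an integer that does
not depend on the character.

Let `w` be a prime of `F'` above `𝔮`. The decomposition group of `w`, cyclic of order `1` or `p`,
acts on the sets counted over `F'_w`. As everything is unramified and `p` is a unit at `w`, the
fixed points are exactly the classes that come from `F_𝔮`, so the counts over `F_𝔮` and `F'_w` are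
congruent modulo `p`. The factors `1 - τ^{i-1} q^{i-1} t` are congruent too: `p` is odd, so `τ` does
not change, and the residue fields have congruent orders by the same fixed point argument. Finally
there are `1` or `p` primes above `𝔮`, and `a ^ p ≡ a`.
-/

namespace SiegelSeries

/-! ### Unramified quadratic algebras -/

/-- `K = F ⊕ F θ` is a quadratic algebra with conjugation `ρ` such that `θ` has trace `s` and
norm `P` in `g` and the discriminant `s² - 4P` is a unit of `g`. -/
structure IsUnramifiedQuadratic {F K : Type*} [Field F] [CommRing K] [Algebra F K]
    (g : ValuationSubring F) (ρ : K →+* K) (θ : K) (s P : F) : Prop where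
  trace_mem : s ∈ g
  norm_mem : P ∈ g
  disc_unit : ∃ e ∈ g, (s ^ 2 - 4 * P) * e = 1
  theta_sq : θ * θ = algebraMap F K s * θ - algebraMap F K P
  conj_theta : ρ θ = algebraMap F K s - θ
  conj_algebraMap : ∀ a, ρ (algebraMap F K a) = algebraMap F K a
  bijective_coord :
    Function.Bijective fun ab : F × F => algebraMap F K ab.1 + algebraMap F K ab.2 * θ

namespace IsUnramifiedQuadratic

variable {F K : Type*} [Field F] [CommRing K] [Algebra F K]
  {g : ValuationSubring F} {ρ : K →+* K} {θ : K} {s P : F}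

variable (h : IsUnramifiedQuadratic g ρ θ s P)
include h

theorem exists_coord (x : K) : ∃ a b, x = algebraMap F K a + algebraMap F K b * θ := by
  obtain ⟨⟨a, b⟩, hab⟩ := h.bijective_coord.2 x
  exact ⟨a, b, hab.symm⟩

theorem coord_inj {a b a' b' : F}
    (hab : algebraMap F K a + algebraMap F K b * θ = algebraMap F K a' + algebraMap F K b' * θ) :
    a = a' ∧ b = b' := by
  simpa using @h.bijective_coord.1 (a, b) (a', b') hab

theorem algebraMap_injective : Function.Injective (algebraMap F K) := by
  intro a b hab
  refine (h.coord_inj (a := a) (b := 0) (a' := b) (b' := 0) ?_).1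
  simp [hab]

theorem conj_coord (a b : F) : ρ (algebraMap F K a + algebraMap F K b * θ) =
    algebraMap F K (a + b * s) + algebraMap F K (-b) * θ := by
  simp only [map_add, map_mul, map_neg, h.conj_algebraMap, h.conj_theta]
  ring

theorem conj_conj (x : K) : ρ (ρ x) = x := by
  obtain ⟨a, b, rfl⟩ := h.exists_coord x
  rw [h.conj_coord, h.conj_coord]
  simp

theorem sub_conj_mul_self : (θ - ρ θ) * (θ - ρ θ) = algebraMap F K (s ^ 2 - 4 * P) := by
  rw [h.conj_theta]
  simp only [map_sub, map_mul, map_pow, map_ofNat]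
  linear_combination 4 * h.theta_sq

theorem isUnit_sub_conj : IsUnit (θ - ρ θ) := by
  obtain ⟨e, -, he⟩ := h.disc_unit
  refine IsUnit.of_mul_eq_one ((θ - ρ θ) * algebraMap F K e) ?_
  rw [← mul_assoc, h.sub_conj_mul_self, ← map_mul, he, map_one]

theorem conj_eq_self_iff {x : K} : ρ x = x ↔ ∃ a, x = algebraMap F K a := by
  constructor
  · intro hx
    obtain ⟨a, b, rfl⟩ := h.exists_coord x
    have hb : algebraMap F K b * (θ - ρ θ) = 0 := by
      simp only [map_add, map_mul, h.conj_algebraMap] at hx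
      linear_combination -hx
    rw [h.isUnit_sub_conj.mul_left_eq_zero] at hb
    exact ⟨a, by rw [hb]; ring⟩
  · rintro ⟨a, rfl⟩
    exact h.conj_algebraMap a

theorem algebraMap_mem_maxOrder_iff {a : F} : algebraMap F K a ∈ maxOrder g K ↔ a ∈ g := by
  refine ⟨fun ha => ?_, fun ha => (maxOrder g K).algebraMap_mem ⟨a, ha⟩⟩
  have ha_integral : IsIntegral g a := (isIntegral_algebraMap_iff h.algebraMap_injective).1 ha
  obtain ⟨y, rfl⟩ := IsIntegrallyClosed.isIntegral_iff.1 ha_integral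
  exact y.2

theorem theta_mem : θ ∈ maxOrder g K := by
  refine ⟨Polynomial.X ^ 2 - Polynomial.C ⟨s, h.trace_mem⟩ * Polynomial.X +
    Polynomial.C ⟨P, h.norm_mem⟩, ?_, ?_⟩
  · monicity!
  · have coe_s : algebraMap g K ⟨s, h.trace_mem⟩ = algebraMap F K s := rfl
    have coe_P : algebraMap g K ⟨P, h.norm_mem⟩ = algebraMap F K P := rfl
    simp only [Polynomial.eval₂_add, Polynomial.eval₂_sub, Polynomial.eval₂_pow,
      Polynomial.eval₂_X, Polynomial.eval₂_mul, Polynomial.eval₂_C, coe_s, coe_P]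
    linear_combination h.theta_sq

theorem conj_mem {x : K} (hx : x ∈ maxOrder g K) : ρ x ∈ maxOrder g K := by
  let f : K →ₐ[g] K := { ρ with commutes' := fun a => h.conj_algebraMap a }
  exact IsIntegral.map f hx

theorem sub_conj_mem : θ - ρ θ ∈ maxOrder g K :=
  sub_mem h.theta_mem (h.conj_mem h.theta_mem)

theorem mem_of_mul_disc_mem {b : F} (hb : b * (s ^ 2 - 4 * P) ∈ g) : b ∈ g := by
  obtain ⟨e, he, hde⟩ := h.disc_unit
  have hbe := g.mul_mem _ _ hb he
  rwa [mul_assoc, hde, mul_one] at hbe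

theorem coord_mem_maxOrder_iff {a b : F} :
    algebraMap F K a + algebraMap F K b * θ ∈ maxOrder g K ↔ a ∈ g ∧ b ∈ g := by
  constructor
  · intro hx
    have hdisc : (algebraMap F K a + algebraMap F K b * θ -
        ρ (algebraMap F K a + algebraMap F K b * θ)) * (θ - ρ θ) =
          algebraMap F K (b * (s ^ 2 - 4 * P)) := by
      rw [map_mul, ← h.sub_conj_mul_self]
      simp only [map_add, map_mul, h.conj_algebraMap]
      ring
    have hb : b ∈ g := by
      refine h.mem_of_mul_disc_mem (h.algebraMap_mem_maxOrder_iff.1 ?_)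
      rw [← hdisc]
      exact mul_mem (sub_mem hx (h.conj_mem hx)) h.sub_conj_mem
    refine ⟨h.algebraMap_mem_maxOrder_iff.1 ?_, hb⟩
    simpa using sub_mem hx (mul_mem (h.algebraMap_mem_maxOrder_iff.2 hb) h.theta_mem)
  · rintro ⟨ha, hb⟩
    exact add_mem (h.algebraMap_mem_maxOrder_iff.2 ha)
      (mul_mem (h.algebraMap_mem_maxOrder_iff.2 hb) h.theta_mem)

theorem coord_sub_coord_mem_maxOrder_iff {a b a' b' : F} :
    (algebraMap F K a + algebraMap F K b * θ) - (algebraMap F K a' + algebraMap F K b' * θ) ∈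
      maxOrder g K ↔ a - a' ∈ g ∧ b - b' ∈ g := by
  rw [← h.coord_mem_maxOrder_iff, map_sub, map_sub]
  ring_nf

theorem mem_maxOrder_of_trace {x : K} (htr : x + ρ x ∈ maxOrder g K)
    (htr_theta : x * θ + ρ (x * θ) ∈ maxOrder g K) : x ∈ maxOrder g K := by
  obtain ⟨e, he, hde⟩ := h.disc_unit
  have hinv : (θ - ρ θ) * ((θ - ρ θ) * algebraMap F K e) = 1 := by
    rw [← mul_assoc, h.sub_conj_mul_self, ← map_mul, hde, map_one]
  have cramer : x =
      ((x * θ + ρ (x * θ)) - ρ θ * (x + ρ x)) * ((θ - ρ θ) * algebraMap F K e) := by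
    rw [map_mul]
    linear_combination (-x) * hinv
  rw [cramer]
  exact mul_mem (sub_mem htr_theta (mul_mem (h.conj_mem h.theta_mem) htr))
    (mul_mem h.sub_conj_mem (h.algebraMap_mem_maxOrder_iff.2 he))

/-- The algebra `K` in coordinates with respect to `1` and `θ`. -/
noncomputable def coordEquiv : QuadraticAlgebra F (-P) s ≃ₐ[F] K :=
  AlgEquiv.ofBijective (QuadraticAlgebra.lift ⟨θ, by
    rw [h.theta_sq, Algebra.smul_def, Algebra.smul_def, map_neg]; ring⟩) (by
    convert h.bijective_coord.comp (QuadraticAlgebra.equivProd (-P) s).bijective using 1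
    ext z
    simp [QuadraticAlgebra.equivProd, QuadraticAlgebra.lift, Algebra.smul_def])

theorem coordEquiv_apply (z : QuadraticAlgebra F (-P) s) :
    h.coordEquiv z = algebraMap F K z.re + algebraMap F K z.im * θ := by
  simp [coordEquiv, QuadraticAlgebra.lift, Algebra.smul_def]

theorem trace_coord (a b : F) :
    Algebra.trace F K (algebraMap F K a + algebraMap F K b * θ) = 2 * a + b * s := by
  suffices a + (a + s * b) = 2 * a + b * s by
    rw [← h.coordEquiv_apply ⟨a, b⟩, Algebra.trace_eq_of_algEquiv,
      Algebra.trace_eq_matrix_trace (QuadraticAlgebra.basis (-P) s), Matrix.trace_fin_two]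
    simpa [Algebra.leftMulMatrix_eq_repr_mul, QuadraticAlgebra.basis] using this
  ring

theorem algebraMap_trace (x : K) : algebraMap F K (Algebra.trace F K x) = x + ρ x := by
  obtain ⟨a, b, rfl⟩ := h.exists_coord x
  rw [h.trace_coord, h.conj_coord]
  simp only [map_add, map_mul, map_neg, map_ofNat]
  ring

theorem differentTrivial : DifferentTrivial g K := by
  intro x hx
  refine h.mem_maxOrder_of_trace ?_ ?_
  · rw [← h.algebraMap_trace, h.algebraMap_mem_maxOrder_iff]
    simpa using hx 1 (one_mem _)
  · rw [← h.algebraMap_trace, h.algebraMap_mem_maxOrder_iff]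
    exact hx θ h.theta_mem

end IsUnramifiedQuadratic

/-! ### Reduced fractions and denominator ideals -/

section Fractions

variable {F K : Type*} [Field F] [CommRing K] [Algebra F K] {g : ValuationSubring F} {n : ℕ}

theorem IsReducedFraction.exists_mul_eq {x : Matrix (Fin n) (Fin n) K}
    {c d c' d' : Matrix (Fin n) (Fin n) (maxOrder g K)}
    (h : IsReducedFraction g x c d) (h' : IsReducedFraction g x c' d') :
    ∃ e : Matrix (Fin n) (Fin n) (maxOrder g K), e * d = d' := by
  obtain ⟨hd, hdx, u, w, huw⟩ := h
  obtain ⟨-, hdx', -⟩ := h'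
  refine ⟨c' * u + d' * w, ?_⟩
  refine Matrix.map_injective (f := algebraMap (maxOrder g K) K) Subtype.val_injective ?_
  set f := algebraMap (maxOrder g K) K
  have huw' : c.map f * u.map f + d.map f * w.map f = 1 := by
    have := congrArg (fun m => m.map f) huw
    simpa [Matrix.map_add, Matrix.map_mul, Matrix.map_one] using this
  have hd_inv : (x * u.map f + w.map f) * d.map f = 1 := by
    refine mul_eq_one_comm.1 ?_
    rw [mul_add, ← mul_assoc, hdx, huw']
  change ((c' * u + d' * w) * d).map f = d'.map f
  simp only [Matrix.map_mul, Matrix.map_add f (map_add f)]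
  rw [← hdx', mul_assoc (d'.map f), ← mul_add, mul_assoc, hd_inv, mul_one]

theorem IsReducedFraction.denomIdeal_eq {x : Matrix (Fin n) (Fin n) K}
    {c d : Matrix (Fin n) (Fin n) (maxOrder g K)} (h : IsReducedFraction g x c d) :
    denomIdeal g x = Ideal.span {d.det} := by
  refine le_antisymm (Ideal.span_le.2 ?_) (Ideal.span_mono ?_)
  · rintro _ ⟨c', d', h', rfl⟩
    obtain ⟨e, rfl⟩ := h.exists_mul_eq h'
    rw [SetLike.mem_coe, Ideal.mem_span_singleton, Matrix.det_mul]
    exact dvd_mul_left _ _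
  · rintro _ rfl
    exact ⟨c, d, h, rfl⟩

theorem IsReducedFraction.add {x : Matrix (Fin n) (Fin n) K}
    {c d : Matrix (Fin n) (Fin n) (maxOrder g K)} (h : IsReducedFraction g x c d)
    (y : Matrix (Fin n) (Fin n) (maxOrder g K)) :
    IsReducedFraction g (x + y.map (algebraMap (maxOrder g K) K)) (c + d * y) d := by
  obtain ⟨hd, hdx, u, w, huw⟩ := h
  refine ⟨hd, ?_, u, w - y * u, ?_⟩
  · rw [mul_add, hdx, Matrix.map_add _ (map_add _), Matrix.map_mul]
  · rw [← huw, add_mul, mul_sub, mul_assoc]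
    abel

theorem denomIdeal_le_denomIdeal_add (x y : Matrix (Fin n) (Fin n) K)
    (hy : ∀ i j, y i j ∈ maxOrder g K) :
    denomIdeal g x ≤ denomIdeal g (x + y) := by
  refine Ideal.span_mono ?_
  rintro _ ⟨c, d, h, rfl⟩
  exact ⟨_, d, h.add (Matrix.of fun i j => ⟨y i j, hy i j⟩), rfl⟩

theorem denomIdeal_add (x y : Matrix (Fin n) (Fin n) K) (hy : ∀ i j, y i j ∈ maxOrder g K) :
    denomIdeal g (x + y) = denomIdeal g x := by
  refine le_antisymm ?_ (denomIdeal_le_denomIdeal_add x y hy)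
  simpa using denomIdeal_le_denomIdeal_add (x + y) (-y) fun i j => neg_mem (hy i j)

theorem denomIdeal_le_denomIdeal_smul (x : Matrix (Fin n) (Fin n) K) (u : gˣ) :
    denomIdeal g x ≤ denomIdeal g ((u : F) • x) := by
  refine Ideal.span_mono ?_
  rintro _ ⟨c, d, ⟨hd, hdx, a, b, hab⟩, rfl⟩
  refine ⟨(u : g) • c, d, ⟨hd, ?_, (↑u⁻¹ : g) • a, b, ?_⟩, rfl⟩
  · rw [Matrix.mul_smul, hdx]
    ext i j
    simp only [Matrix.smul_apply, Matrix.map_apply]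
    rfl
  · rw [Matrix.smul_mul, Matrix.mul_smul, smul_smul, u.mul_inv, one_smul, hab]

theorem denomIdeal_smul (x : Matrix (Fin n) (Fin n) K) (u : gˣ) :
    denomIdeal g ((u : F) • x) = denomIdeal g x := by
  refine le_antisymm ?_ (denomIdeal_le_denomIdeal_smul x u)
  have := denomIdeal_le_denomIdeal_smul ((u : F) • x) u⁻¹
  rwa [smul_smul, show ((↑u⁻¹ : g) : F) * ((u : g) : F) = 1 from congrArg Subtype.val u.inv_mul,
    one_smul] at this

theorem mul_mem_maxOrder_of_mem_denomIdeal {x : Matrix (Fin n) (Fin n) K} {δ : maxOrder g K}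
    (hδ : δ ∈ denomIdeal g x) (i j : Fin n) : (δ : K) * x i j ∈ maxOrder g K := by
  induction hδ using Submodule.span_induction with
  | mem δ h =>
    obtain ⟨c, d, ⟨hd, hdx, -⟩, rfl⟩ := h
    set f := algebraMap (maxOrder g K) K
    have adjugate_smul : (d.det : K) • x = (d.adjugate * c).map f := by
      rw [Matrix.map_mul, ← hdx, ← mul_assoc, ← Matrix.map_mul, Matrix.adjugate_mul,
        Matrix.map_smul' f _ _ (map_mul f), Matrix.map_one f (map_zero f) (map_one f),
        smul_one_mul]
      rfl
    rw [← smul_eq_mul, ← Matrix.smul_apply, adjugate_smul]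
    exact ((d.adjugate * c) i j).2
  | zero => simp
  | add a b _ _ ha hb =>
    rw [Subalgebra.coe_add, add_mul]
    exact add_mem ha hb
  | smul a b _ hb =>
    rw [smul_eq_mul, Subalgebra.coe_mul, mul_assoc]
    exact mul_mem a.2 hb

variable {F' K' : Type*} [Field F'] [CommRing K'] [Algebra F' K'] {g' : ValuationSubring F'}

/-- The restriction to the maximal orders of a ring homomorphism that preserves them. -/
def maxOrderMap (ψ : K →+* K') (hψ : ∀ x ∈ maxOrder g K, ψ x ∈ maxOrder g' K') :
    maxOrder g K →+* maxOrder g' K' :=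
  ψ.restrict (maxOrder g K) (maxOrder g' K') hψ

theorem IsReducedFraction.map {x : Matrix (Fin n) (Fin n) K}
    {c d : Matrix (Fin n) (Fin n) (maxOrder g K)} (h : IsReducedFraction g x c d)
    (ψ : K →+* K') (hψ : ∀ x ∈ maxOrder g K, ψ x ∈ maxOrder g' K') :
    IsReducedFraction g' (x.map ψ) (c.map (maxOrderMap ψ hψ)) (d.map (maxOrderMap ψ hψ)) := by
  obtain ⟨hd, hdx, u, w, huw⟩ := h
  have map_map : ∀ e : Matrix (Fin n) (Fin n) (maxOrder g K),
      (e.map (maxOrderMap ψ hψ)).map (algebraMap (maxOrder g' K') K') =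
        (e.map (algebraMap (maxOrder g K) K)).map ψ := fun e => rfl
  refine ⟨?_, ?_, u.map (maxOrderMap ψ hψ), w.map (maxOrderMap ψ hψ), ?_⟩
  · rw [map_map, ← RingHom.mapMatrix_apply, ← RingHom.map_det]
    exact hd.map ψ
  · rw [map_map, map_map, ← Matrix.map_mul, hdx]
  · rw [← Matrix.map_mul, ← Matrix.map_mul, ← Matrix.map_add _ (map_add _), huw]
    simp

theorem map_mem_denomIdeal {x : Matrix (Fin n) (Fin n) K}
    (ψ : K →+* K') (hψ : ∀ x ∈ maxOrder g K, ψ x ∈ maxOrder g' K')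
    {δ : maxOrder g K} (hδ : δ ∈ denomIdeal g x) :
    maxOrderMap ψ hψ δ ∈ denomIdeal g' (x.map ψ) := by
  suffices hle : denomIdeal g x ≤ (denomIdeal g' (x.map ψ)).comap (maxOrderMap ψ hψ) from hle hδ
  refine Ideal.span_le.2 ?_
  rintro _ ⟨c, d, h, rfl⟩
  refine Ideal.subset_span ⟨_, _, h.map ψ hψ, ?_⟩
  rw [← RingHom.mapMatrix_apply, ← RingHom.map_det]

theorem IsReducedFraction.map_mem_denomIdeal_iff {x : Matrix (Fin n) (Fin n) K}
    {c d : Matrix (Fin n) (Fin n) (maxOrder g K)} (h : IsReducedFraction g x c d) (ψ : K →+* K')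
    (hψ : ∀ x, ψ x ∈ maxOrder g' K' ↔ x ∈ maxOrder g K) {δ : maxOrder g K} :
    maxOrderMap ψ (fun x => (hψ x).2) δ ∈ denomIdeal g' (x.map ψ) ↔ δ ∈ denomIdeal g x := by
  refine ⟨fun hδ => ?_, map_mem_denomIdeal ψ _⟩
  rw [(h.map ψ fun x => (hψ x).2).denomIdeal_eq, ← RingHom.mapMatrix_apply, ← RingHom.map_det,
    Ideal.mem_span_singleton'] at hδ
  rw [h.denomIdeal_eq, Ideal.mem_span_singleton']
  obtain ⟨a, ha⟩ := hδ
  obtain ⟨v, hv⟩ : IsUnit (d.det : K) := by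
    have := h.1
    rwa [← RingHom.mapMatrix_apply, ← RingHom.map_det] at this
  have ha' : (a : K') * ψ v = ψ δ := by
    rw [hv]
    exact congrArg Subtype.val ha
  have quotient_eq : ψ ((δ : K) * (↑v⁻¹ : K)) = a := by
    rw [map_mul, ← ha', mul_assoc, ← map_mul, v.mul_inv, map_one, mul_one]
  refine ⟨⟨(δ : K) * (↑v⁻¹ : K), (hψ _).1 (quotient_eq ▸ a.2)⟩, Subtype.ext ?_⟩
  change (δ : K) * (↑v⁻¹ : K) * (d.det : K) = δ
  rw [← hv, mul_assoc, v.inv_mul, mul_one]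

end Fractions

/-! ### Ideals of discrete valuation rings and the index `ν` -/

section Index

section DiscreteValuationRing

variable {R : Type*} [CommRing R] [IsDomain R] [IsDiscreteValuationRing R] {ϖ : R}
  (hϖ : Irreducible ϖ)
include hϖ

theorem card_quotient_span_pow (m : ℕ) :
    Nat.card (R ⧸ Ideal.span {ϖ ^ m}) = Nat.card (IsLocalRing.ResidueField R) ^ m := by
  rw [← Ideal.span_singleton_pow, ← hϖ.maximalIdeal_eq]
  exact cardQuot_pow_of_prime (IsDiscreteValuationRing.not_a_field R)

theorem card_quotient_eq_card_residueField_pow_iff [Finite (IsLocalRing.ResidueField R)]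
    (I : Ideal R) (k : ℕ) :
    Nat.card (R ⧸ I) = Nat.card (IsLocalRing.ResidueField R) ^ k ↔
      ∀ m, ϖ ^ m ∈ I ↔ k ≤ m := by
  have one_lt_card : 1 < Nat.card (IsLocalRing.ResidueField R) := Finite.one_lt_card
  rcases eq_or_ne I ⊥ with rfl | hI
  · refine iff_of_false (fun hcard => ?_) fun hpow => ?_
    · have : Finite (R ⧸ (⊥ : Ideal R)) :=
        Nat.finite_of_card_ne_zero (hcard ▸ pow_ne_zero _ (by lia))
      have : Finite R := Finite.of_equiv _ (RingEquiv.quotientBot R).toEquiv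
      exact IsDiscreteValuationRing.not_isField R (Finite.isField_of_domain R)
    · exact pow_ne_zero k hϖ.ne_zero (Ideal.mem_bot.1 ((hpow k).2 le_rfl))
  · obtain ⟨l, rfl⟩ := IsDiscreteValuationRing.ideal_eq_span_pow_irreducible hI hϖ
    simp only [card_quotient_span_pow hϖ, Nat.pow_right_inj one_lt_card, Ideal.mem_span_singleton,
      pow_dvd_pow_iff hϖ.ne_zero hϖ.not_isUnit]
    exact ⟨by rintro rfl; simp, fun h => le_antisymm ((h k).2 le_rfl) ((h l).1 le_rfl)⟩

end DiscreteValuationRing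

variable {F K : Type*} [Field F] [CommRing K] [Algebra F K] {g : ValuationSubring F}
  [IsDiscreteValuationRing g] [Finite (IsLocalRing.ResidueField g)] {n : ℕ}

theorem nu_eq_pow_iff {ϖ : g} (hϖ : Irreducible ϖ) (x : Matrix (Fin n) (Fin n) K) (k : ℕ) :
    nu g x = resCard g ^ k ↔
      ∀ m, algebraMap g (maxOrder g K) (ϖ ^ m) ∈ denomIdeal g x ↔ k ≤ m :=
  card_quotient_eq_card_residueField_pow_iff hϖ _ k

end Index

/-! ### Character sums over sets with an action of the units -/

section CharacterSum

variable {F : Type*} [Field F] {g : ValuationSubring F}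

theorem HasConductorOne.apply_eq_one {χ : AddChar F Circle} (hχ : HasConductorOne g χ) {a : F}
    (ha : a ∈ g) : χ a = 1 := by
  simpa using (hχ a).1 ha 1 g.one_mem

theorem HasConductorOne.apply_eq {χ : AddChar F Circle} (hχ : HasConductorOne g χ) {a b : F}
    (hab : a - b ∈ g) : χ a = χ b := by
  rw [← sub_add_cancel a b, AddChar.map_add_eq_mul, hχ.apply_eq_one hab, one_mul]

theorem mem_iff_mem_of_sub_mem {a b : F} (hab : a - b ∈ g) : a ∈ g ↔ b ∈ g :=
  ⟨fun ha => by simpa using sub_mem ha hab, fun hb => by simpa using add_mem hab hb⟩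

theorem unit_mul_mem_iff (u : gˣ) (a : F) : (u : F) * a ∈ g ↔ a ∈ g := by
  refine ⟨fun h => ?_, fun h => g.mul_mem _ _ u.1.2 h⟩
  have := g.mul_mem _ _ (↑u⁻¹ : g).2 h
  rwa [← mul_assoc, show ((↑u⁻¹ : g) : F) * ((u : g) : F) = 1 from
    congrArg Subtype.val u.inv_mul, one_mul] at this

theorem HasConductorOne.mulShift {χ : AddChar F Circle} (hχ : HasConductorOne g χ) (u : gˣ) :
    HasConductorOne g (χ.mulShift u) := by
  intro a
  rw [← unit_mul_mem_iff u a, hχ]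
  simp only [AddChar.mulShift_apply, mul_assoc]

theorem residue_out (b : IsLocalRing.ResidueField g) : IsLocalRing.residue g b.out = b :=
  Quotient.out_eq b

section Uniformizer

variable {ϖ : g} (hϖ : Irreducible ϖ)
include hϖ

theorem uniformizer_ne_zero : (ϖ : F) ≠ 0 := by
  simpa using hϖ.ne_zero

theorem uniformizer_mul_inv_mem : (ϖ : F) * (ϖ : F)⁻¹ ∈ g := by
  rw [mul_inv_cancel₀ (uniformizer_ne_zero hϖ)]
  exact g.one_mem

theorem uniformizer_inv_notMem : (ϖ : F)⁻¹ ∉ g := fun h =>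
  hϖ.not_isUnit (IsUnit.of_mul_eq_one ⟨_, h⟩
    (Subtype.ext (mul_inv_cancel₀ (uniformizer_ne_zero hϖ))))

theorem isUnit_one_add_uniformizer_pow_mul (b : g) {m : ℕ} (hm : m ≠ 0) :
    IsUnit (1 + ϖ ^ m * b) := by
  have hmem : ϖ ^ m * b ∈ IsLocalRing.maximalIdeal g :=
    Ideal.mul_mem_right _ _ (Ideal.pow_mem_of_mem _ hϖ.not_isUnit _ (Nat.pos_of_ne_zero hm))
  simpa using IsLocalRing.isUnit_one_sub_self_of_mem_nonunits _ (neg_mem hmem)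

variable [IsDiscreteValuationRing g]

theorem exists_uniformizer_pow_mul_mem (a : F) : ∃ m : ℕ, (ϖ : F) ^ m * a ∈ g := by
  obtain ⟨x, y, hy, rfl⟩ := IsFractionRing.div_surjective (A := g) a
  obtain ⟨m, u, rfl⟩ :=
    IsDiscreteValuationRing.eq_unit_mul_pow_irreducible (nonZeroDivisors.ne_zero hy) hϖ
  refine ⟨m, ?_⟩
  have h0 := uniformizer_ne_zero hϖ
  have hu : ((↑u⁻¹ : g) : F) * ((u : g) : F) = 1 := congrArg Subtype.val u.inv_mul
  have hu0 : ((u : g) : F) ≠ 0 := right_ne_zero_of_mul_eq_one hu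
  have cancel : (ϖ : F) ^ m * (algebraMap g F x / algebraMap g F (u * ϖ ^ m)) =
      ((↑u⁻¹ * x : g) : F) := by
    simp only [map_mul, map_pow]
    change (ϖ : F) ^ m * ((x : F) / ((u : g) * (ϖ : F) ^ m)) = ((↑u⁻¹ : g) : F) * x
    field_simp
    linear_combination (-(x : F)) * hu
  rw [cancel]
  exact Subtype.mem _

theorem mul_sub_mul_mem_of_residue_eq {w : F} (hw : (ϖ : F) * w ∈ g) {a b : g}
    (hab : IsLocalRing.residue g a = IsLocalRing.residue g b) : w * a - w * b ∈ g := by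
  have hsub : a - b ∈ IsLocalRing.maximalIdeal g := Ideal.Quotient.eq.1 hab
  rw [hϖ.maximalIdeal_eq, Ideal.mem_span_singleton] at hsub
  obtain ⟨c, hc⟩ := hsub
  have hc' : (a : F) - b = ϖ * c := congrArg Subtype.val hc
  rw [show w * a - w * b = (ϖ : F) * w * c by linear_combination w * hc']
  exact g.mul_mem _ _ hw c.2

theorem inv_uniformizer_mul_out_zero_mem :
    (ϖ : F)⁻¹ * ((0 : IsLocalRing.ResidueField g).out : g) ∈ g := by
  simpa using mul_sub_mul_mem_of_residue_eq hϖ (uniformizer_mul_inv_mem hϖ)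
    (b := 0) (by rw [residue_out, map_zero])

theorem sub_inv_uniformizer_mul_out_mem_iff (a : F) (b : IsLocalRing.ResidueField g) :
    a - (ϖ : F)⁻¹ * (b.out : g) ∈ g ↔
      ∃ h : (ϖ : F) * a ∈ g, IsLocalRing.residue g ⟨_, h⟩ = b := by
  have hϖ0 := uniformizer_ne_zero hϖ
  constructor
  · intro h
    have expand : (ϖ : F) * a = ϖ * (a - (ϖ : F)⁻¹ * (b.out : g)) + (b.out : g) := by
      field_simp; ring
    have hmem : (ϖ : F) * a ∈ g := by
      rw [expand]
      exact add_mem (g.mul_mem _ _ ϖ.2 h) b.out.2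
    refine ⟨hmem, ?_⟩
    rw [show (⟨_, hmem⟩ : g) = ϖ * ⟨_, h⟩ + b.out from Subtype.ext expand, map_add, map_mul,
      residue_out, (IsLocalRing.residue_eq_zero_iff _).2 hϖ.not_isUnit, zero_mul, zero_add]
  · rintro ⟨h, hb⟩
    have := mul_sub_mul_mem_of_residue_eq hϖ (a := ⟨_, h⟩) (b := b.out)
      (uniformizer_mul_inv_mem hϖ) (by rw [hb, residue_out])
    rwa [inv_mul_cancel_left₀ hϖ0] at this

theorem sum_char_mul_out_eq_zero [Fintype (IsLocalRing.ResidueField g)] {χ : AddChar F Circle}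
    (hχ : HasConductorOne g χ) {w : F} (hw : (ϖ : F) * w ∈ g) (hw' : w ∉ g) :
    ∑ b : IsLocalRing.ResidueField g, (χ (w * (b.out : g)) : ℂ) = 0 := by
  obtain ⟨b₀, hb₀, hne⟩ : ∃ b ∈ g, χ (w * b) ≠ 1 := by
    by_contra! h
    exact hw' ((hχ w).2 h)
  have hshift : ∀ b : IsLocalRing.ResidueField g,
      χ (w * ((b + IsLocalRing.residue g ⟨b₀, hb₀⟩).out : g)) =
        χ (w * (b.out : g)) * χ (w * b₀) := by
    intro b
    rw [← AddChar.map_add_eq_mul, ← mul_add]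
    refine hχ.apply_eq (mul_sub_mul_mem_of_residue_eq hϖ hw (b := b.out + ⟨b₀, hb₀⟩) ?_)
    rw [residue_out, map_add, residue_out]
  have hsum : ∑ b : IsLocalRing.ResidueField g, (χ (w * (b.out : g)) : ℂ) =
      (∑ b : IsLocalRing.ResidueField g, (χ (w * (b.out : g)) : ℂ)) * χ (w * b₀) := by
    rw [Finset.sum_mul, ← Equiv.sum_comp (Equiv.addRight (IsLocalRing.residue g ⟨b₀, hb₀⟩))]
    refine Finset.sum_congr rfl fun b _ => ?_
    rw [Equiv.coe_addRight, hshift, Circle.coe_mul]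
  have hne' : (χ (w * b₀) : ℂ) ≠ 1 := by rwa [Ne, Circle.coe_eq_one]
  by_contra h0
  exact hne' (mul_left_cancel₀ h0 (by rw [← hsum, mul_one]))

open Classical in
theorem sum_char_filter_eq_sum_card_mul [Fintype (IsLocalRing.ResidueField g)]
    {χ : AddChar F Circle} (hχ : HasConductorOne g χ) {X : Type*} [Fintype X] (t : X → F) :
    ∑ x with (ϖ : F) * t x ∈ g, (χ (t x) : ℂ) =
      ∑ b : IsLocalRing.ResidueField g,
        (Nat.card {x // t x - (ϖ : F)⁻¹ * (b.out : g) ∈ g} : ℂ) *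
          χ ((ϖ : F)⁻¹ * (b.out : g)) := by
  have hfiber : ∀ b : IsLocalRing.ResidueField g,
      (Nat.card {x // t x - (ϖ : F)⁻¹ * (b.out : g) ∈ g} : ℂ) * χ ((ϖ : F)⁻¹ * (b.out : g)) =
        ∑ x, if t x - (ϖ : F)⁻¹ * (b.out : g) ∈ g then (χ (t x) : ℂ) else 0 := by
    intro b
    rw [← Finset.sum_filter, Nat.card_eq_fintype_card, Fintype.card_subtype, ← nsmul_eq_mul,
      ← Finset.sum_const]
    refine Finset.sum_congr rfl fun x hx => ?_
    rw [hχ.apply_eq (Finset.mem_filter.1 hx).2]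
  rw [Finset.sum_congr rfl fun b _ => hfiber b, Finset.sum_comm, Finset.sum_filter]
  refine Finset.sum_congr rfl fun x _ => ?_
  by_cases h : (ϖ : F) * t x ∈ g <;> simp [sub_inv_uniformizer_mul_out_mem_iff hϖ, h]

end Uniformizer

/-- A family `t` of elements of `F` whose classes modulo `g` are permuted, with multiplicities, by
the multiplication with each unit of `g`. -/
def IsUnitEquivariant (g : ValuationSubring F) {X : Type*} (t : X → F) : Prop :=
  ∀ u : gˣ, ∃ e : Equiv.Perm X, ∀ x, t (e x) - (u : F) * t x ∈ g

namespace IsUnitEquivariant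

variable {X : Type*} {t : X → F} (ht : IsUnitEquivariant g t)
include ht

theorem card_sub_unit_mul_mem (u : gˣ) (a : F) :
    Nat.card {x // t x - (u : F) * a ∈ g} = Nat.card {x // t x - a ∈ g} := by
  obtain ⟨e, he⟩ := ht u
  refine (Nat.card_congr (e.subtypeEquiv fun x => ?_)).symm
  rw [← unit_mul_mem_iff u (t x - a)]
  refine (mem_iff_mem_of_sub_mem ?_).symm
  convert he x using 1
  ring

variable [Fintype X] {ϖ : g} (hϖ : Irreducible ϖ) {χ : AddChar F Circle}
  (hχ : HasConductorOne g χ)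
include hϖ hχ

open Classical in
theorem sum_char_level_mul {m : ℕ} (hm : m ≠ 0) (b : g) :
    ∑ x with (ϖ : F) ^ (m + 1) * t x ∈ g ∧ (ϖ : F) ^ m * t x ∉ g,
        (χ (t x) : ℂ) * χ ((ϖ : F) ^ m * t x * b) =
      ∑ x with (ϖ : F) ^ (m + 1) * t x ∈ g ∧ (ϖ : F) ^ m * t x ∉ g, (χ (t x) : ℂ) := by
  obtain ⟨u, hu⟩ := isUnit_one_add_uniformizer_pow_mul hϖ b hm
  obtain ⟨e, he⟩ := ht u
  have hlevel : ∀ k x, (ϖ : F) ^ k * t (e x) ∈ g ↔ (ϖ : F) ^ k * t x ∈ g := by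
    intro k x
    rw [← unit_mul_mem_iff u ((ϖ : F) ^ k * t x)]
    refine mem_iff_mem_of_sub_mem ?_
    convert g.mul_mem _ _ (ϖ ^ k).2 (he x) using 1
    push_cast
    ring
  refine Finset.sum_equiv e (fun x => by simp [hlevel]) fun x _ => ?_
  rw [← Circle.coe_mul, ← AddChar.map_add_eq_mul]
  congr 1
  refine (hχ.apply_eq ?_).symm
  have hu' : (u : F) = 1 + (ϖ : F) ^ m * b := by rw [hu]; rfl
  convert he x using 1
  rw [hu']
  ring

variable [IsDiscreteValuationRing g] [Finite (IsLocalRing.ResidueField g)]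

open Classical in
theorem sum_char_level_eq_zero {m : ℕ} (hm : m ≠ 0) :
    ∑ x with (ϖ : F) ^ (m + 1) * t x ∈ g ∧ (ϖ : F) ^ m * t x ∉ g, (χ (t x) : ℂ) = 0 := by
  have := Fintype.ofFinite (IsLocalRing.ResidueField g)
  set E : Finset X := {x | (ϖ : F) ^ (m + 1) * t x ∈ g ∧ (ϖ : F) ^ m * t x ∉ g}
  have average : (Fintype.card (IsLocalRing.ResidueField g) : ℂ) * ∑ x ∈ E, (χ (t x) : ℂ) = 0 := by
    calc (Fintype.card (IsLocalRing.ResidueField g) : ℂ) * ∑ x ∈ E, (χ (t x) : ℂ)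
        = ∑ _b : IsLocalRing.ResidueField g, ∑ x ∈ E, (χ (t x) : ℂ) := by
          rw [Finset.sum_const, Finset.card_univ, nsmul_eq_mul]
      _ = ∑ b : IsLocalRing.ResidueField g, ∑ x ∈ E,
            (χ (t x) : ℂ) * χ ((ϖ : F) ^ m * t x * (b.out : g)) :=
          Finset.sum_congr rfl fun b _ => (ht.sum_char_level_mul hϖ hχ hm b.out).symm
      _ = 0 := by
          rw [Finset.sum_comm]
          refine Finset.sum_eq_zero fun x hx => ?_
          obtain ⟨hmem, hnotMem⟩ := (Finset.mem_filter.1 hx).2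
          rw [pow_succ', mul_assoc] at hmem
          rw [← Finset.mul_sum, sum_char_mul_out_eq_zero hϖ hχ hmem hnotMem, mul_zero]
  exact (mul_eq_zero.1 average).resolve_left (Nat.cast_ne_zero.2 Fintype.card_ne_zero)

open Classical in
theorem sum_char_first_level :
    ∑ x with (ϖ : F) * t x ∈ g, (χ (t x) : ℂ) =
      (Nat.card {x // t x ∈ g} : ℂ) - Nat.card {x // t x - (ϖ : F)⁻¹ ∈ g} := by
  have := Fintype.ofFinite (IsLocalRing.ResidueField g)
  have h0 := inv_uniformizer_mul_out_zero_mem hϖ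
  have card_zero :
      Nat.card {x // t x - (ϖ : F)⁻¹ * ((0 : IsLocalRing.ResidueField g).out : g) ∈ g} =
        Nat.card {x // t x ∈ g} :=
    Nat.card_congr (Equiv.subtypeEquivRight fun x =>
      ⟨fun h => by simpa using add_mem h h0, fun h => sub_mem h h0⟩)
  have card_nonzero : ∀ b : IsLocalRing.ResidueField g, b ≠ 0 →
      Nat.card {x // t x - (ϖ : F)⁻¹ * (b.out : g) ∈ g} =
        Nat.card {x // t x - (ϖ : F)⁻¹ ∈ g} := by
    intro b hb
    obtain ⟨u, hu⟩ : IsUnit b.out := by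
      rwa [← IsLocalRing.residue_ne_zero_iff_isUnit, residue_out]
    rw [← hu, mul_comm, ht.card_sub_unit_mul_mem]
  have sum_residue := sum_char_mul_out_eq_zero hϖ hχ (uniformizer_mul_inv_mem hϖ)
    (uniformizer_inv_notMem hϖ)
  rw [← Finset.add_sum_erase _ _ (Finset.mem_univ 0), hχ.apply_eq_one h0,
    Circle.coe_one] at sum_residue
  rw [sum_char_filter_eq_sum_card_mul hϖ hχ, ← Finset.add_sum_erase _ _ (Finset.mem_univ 0),
    card_zero, hχ.apply_eq_one h0, Circle.coe_one, mul_one,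
    Finset.sum_congr rfl fun b hb => by rw [card_nonzero b (Finset.ne_of_mem_erase hb)],
    ← Finset.mul_sum]
  linear_combination (Nat.card {x // t x - (ϖ : F)⁻¹ ∈ g} : ℂ) * sum_residue

open Classical in
theorem sum_char_filter_eq_card_sub_card (m : ℕ) :
    ∑ x with (ϖ : F) ^ (m + 1) * t x ∈ g, (χ (t x) : ℂ) =
      (Nat.card {x // t x ∈ g} : ℂ) - Nat.card {x // t x - (ϖ : F)⁻¹ ∈ g} := by
  induction m with
  | zero => simpa using ht.sum_char_first_level hϖ hχ
  | succ m ih =>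
    rw [← ih, ← Finset.sum_filter_add_sum_filter_not _ (fun x => (ϖ : F) ^ (m + 1) * t x ∈ g),
      Finset.filter_filter, Finset.filter_filter,
      ht.sum_char_level_eq_zero hϖ hχ m.succ_ne_zero, add_zero]
    refine Finset.sum_congr (Finset.filter_congr fun x _ => ?_) fun _ _ => rfl
    refine and_iff_right_of_imp fun h => ?_
    rw [pow_succ', mul_assoc]
    exact g.mul_mem _ _ ϖ.2 h

theorem sum_char_eq_card_sub_card :
    ∑ x, (χ (t x) : ℂ) =
      (Nat.card {x // t x ∈ g} : ℂ) - Nat.card {x // t x - (ϖ : F)⁻¹ ∈ g} := by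
  classical
  choose m hm using fun x => exists_uniformizer_pow_mul_mem hϖ (t x)
  rw [← ht.sum_char_filter_eq_card_sub_card hϖ hχ (Finset.univ.sup m)]
  refine Finset.sum_congr (Finset.filter_true_of_mem fun x _ => ?_).symm fun _ _ => rfl
  obtain ⟨j, hj⟩ := Nat.exists_eq_add_of_le
    ((Finset.le_sup (f := m) (Finset.mem_univ x)).trans (Nat.le_succ _))
  rw [← Nat.succ_eq_add_one, hj, add_comm, pow_add, mul_assoc]
  exact g.mul_mem _ _ (ϖ ^ j).2 (hm x)

end IsUnitEquivariant

end CharacterSum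

/-! ### The coefficients of the series as differences of cardinalities -/

section Counting

variable {F K : Type*} [Field F] [CommRing K] [Algebra F K]
  {g : ValuationSubring F} {ρ : K →+* K} {n : ℕ}

theorem mem_herm_iff {X : Matrix (Fin n) (Fin n) K} :
    X ∈ herm ρ n ↔ ∀ i j, ρ (X j i) = X i j := by
  change adjT ρ X = X ↔ _
  rw [← Matrix.ext_iff]
  rfl

theorem mk_eq_mk_iff {x y : herm ρ n} :
    (QuotientAddGroup.mk x : herm ρ n ⧸ intHerm g ρ n) = QuotientAddGroup.mk y ↔
      ∀ i j, y.1 i j - x.1 i j ∈ maxOrder g K := by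
  rw [QuotientAddGroup.eq]
  change (∀ i j, (-x + y : herm ρ n).1 i j ∈ maxOrder g K) ↔ _
  refine forall₂_congr fun i j => ?_
  rw [show (-x + y : herm ρ n).1 i j = y.1 i j - x.1 i j by
    simp [neg_add_eq_sub]]

theorem out_sub_mem (x : herm ρ n) (i j : Fin n) :
    (QuotientAddGroup.mk x : herm ρ n ⧸ intHerm g ρ n).out.1 i j - x.1 i j ∈ maxOrder g K := by
  refine mk_eq_mk_iff.1 ?_ i j
  exact (Quotient.out_eq _).symm

theorem nu_out (x : herm ρ n) :
    nu g (QuotientAddGroup.mk x : herm ρ n ⧸ intHerm g ρ n).out.1 = nu g x.1 := by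
  have : (QuotientAddGroup.mk x : herm ρ n ⧸ intHerm g ρ n).out.1 =
    x.1 + ((QuotientAddGroup.mk x : herm ρ n ⧸ intHerm g ρ n).out.1 - x.1) := by simp
  rw [nu, this, denomIdeal_add x.1 (_ - x.1) fun i j => out_sub_mem x i j]
  rfl

theorem nu_smul (x : Matrix (Fin n) (Fin n) K) (u : gˣ) : nu g ((u : F) • x) = nu g x := by
  rw [nu, denomIdeal_smul]
  rfl

theorem conj_trace_mul {ζ σ : Matrix (Fin n) (Fin n) K}
    (hζ : ζ ∈ herm ρ n) (hσ : σ ∈ herm ρ n) : ρ (ζ * σ).trace = (ζ * σ).trace := by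
  rw [Matrix.trace_mul_comm]
  simp only [Matrix.trace, Matrix.diag, Matrix.mul_apply, map_sum, map_mul]
  rw [Finset.sum_comm]
  rw [mem_herm_iff] at hζ hσ
  refine Finset.sum_congr rfl fun i _ => Finset.sum_congr rfl fun j _ => ?_
  rw [hσ, hζ, mul_comm]

theorem trace_mul_mem {ζ σ : Matrix (Fin n) (Fin n) K} (hζ : ∀ i j, ζ i j ∈ maxOrder g K)
    (hσ : ∀ i j, σ i j ∈ maxOrder g K) : (ζ * σ).trace ∈ maxOrder g K :=
  sum_mem fun i _ => by
    rw [Matrix.diag_apply, Matrix.mul_apply]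
    exact sum_mem fun j _ => mul_mem (hζ i j) (hσ j i)

/-- The set of classes `σ` of hermitian matrices with `k(σ) = k` and `tr(ζσ) ∈ c + g`. -/
def fiber (g : ValuationSubring F) (ρ : K →+* K) (ζ : Matrix (Fin n) (Fin n) K) (k : ℕ) (c : F) :
    Set (herm ρ n ⧸ intHerm g ρ n) :=
  {s | nu g s.out.1 = resCard g ^ k ∧ descend (ζ * s.out.1).trace - c ∈ g}

theorem card_fiber_eq_card_level (ζ : Matrix (Fin n) (Fin n) K) (k : ℕ) (c : F) :
    Nat.card (fiber g ρ ζ k c) =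
      Nat.card {x : {s : herm ρ n ⧸ intHerm g ρ n // nu g s.out.1 = resCard g ^ k} //
        descend (ζ * x.1.out.1).trace - c ∈ g} :=
  (Nat.card_congr (Equiv.subtypeSubtypeEquivSubtypeInter
    (fun s : herm ρ n ⧸ intHerm g ρ n => nu g s.out.1 = resCard g ^ k)
    (fun s => descend (ζ * s.out.1).trace - c ∈ g))).symm

variable {θ : K} {s P : F} (h : IsUnramifiedQuadratic g ρ θ s P)
include h

theorem descend_algebraMap (a : F) : descend (algebraMap F K a) = a :=
  Function.leftInverse_invFun h.algebraMap_injective a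

theorem algebraMap_descend_trace {ζ σ : Matrix (Fin n) (Fin n) K}
    (hζ : ζ ∈ herm ρ n) (hσ : σ ∈ herm ρ n) :
    algebraMap F K (descend (ζ * σ).trace) = (ζ * σ).trace := by
  obtain ⟨a, ha⟩ := h.conj_eq_self_iff.1 (conj_trace_mul hζ hσ)
  rw [ha, descend_algebraMap h]

theorem single_add_single_conj_mem_herm (i j : Fin n) (z : K) :
    Matrix.single i j z + Matrix.single j i (ρ z) ∈ herm ρ n := by
  refine mem_herm_iff.2 fun a b => ?_
  simp only [Matrix.add_apply, Matrix.single_apply, map_add]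
  rw [add_comm, apply_ite ρ, apply_ite ρ, h.conj_conj, map_zero]
  congr 1 <;> exact if_congr and_comm rfl rfl

theorem single_add_single_conj_integral (i j : Fin n) {z : K} (hz : z ∈ maxOrder g K)
    (a b : Fin n) :
    (Matrix.single i j z + Matrix.single j i (ρ z)) a b ∈ maxOrder g K := by
  simp only [Matrix.add_apply, Matrix.single_apply]
  refine add_mem ?_ ?_ <;> split_ifs
  exacts [hz, zero_mem _, h.conj_mem hz, zero_mem _]

theorem trace_mul_mem_of_mem_dualLattice {ζ : Matrix (Fin n) (Fin n) K}
    (hζ : ζ ∈ dualLattice g ρ n) {y : Matrix (Fin n) (Fin n) K} (hy : y ∈ herm ρ n)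
    (hy_int : ∀ i j, y i j ∈ maxOrder g K) : (y * ζ).trace ∈ maxOrder g K := by
  obtain ⟨a, ha, hya⟩ := hζ.2 ⟨y, hy⟩ hy_int
  exact (congrArg (· ∈ maxOrder g K) hya).mpr (h.algebraMap_mem_maxOrder_iff.2 ha)

theorem trace_entry_mul_mem_of_mem_dualLattice {ζ : Matrix (Fin n) (Fin n) K}
    (hζ : ζ ∈ dualLattice g ρ n) (i j : Fin n) {z : K} (hz : z ∈ maxOrder g K) :
    ζ i j * z + ρ (ζ i j * z) ∈ maxOrder g K := by
  convert trace_mul_mem_of_mem_dualLattice h hζ (single_add_single_conj_mem_herm h j i z)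
    (single_add_single_conj_integral h j i hz) using 1
  rw [Matrix.add_mul, Matrix.trace_add, Matrix.trace_single_mul, Matrix.trace_single_mul, map_mul,
    mem_herm_iff.1 hζ.1, smul_eq_mul, smul_eq_mul, mul_comm z, mul_comm (ρ z)]

theorem mem_dualLattice_iff {ζ : Matrix (Fin n) (Fin n) K} :
    ζ ∈ dualLattice g ρ n ↔ ζ ∈ herm ρ n ∧ ∀ i j, ζ i j ∈ maxOrder g K := by
  constructor
  · refine fun hζ => ⟨hζ.1, fun i j => h.mem_maxOrder_of_trace ?_
      (trace_entry_mul_mem_of_mem_dualLattice h hζ i j h.theta_mem)⟩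
    simpa using trace_entry_mul_mem_of_mem_dualLattice h hζ i j (one_mem _)
  · rintro ⟨hζ, hζ_int⟩
    refine ⟨hζ, fun y hy => ⟨descend (y.1 * ζ).trace, ?_,
      (algebraMap_descend_trace h y.2 hζ).symm⟩⟩
    rw [← h.algebraMap_mem_maxOrder_iff (K := K), algebraMap_descend_trace h y.2 hζ]
    exact trace_mul_mem hy hζ_int

theorem descend_trace_sub_mem {ζ : Matrix (Fin n) (Fin n) K} (hζ : ζ ∈ dualLattice g ρ n)
    {x y : Matrix (Fin n) (Fin n) K} (hx : x ∈ herm ρ n) (hy : y ∈ herm ρ n)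
    (hxy : ∀ i j, x i j - y i j ∈ maxOrder g K) :
    descend (ζ * x).trace - descend (ζ * y).trace ∈ g := by
  rw [← h.algebraMap_mem_maxOrder_iff (K := K), map_sub, algebraMap_descend_trace h hζ.1 hx,
    algebraMap_descend_trace h hζ.1 hy, ← Matrix.trace_sub, ← Matrix.mul_sub]
  exact trace_mul_mem ((mem_dualLattice_iff h).1 hζ).2 hxy

theorem descend_trace_out_sub_mem {ζ : Matrix (Fin n) (Fin n) K} (hζ : ζ ∈ dualLattice g ρ n)
    (x : herm ρ n) :
    descend (ζ * (QuotientAddGroup.mk x : herm ρ n ⧸ intHerm g ρ n).out.1).trace -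
      descend (ζ * x.1).trace ∈ g :=
  descend_trace_sub_mem h hζ (Subtype.mem _) x.2 (out_sub_mem x)

theorem mk_mem_fiber_iff {ζ : Matrix (Fin n) (Fin n) K} (hζ : ζ ∈ dualLattice g ρ n) (k : ℕ)
    (c : F) (x : herm ρ n) :
    (QuotientAddGroup.mk x : herm ρ n ⧸ intHerm g ρ n) ∈ fiber g ρ ζ k c ↔
      nu g x.1 = resCard g ^ k ∧ descend (ζ * x.1).trace - c ∈ g := by
  rw [fiber, Set.mem_ofPred_eq, nu_out]
  refine and_congr_right fun _ => mem_iff_mem_of_sub_mem ?_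
  rw [sub_sub_sub_cancel_right]
  exact descend_trace_out_sub_mem h hζ x

theorem smul_mem_herm (a : F) {x : Matrix (Fin n) (Fin n) K} (hx : x ∈ herm ρ n) :
    a • x ∈ herm ρ n := by
  rw [mem_herm_iff] at hx ⊢
  intro i j
  rw [Matrix.smul_apply, Matrix.smul_apply, Algebra.smul_def, Algebra.smul_def, map_mul,
    h.conj_algebraMap, hx]

theorem descend_trace_smul (a : F) {ζ x : Matrix (Fin n) (Fin n) K} (hζ : ζ ∈ herm ρ n)
    (hx : x ∈ herm ρ n) : descend (ζ * (a • x)).trace = a * descend (ζ * x).trace := by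
  refine h.algebraMap_injective ?_
  rw [algebraMap_descend_trace h hζ (smul_mem_herm h a hx), map_mul,
    algebraMap_descend_trace h hζ hx, Matrix.mul_smul, Matrix.trace_smul, Algebra.smul_def]

/-- Multiplication by a unit of `g`, as an automorphism of the group of hermitian matrices. -/
noncomputable def unitSMul (u : gˣ) : herm ρ n ≃+ herm ρ n where
  toFun x := ⟨(u : F) • x.1, smul_mem_herm h u x.2⟩
  invFun x := ⟨((↑u⁻¹ : g) : F) • x.1, smul_mem_herm h _ x.2⟩
  left_inv x := Subtype.ext <| by
    change ((↑u⁻¹ : g) : F) • (u : F) • x.1 = x.1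
    rw [smul_smul, show ((↑u⁻¹ : g) : F) * ((u : g) : F) = 1 from congrArg Subtype.val u.inv_mul,
      one_smul]
  right_inv x := Subtype.ext <| by
    change (u : F) • ((↑u⁻¹ : g) : F) • x.1 = x.1
    rw [smul_smul, show ((u : g) : F) * ((↑u⁻¹ : g) : F) = 1 from congrArg Subtype.val u.mul_inv,
      one_smul]
  map_add' x y := Subtype.ext (smul_add _ _ _)

theorem unitSMul_mem_intHerm (u : gˣ) {x : herm ρ n} (hx : x ∈ intHerm g ρ n) :
    unitSMul h u x ∈ intHerm g ρ n := fun i j => by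
  change (u : F) • x.1 i j ∈ maxOrder g K
  rw [Algebra.smul_def]
  exact mul_mem (h.algebraMap_mem_maxOrder_iff.2 u.1.2) (hx i j)

theorem map_unitSMul_intHerm (u : gˣ) :
    (intHerm g ρ n).map (unitSMul h u).toAddMonoidHom = intHerm g ρ n := by
  refine le_antisymm ?_ fun x hx => ⟨unitSMul h u⁻¹ x, unitSMul_mem_intHerm h u⁻¹ hx, ?_⟩
  · rintro _ ⟨x, hx, rfl⟩
    exact unitSMul_mem_intHerm h u hx
  · exact (unitSMul h u).apply_symm_apply x

/-- The automorphism of the group of classes of hermitian matrices that is induced by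
`unitSMul`. -/
noncomputable def classUnitSMul (u : gˣ) :
    herm ρ n ⧸ intHerm g ρ n ≃+ herm ρ n ⧸ intHerm g ρ n :=
  QuotientAddGroup.congr _ _ (unitSMul h u) (map_unitSMul_intHerm h u)

theorem classUnitSMul_eq_mk (u : gˣ) (s : herm ρ n ⧸ intHerm g ρ n) :
    classUnitSMul h u s = QuotientAddGroup.mk (unitSMul h u s.out) := by
  conv_lhs => rw [← Quotient.out_eq s]
  rfl

theorem nu_classUnitSMul_out (u : gˣ) (s : herm ρ n ⧸ intHerm g ρ n) :
    nu g (classUnitSMul h u s).out.1 = nu g s.out.1 := by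
  rw [classUnitSMul_eq_mk, nu_out]
  exact nu_smul s.out.1 u

theorem isUnitEquivariant_descend_trace {ζ : Matrix (Fin n) (Fin n) K}
    (hζ : ζ ∈ dualLattice g ρ n) (N : ℕ) :
    IsUnitEquivariant g fun x : {s : herm ρ n ⧸ intHerm g ρ n // nu g s.out.1 = N} =>
      descend (ζ * x.1.out.1).trace := by
  refine fun u => ⟨Equiv.Perm.subtypePerm (classUnitSMul h u).toEquiv fun s => ?_, fun x => ?_⟩
  · exact iff_of_eq (congrArg (· = N) (nu_classUnitSMul_out h u s))
  · have hsub := descend_trace_out_sub_mem h hζ (unitSMul h u x.1.out)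
    rw [← classUnitSMul_eq_mk] at hsub
    rw [← descend_trace_smul h _ hζ.1 (Subtype.mem _)]
    exact hsub

theorem seriesA_smul {χ : AddChar F Circle} (u : F) {ζ : Matrix (Fin n) (Fin n) K}
    (hζ : ζ ∈ herm ρ n) : seriesA g ρ χ (u • ζ) = seriesA g ρ (χ.mulShift u) ζ := by
  ext k
  rw [seriesA, seriesA, PowerSeries.coeff_mk, PowerSeries.coeff_mk]
  refine finsum_congr fun x => ?_
  rw [Matrix.smul_mul, ← Matrix.mul_smul, descend_trace_smul h u hζ (Subtype.mem _)]
  rfl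

theorem sub_mem_maxOrder_of_scaled_coord {ϖ : g} (hϖ : Irreducible ϖ) {k : ℕ} {x y : K}
    {a b a' b' : g}
    (hx : algebraMap F K ((ϖ : F) ^ k) * x = algebraMap F K a + algebraMap F K b * θ)
    (hy : algebraMap F K ((ϖ : F) ^ k) * y = algebraMap F K a' + algebraMap F K b' * θ)
    (ha : ϖ ^ k ∣ a - a') (hb : ϖ ^ k ∣ b - b') : x - y ∈ maxOrder g K := by
  obtain ⟨α, hα⟩ := ha
  obtain ⟨β, hβ⟩ := hb
  have hu : IsUnit (algebraMap F K ((ϖ : F) ^ k)) :=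
    (IsUnit.mk0 _ (pow_ne_zero _ (uniformizer_ne_zero hϖ))).map _
  have hα' := congrArg (fun z : g => algebraMap F K z) hα
  have hβ' := congrArg (fun z : g => algebraMap F K z) hβ
  simp only [g.coe_sub, g.coe_mul, g.coe_pow, map_sub, map_mul] at hα' hβ'
  have hsub : x - y = algebraMap F K α + algebraMap F K β * θ := by
    refine hu.mul_left_cancel ?_
    linear_combination hx - hy + hα' + θ * hβ'
  rw [hsub, h.coord_mem_maxOrder_iff]
  exact ⟨α.2, β.2⟩

variable [IsDiscreteValuationRing g] [Finite (IsLocalRing.ResidueField g)]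

theorem exists_scaled_coord {ϖ : g} (hϖ : Irreducible ϖ) {x : Matrix (Fin n) (Fin n) K} {k : ℕ}
    (hx : nu g x = resCard g ^ k) (i j : Fin n) :
    ∃ a b : g, algebraMap F K ((ϖ : F) ^ k) * x i j =
      algebraMap F K a + algebraMap F K b * θ := by
  have hmem : algebraMap F K ((ϖ : F) ^ k) * x i j ∈ maxOrder g K :=
    mul_mem_maxOrder_of_mem_denomIdeal (((nu_eq_pow_iff hϖ _ k).1 hx k).2 le_rfl) i j
  obtain ⟨a, b, hab⟩ := h.exists_coord (algebraMap F K ((ϖ : F) ^ k) * x i j)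
  rw [hab, h.coord_mem_maxOrder_iff] at hmem
  exact ⟨⟨a, hmem.1⟩, ⟨b, hmem.2⟩, hab⟩

theorem finite_level (k : ℕ) :
    Finite {s : herm ρ n ⧸ intHerm g ρ n // nu g s.out.1 = resCard g ^ k} := by
  obtain ⟨ϖ, hϖ⟩ := IsDiscreteValuationRing.exists_irreducible g
  have : Finite (g ⧸ Ideal.span {ϖ ^ k}) := Nat.finite_of_card_ne_zero <| by
    rw [card_quotient_span_pow hϖ]
    exact pow_ne_zero _ Nat.card_pos.ne'
  choose a b hab using
    fun s : {s : herm ρ n ⧸ intHerm g ρ n // nu g s.out.1 = resCard g ^ k} =>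
      exists_scaled_coord h hϖ s.2
  refine Finite.of_injective (β := Fin n → Fin n →
    (g ⧸ Ideal.span {ϖ ^ k}) × (g ⧸ Ideal.span {ϖ ^ k}))
    (fun s i j => (Ideal.Quotient.mk _ (a s i j), Ideal.Quotient.mk _ (b s i j))) ?_
  intro s s' hss
  refine Subtype.ext ?_
  rw [← Quotient.out_eq s.1, ← Quotient.out_eq s'.1]
  refine mk_eq_mk_iff.2 fun i j => ?_
  have hcongr := congrFun (congrFun hss.symm i) j
  simp only [Prod.mk.injEq, Ideal.Quotient.eq, Ideal.mem_span_singleton] at hcongr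
  exact sub_mem_maxOrder_of_scaled_coord h hϖ (hab s' i j) (hab s i j) hcongr.1 hcongr.2

theorem finite_fiber (ζ : Matrix (Fin n) (Fin n) K) (k : ℕ) (c : F) :
    Finite (fiber g ρ ζ k c) :=
  have := finite_level (n := n) h k
  Finite.of_injective
    (β := {s : herm ρ n ⧸ intHerm g ρ n // nu g s.out.1 = resCard g ^ k})
    (fun t => ⟨t.1, t.2.1⟩) fun _ _ htt => Subtype.ext (congrArg (·.1) htt)

theorem coeff_seriesA {χ : AddChar F Circle} (hχ : HasConductorOne g χ)
    {ζ : Matrix (Fin n) (Fin n) K} (hζ : ζ ∈ dualLattice g ρ n) {ϖ : g} (hϖ : Irreducible ϖ)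
    (k : ℕ) : PowerSeries.coeff k (seriesA g ρ χ ζ) =
      (Nat.card (fiber g ρ ζ k 0) : ℂ) - Nat.card (fiber g ρ ζ k (ϖ : F)⁻¹) := by
  have := finite_level (n := n) h k
  have := Fintype.ofFinite {s : herm ρ n ⧸ intHerm g ρ n // nu g s.out.1 = resCard g ^ k}
  simp only [card_fiber_eq_card_level]
  rw [seriesA, PowerSeries.coeff_mk, finsum_eq_sum_of_fintype,
    (isUnitEquivariant_descend_trace h hζ _).sum_char_eq_card_sub_card hϖ hχ]
  simp only [sub_zero]

end Counting

/-! ### Cyclic base change of prime degree -/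

theorem card_modEq_of_range_eq_fixedPoints {X Y : Type*} [Finite X] {p : ℕ} [Fact p.Prime]
    {f : X → X} (hf : ∀ x, f^[p] x = x) {i : Y → X} (hi : Function.Injective i)
    (hrange : Set.range i = Function.fixedPoints f) : Nat.card X ≡ Nat.card Y [MOD p] := by
  classical
  have := Fintype.ofFinite X
  let e : Function.End X := f
  have hcard := Equiv.Perm.card_fixedPoints_modEq (f := e) (p := p) (n := 1)
    (by rw [pow_one]; exact funext hf)
  rwa [← Nat.card_eq_fintype_card, ← Nat.card_eq_fintype_card, ← hrange,
    Nat.card_range_of_injective hi] at hcard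

theorem isLocalHom_of_map_irreducible {R S : Type*} [CommRing R] [IsDomain R]
    [IsDiscreteValuationRing R] [CommRing S] [IsDomain S] [IsDiscreteValuationRing S]
    {f : R →+* S} {ϖ : R} (hϖ : Irreducible ϖ) (hfϖ : Irreducible (f ϖ)) : IsLocalHom f := by
  refine ((IsLocalRing.local_hom_TFAE f).out 0 2).2 ?_
  rw [hϖ.maximalIdeal_eq, hfϖ.maximalIdeal_eq, Ideal.map_span, Set.image_singleton]

theorem residue_eq_residue_iff_dvd {R : Type*} [CommRing R] [IsDomain R]
    [IsDiscreteValuationRing R] {ϖ : R} (hϖ : Irreducible ϖ) {a b : R} :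
    IsLocalRing.residue R a = IsLocalRing.residue R b ↔ ϖ ∣ a - b := by
  rw [← sub_eq_zero, ← map_sub, IsLocalRing.residue_eq_zero_iff, hϖ.maximalIdeal_eq,
    Ideal.mem_span_singleton]

/-- `φ : F → F'` is an unramified extension of discretely valued fields (`ϖ` is a uniformizer of
both) with an automorphism `γ` of `F'` over `F`, of order dividing `p`, such that the elements of
`F'` and of `F' / g'` that are fixed by `γ` come from `F`. -/
structure IsCyclicBaseChange {F F' : Type*} [Field F] [Field F'] (p : ℕ)
    (g : ValuationSubring F) (g' : ValuationSubring F') (φ : F →+* F') (γ : F' →+* F')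
    (ϖ : g) (ϖ' : g') : Prop where
  irreducible : Irreducible ϖ
  irreducible' : Irreducible ϖ'
  map_uniformizer : φ ϖ = ϖ'
  mem_iff : ∀ a, φ a ∈ g' ↔ a ∈ g
  apply_map : ∀ a, γ (φ a) = φ a
  iterate_apply : ∀ x, γ^[p] x = x
  map_mem : ∀ x ∈ g', γ x ∈ g'
  exists_of_fixed : ∀ x, γ x = x → ∃ y, x = φ y
  exists_of_sub_mem : ∀ x, γ x - x ∈ g' → ∃ y, x - φ y ∈ g'

namespace IsCyclicBaseChange

variable {F F' : Type*} [Field F] [Field F'] {p : ℕ} {g : ValuationSubring F}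
  {g' : ValuationSubring F'} {φ : F →+* F'} {γ : F' →+* F'} {ϖ : g} {ϖ' : g'}
  (B : IsCyclicBaseChange p g g' φ γ ϖ ϖ')

/-- The map `φ` on the rings of integers. -/
def integerMap : g →+* g' := φ.restrict g g' fun a => (B.mem_iff a).2

/-- The automorphism `γ` on the ring of integers `g'`. -/
def integerAut : g' →+* g' := γ.restrict g' g' B.map_mem

include B

theorem apply_uniformizer : γ ϖ' = ϖ' := by
  rw [← B.map_uniformizer, B.apply_map]

theorem integerMap_uniformizer : B.integerMap ϖ = ϖ' := Subtype.ext B.map_uniformizer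

theorem integerAut_uniformizer : B.integerAut ϖ' = ϖ' := Subtype.ext B.apply_uniformizer

theorem integerAut_iterate (b : g') : B.integerAut^[p] b = b := by
  have hval : Function.Semiconj ((↑) : g' → F') B.integerAut γ := fun _ => rfl
  exact Subtype.ext ((hval.iterate_right p b).trans (B.iterate_apply b))

theorem apply_eq_self_of_root (hp : Odd p) {s P : F} {r : F'}
    (hr : r * r + r * φ s + φ P = 0) : γ r = r := by
  have hγr : γ r * γ r + γ r * φ s + φ P = 0 := by
    simpa [B.apply_map] using congrArg γ hr
  have hγγr : Function.IsPeriodicPt γ 2 r := by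
    have hprod : (γ r - r) * (γ r + r + φ s) = 0 := by linear_combination hγr - hr
    rcases mul_eq_zero.1 hprod with hfix | hother
    · exact Function.IsFixedPt.isPeriodicPt (sub_eq_zero.1 hfix) 2
    · have hother' : γ r = -r - φ s := by linear_combination hother
      change γ (γ r) = r
      rw [hother', map_sub, map_neg, B.apply_map, hother']
      ring
  have hfix := hγγr.gcd (B.iterate_apply r : Function.IsPeriodicPt γ p r)
  rwa [Nat.coprime_two_left.2 hp] at hfix

variable [IsDiscreteValuationRing g']

theorem isLocalHom_integerMap [IsDiscreteValuationRing g] : IsLocalHom B.integerMap :=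
  isLocalHom_of_map_irreducible B.irreducible (B.integerMap_uniformizer.symm ▸ B.irreducible')

theorem isLocalHom_integerAut : IsLocalHom B.integerAut :=
  isLocalHom_of_map_irreducible B.irreducible' (B.integerAut_uniformizer.symm ▸ B.irreducible')

-- Apply `exists_of_sub_mem` to `b / ϖ'`: its class modulo `g'` is fixed by `γ`.
theorem exists_residue_integerMap_eq {b : g'}
    (hb : IsLocalRing.residue g' (B.integerAut b) = IsLocalRing.residue g' b) :
    ∃ a, IsLocalRing.residue g' (B.integerMap a) = IsLocalRing.residue g' b := by
  have hϖ' := uniformizer_ne_zero B.irreducible'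
  simp only [residue_eq_residue_iff_dvd B.irreducible'] at hb ⊢
  obtain ⟨c, hc⟩ := hb
  have hc' : γ b - b = ϖ' * c := congrArg Subtype.val hc
  obtain ⟨y, hy⟩ := B.exists_of_sub_mem (b / ϖ') (by
    rw [map_div₀, B.apply_uniformizer, ← sub_div, hc', mul_div_cancel_left₀ _ hϖ']
    exact c.2)
  have hsub : φ (ϖ * y) - b = ϖ' * -(b / ϖ' - φ y) := by
    rw [map_mul, B.map_uniformizer]
    field_simp
    ring
  have hmem : ϖ * y ∈ g := by
    rw [← B.mem_iff, mem_iff_mem_of_sub_mem (hsub ▸ g'.mul_mem _ _ ϖ'.2 (neg_mem hy))]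
    exact b.2
  exact ⟨⟨_, hmem⟩, ⟨_, neg_mem hy⟩, Subtype.ext hsub⟩

theorem card_residueField_modEq [Fact p.Prime] [IsDiscreteValuationRing g]
    [Finite (IsLocalRing.ResidueField g')] : resCard g' ≡ resCard g [MOD p] := by
  have := B.isLocalHom_integerMap
  have := B.isLocalHom_integerAut
  refine card_modEq_of_range_eq_fixedPoints
    (f := IsLocalRing.ResidueField.map B.integerAut) (fun x => ?_)
    (IsLocalRing.ResidueField.map B.integerMap).injective (Set.ext fun x => ⟨?_, fun hx => ?_⟩)
  · obtain ⟨b, rfl⟩ := IsLocalRing.residue_surjective x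
    have hsemi : Function.Semiconj (IsLocalRing.residue g') B.integerAut
      (IsLocalRing.ResidueField.map B.integerAut) := fun _ => rfl
    rw [← hsemi.iterate_right p b, B.integerAut_iterate]
  · rintro ⟨y, rfl⟩
    obtain ⟨a, rfl⟩ := IsLocalRing.residue_surjective y
    exact congrArg (IsLocalRing.residue g') (Subtype.ext (B.apply_map a))
  · obtain ⟨b, rfl⟩ := IsLocalRing.residue_surjective x
    obtain ⟨a, ha⟩ := B.exists_residue_integerMap_eq hx
    exact ⟨IsLocalRing.residue g a, ha⟩

end IsCyclicBaseChange

theorem IsUnramifiedQuadratic.mul_conj_coord {F K : Type*} [Field F] [CommRing K] [Algebra F K]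
    {g : ValuationSubring F} {ρ : K →+* K} {θ : K} {s P : F}
    (h : IsUnramifiedQuadratic g ρ θ s P) (a b : F) :
    (algebraMap F K a + algebraMap F K b * θ) * ρ (algebraMap F K a + algebraMap F K b * θ) =
      algebraMap F K (a * a + a * b * s + b * b * P) := by
  rw [h.conj_coord]
  simp only [map_add, map_mul, map_neg]
  linear_combination -(algebraMap F K b * algebraMap F K b) * h.theta_sq

theorem IsUnramifiedQuadratic.isField_iff {F K : Type*} [Field F] [CommRing K] [Algebra F K]
    {g : ValuationSubring F} {ρ : K →+* K} {θ : K} {s P : F}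
    (h : IsUnramifiedQuadratic g ρ θ s P) :
    IsField K ↔ ∀ r : F, r * r + r * s + P ≠ 0 := by
  constructor
  · intro hK r hr
    let := hK.toField
    have hnorm := h.mul_conj_coord r 1
    rw [mul_one, mul_one, one_mul, hr, map_zero, mul_eq_zero, map_eq_zero ρ, or_self] at hnorm
    exact one_ne_zero (h.coord_inj (a' := 0) (b' := 0) (by simpa using hnorm)).2
  · intro hroot
    have := h.algebraMap_injective.nontrivial
    refine ⟨exists_pair_ne K, mul_comm, fun {x} hx => ?_⟩
    obtain ⟨a, b, rfl⟩ := h.exists_coord x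
    have hnorm : a * a + a * b * s + b * b * P ≠ 0 := by
      intro hab
      rcases eq_or_ne b 0 with rfl | hb
      · simp_all
      · refine hroot (a / b) ?_
        field_simp
        linear_combination hab
    refine ⟨ρ (algebraMap F K a + algebraMap F K b * θ) *
      algebraMap F K (a * a + a * b * s + b * b * P)⁻¹, ?_⟩
    rw [← mul_assoc, h.mul_conj_coord, ← map_mul, mul_inv_cancel₀ hnorm, map_one]

/-! ### Base change of quadratic algebras -/

section HermitianClasses

variable {F F' K K' : Type*} [Field F] [Field F'] [CommRing K] [Algebra F K] [CommRing K']
  [Algebra F' K'] {g : ValuationSubring F} {g' : ValuationSubring F'} {ρ : K →+* K}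
  {ρ' : K' →+* K'} {n : ℕ} {ψ : K →+* K'} (hconj : ∀ x, ρ' (ψ x) = ψ (ρ x))

include hconj in
theorem map_mem_herm {x : Matrix (Fin n) (Fin n) K} (hx : x ∈ herm ρ n) :
    x.map ψ ∈ herm ρ' n :=
  mem_herm_iff.2 fun i j => by
    rw [Matrix.map_apply, Matrix.map_apply, hconj, mem_herm_iff.1 hx]

/-- Entrywise application to hermitian matrices of a homomorphism that commutes with the
conjugations. -/
def hermMap : herm ρ n →+ herm ρ' n where
  toFun x := ⟨x.1.map ψ, map_mem_herm hconj x.2⟩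
  map_zero' := Subtype.ext (Matrix.map_zero ψ (map_zero ψ))
  map_add' x y := Subtype.ext (Matrix.map_add ψ (map_add ψ) x.1 y.1)

/-- The map induced by `hermMap` on hermitian matrices modulo integral ones. -/
def hermClassMap (hmax : ∀ x ∈ maxOrder g K, ψ x ∈ maxOrder g' K') :
    herm ρ n ⧸ intHerm g ρ n →+ herm ρ' n ⧸ intHerm g' ρ' n :=
  QuotientAddGroup.map _ _ (hermMap hconj) fun _ hx i j => hmax _ (hx i j)

include hconj in
theorem descend_trace_map {θ : K} {s P : F} {θ' : K'} {s' P' : F'} {φ : F →+* F'}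
    (h : IsUnramifiedQuadratic g ρ θ s P) (h' : IsUnramifiedQuadratic g' ρ' θ' s' P')
    (hψ : ∀ a, ψ (algebraMap F K a) = algebraMap F' K' (φ a)) {ζ x : Matrix (Fin n) (Fin n) K}
    (hζ : ζ ∈ herm ρ n) (hx : x ∈ herm ρ n) :
    descend (ζ.map ψ * x.map ψ).trace = φ (descend (ζ * x).trace) := by
  refine h'.algebraMap_injective ?_
  rw [algebraMap_descend_trace h' (map_mem_herm hconj hζ) (map_mem_herm hconj hx), ← hψ,
    algebraMap_descend_trace h hζ hx, ← Matrix.map_mul, AddMonoidHom.map_trace ψ]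

end HermitianClasses

/-- The automorphism `x + y ω ↦ γ(x) + γ(y) ω` of the quadratic algebra `R[ω]`. -/
def quadraticAlgebraMap {R : Type*} [CommRing R] {a b : R} (γ : R →+* R) (ha : γ a = a)
    (hb : γ b = b) : QuadraticAlgebra R a b →+* QuadraticAlgebra R a b where
  toFun z := ⟨γ z.re, γ z.im⟩
  map_one' := by ext <;> simp [QuadraticAlgebra.re_one, QuadraticAlgebra.im_one]
  map_zero' := by ext <;> simp
  map_add' x y := by ext <;> simp
  map_mul' x y := by ext <;> simp [ha, hb]

/-- The unramified quadratic `F'`-algebra `K'` is the base change of the unramified quadratic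
`F`-algebra `K` along `φ : F → F'`, and `ψ : K → K'` is the canonical map. -/
structure IsQuadraticBaseChange {F F' K K' : Type*} [Field F] [Field F'] [CommRing K]
    [Algebra F K] [CommRing K'] [Algebra F' K'] (p : ℕ) (g : ValuationSubring F)
    (g' : ValuationSubring F') (φ : F →+* F') (γ : F' →+* F') (ϖ : g) (ϖ' : g') (ρ : K →+* K)
    (ρ' : K' →+* K') (θ : K) (s P : F) (ψ : K →+* K') : Prop extends
    IsCyclicBaseChange p g g' φ γ ϖ ϖ' where
  quad : IsUnramifiedQuadratic g ρ θ s P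
  quad' : IsUnramifiedQuadratic g' ρ' (ψ θ) (φ s) (φ P)
  map_algebraMap : ∀ a, ψ (algebraMap F K a) = algebraMap F' K' (φ a)

namespace IsQuadraticBaseChange

variable {F F' K K' : Type*} [Field F] [Field F'] [CommRing K] [Algebra F K] [CommRing K']
  [Algebra F' K'] {p : ℕ} {g : ValuationSubring F} {g' : ValuationSubring F'} {φ : F →+* F'}
  {γ : F' →+* F'} {ϖ : g} {ϖ' : g'} {ρ : K →+* K} {ρ' : K' →+* K'} {θ : K} {s P : F}
  {ψ : K →+* K'} {n : ℕ} (B : IsQuadraticBaseChange p g g' φ γ ϖ ϖ' ρ ρ' θ s P ψ)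
include B

theorem isField_iff (hp : Odd p) : IsField K ↔ IsField K' := by
  rw [B.quad.isField_iff, B.quad'.isField_iff]
  constructor
  · intro hroot r hr
    obtain ⟨y, rfl⟩ := B.exists_of_fixed r (B.apply_eq_self_of_root hp hr)
    exact hroot y (φ.injective (by simpa using hr))
  · intro hroot r hr
    exact hroot (φ r) (by simpa using congrArg φ hr)

theorem tau_eq (hp : Odd p) (i : ℕ) : tau g' K' i = tau g K i := by
  rw [tau, tau, B.isField_iff hp, if_pos B.quad.differentTrivial, if_pos B.quad'.differentTrivial]

theorem map_coord (a b : F) : ψ (algebraMap F K a + algebraMap F K b * θ) =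
    algebraMap F' K' (φ a) + algebraMap F' K' (φ b) * ψ θ := by
  rw [map_add, map_mul, B.map_algebraMap, B.map_algebraMap]

theorem conj_map (x : K) : ρ' (ψ x) = ψ (ρ x) := by
  obtain ⟨a, b, rfl⟩ := B.quad.exists_coord x
  rw [B.quad.conj_coord, B.map_coord, B.map_coord, B.quad'.conj_coord]
  simp only [map_add, map_mul, map_neg]

theorem map_injective : Function.Injective ψ := by
  intro x y hxy
  obtain ⟨a, b, rfl⟩ := B.quad.exists_coord x
  obtain ⟨a', b', rfl⟩ := B.quad.exists_coord y
  rw [B.map_coord, B.map_coord] at hxy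
  obtain ⟨ha, hb⟩ := B.quad'.coord_inj hxy
  rw [φ.injective ha, φ.injective hb]

theorem map_mem_maxOrder_iff (x : K) : ψ x ∈ maxOrder g' K' ↔ x ∈ maxOrder g K := by
  obtain ⟨a, b, rfl⟩ := B.quad.exists_coord x
  rw [B.quad.coord_mem_maxOrder_iff, B.map_coord, B.quad'.coord_mem_maxOrder_iff, B.mem_iff,
    B.mem_iff]

theorem map_mem_dualLattice_iff {ζ : Matrix (Fin n) (Fin n) K} :
    ζ.map ψ ∈ dualLattice g' ρ' n ↔ ζ ∈ dualLattice g ρ n := by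
  simp only [mem_dualLattice_iff B.quad, mem_dualLattice_iff B.quad', mem_herm_iff,
    Matrix.map_apply, B.conj_map, B.map_injective.eq_iff, B.map_mem_maxOrder_iff]

theorem map_algebraMap_uniformizer_pow (m : ℕ) :
    ψ (algebraMap F K ((ϖ : F) ^ m)) = algebraMap F' K' ((ϖ' : F') ^ m) := by
  rw [B.map_algebraMap, map_pow φ, B.map_uniformizer]

theorem nu_map_eq_pow_iff [IsDiscreteValuationRing g] [IsDiscreteValuationRing g']
    [Finite (IsLocalRing.ResidueField g)] [Finite (IsLocalRing.ResidueField g')]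
    {x : Matrix (Fin n) (Fin n) K} (hx : ∃ c d, IsReducedFraction g x c d) (k : ℕ) :
    nu g' (x.map ψ) = resCard g' ^ k ↔ nu g x = resCard g ^ k := by
  obtain ⟨c, d, hcd⟩ := hx
  rw [nu_eq_pow_iff B.irreducible, nu_eq_pow_iff B.irreducible']
  refine forall_congr' fun m => iff_congr ?_ Iff.rfl
  rw [← hcd.map_mem_denomIdeal_iff ψ B.map_mem_maxOrder_iff,
    show maxOrderMap ψ _ (algebraMap g (maxOrder g K) (ϖ ^ m)) =
      algebraMap g' (maxOrder g' K') (ϖ' ^ m) from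
      Subtype.ext (B.map_algebraMap_uniformizer_pow m)]

theorem apply_neg_map (a : F) : γ (-φ a) = -φ a := by
  rw [map_neg, B.apply_map]

/-- The automorphism of `K'` that extends `γ` and fixes the image of `K`. -/
noncomputable def galois : K' →+* K' :=
  (B.quad'.coordEquiv.toRingEquiv.toRingHom.comp
    (quadraticAlgebraMap γ (B.apply_neg_map P) (B.apply_map s))).comp
    B.quad'.coordEquiv.symm.toRingEquiv.toRingHom

theorem galois_coord (a b : F') :
    B.galois (algebraMap F' K' a + algebraMap F' K' b * ψ θ) =
      algebraMap F' K' (γ a) + algebraMap F' K' (γ b) * ψ θ := by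
  rw [← B.quad'.coordEquiv_apply ⟨a, b⟩, ← B.quad'.coordEquiv_apply ⟨γ a, γ b⟩]
  refine congrArg B.quad'.coordEquiv ?_
  exact congrArg (quadraticAlgebraMap γ (B.apply_neg_map P) (B.apply_map s))
    (B.quad'.coordEquiv.symm_apply_apply _)

theorem galois_algebraMap (a : F') : B.galois (algebraMap F' K' a) = algebraMap F' K' (γ a) := by
  simpa using B.galois_coord a 0

theorem galois_map (x : K) : B.galois (ψ x) = ψ x := by
  obtain ⟨a, b, rfl⟩ := B.quad.exists_coord x
  rw [B.map_coord, B.galois_coord, B.apply_map, B.apply_map]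

theorem conj_galois (x : K') : ρ' (B.galois x) = B.galois (ρ' x) := by
  obtain ⟨a, b, rfl⟩ := B.quad'.exists_coord x
  rw [B.galois_coord, B.quad'.conj_coord, B.quad'.conj_coord, B.galois_coord]
  simp [B.apply_map]

theorem galois_mem_maxOrder (x : K') (hx : x ∈ maxOrder g' K') : B.galois x ∈ maxOrder g' K' := by
  obtain ⟨a, b, rfl⟩ := B.quad'.exists_coord x
  rw [B.quad'.coord_mem_maxOrder_iff] at hx
  rw [B.galois_coord, B.quad'.coord_mem_maxOrder_iff]
  exact ⟨B.map_mem _ hx.1, B.map_mem _ hx.2⟩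

theorem galois_iterate_coord (k : ℕ) (a b : F') :
    B.galois^[k] (algebraMap F' K' a + algebraMap F' K' b * ψ θ) =
      algebraMap F' K' (γ^[k] a) + algebraMap F' K' (γ^[k] b) * ψ θ := by
  induction k generalizing a b with
  | zero => rfl
  | succ k ih => simp only [Function.iterate_succ_apply, B.galois_coord, ih]

theorem galois_iterate : B.galois^[p] = id := by
  funext x
  obtain ⟨a, b, rfl⟩ := B.quad'.exists_coord x
  rw [B.galois_iterate_coord, B.iterate_apply, B.iterate_apply, id]

theorem uniformizer_pow_mem_denomIdeal_galois_iterate {x : Matrix (Fin n) (Fin n) K'} {m : ℕ}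
    (hx : algebraMap g' (maxOrder g' K') (ϖ' ^ m) ∈ denomIdeal g' x) (i : ℕ) :
    algebraMap g' (maxOrder g' K') (ϖ' ^ m) ∈ denomIdeal g' (x.map B.galois^[i]) := by
  induction i with
  | zero => rwa [Function.iterate_zero, Matrix.map_id]
  | succ i ih =>
    have hfix : maxOrderMap B.galois B.galois_mem_maxOrder
        (algebraMap g' (maxOrder g' K') (ϖ' ^ m)) = algebraMap g' (maxOrder g' K') (ϖ' ^ m) := by
      refine Subtype.ext ?_
      change B.galois (algebraMap F' K' ((ϖ' : F') ^ m)) = algebraMap F' K' ((ϖ' : F') ^ m)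
      rw [← B.map_algebraMap_uniformizer_pow, B.galois_map]
    have hmap := map_mem_denomIdeal B.galois B.galois_mem_maxOrder ih
    rwa [hfix, Matrix.map_map, ← Function.iterate_succ'] at hmap

theorem nu_map_galois_eq_pow_iff [NeZero p] [IsDiscreteValuationRing g']
    [Finite (IsLocalRing.ResidueField g')] (x : Matrix (Fin n) (Fin n) K') (k : ℕ) :
    nu g' (x.map B.galois) = resCard g' ^ k ↔ nu g' x = resCard g' ^ k := by
  rw [nu_eq_pow_iff B.irreducible', nu_eq_pow_iff B.irreducible']
  refine forall_congr' fun m => iff_congr ⟨fun hx => ?_, fun hx => ?_⟩ Iff.rfl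
  · have hpred := B.uniformizer_pow_mem_denomIdeal_galois_iterate hx (p - 1)
    rwa [Matrix.map_map, ← Function.iterate_succ, Nat.succ_eq_add_one,
      Nat.sub_add_cancel NeZero.one_le, B.galois_iterate, Matrix.map_id] at hpred
  · exact B.uniformizer_pow_mem_denomIdeal_galois_iterate hx 1

theorem exists_sub_map_mem {x : K'} (hx : B.galois x - x ∈ maxOrder g' K') :
    ∃ y, x - ψ y ∈ maxOrder g' K' ∧ (ρ' x = x → ρ y = y) := by
  by_cases hconj : ρ' x = x
  · obtain ⟨a, rfl⟩ := B.quad'.conj_eq_self_iff.1 hconj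
    rw [B.galois_algebraMap, ← map_sub, B.quad'.algebraMap_mem_maxOrder_iff] at hx
    obtain ⟨y, hy⟩ := B.exists_of_sub_mem a hx
    refine ⟨algebraMap F K y, ?_, fun _ => B.quad.conj_algebraMap y⟩
    rwa [B.map_algebraMap, ← map_sub, B.quad'.algebraMap_mem_maxOrder_iff]
  · obtain ⟨a, b, rfl⟩ := B.quad'.exists_coord x
    rw [B.galois_coord, B.quad'.coord_sub_coord_mem_maxOrder_iff] at hx
    obtain ⟨ya, hya⟩ := B.exists_of_sub_mem a hx.1
    obtain ⟨yb, hyb⟩ := B.exists_of_sub_mem b hx.2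
    refine ⟨algebraMap F K ya + algebraMap F K yb * θ, ?_, fun h => absurd h hconj⟩
    rw [B.map_coord, B.quad'.coord_sub_coord_mem_maxOrder_iff]
    exact ⟨hya, hyb⟩

theorem exists_herm_sub_map_mem {x : Matrix (Fin n) (Fin n) K'} (hx : x ∈ herm ρ' n)
    (hfix : ∀ i j, B.galois (x i j) - x i j ∈ maxOrder g' K') :
    ∃ y : herm ρ n, ∀ i j, x i j - ψ (y.1 i j) ∈ maxOrder g' K' := by
  rw [mem_herm_iff] at hx
  choose y hy hdiag using fun i j => B.exists_sub_map_mem (hfix i j)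
  refine ⟨⟨Matrix.of fun i j => if i ≤ j then y i j else ρ (y j i), ?_⟩, fun i j => ?_⟩
  · rw [mem_herm_iff]
    intro i j
    simp only [Matrix.of_apply]
    rcases lt_trichotomy i j with hij | rfl | hij
    · rw [if_neg (not_le.2 hij), if_pos hij.le, B.quad.conj_conj]
    · rw [if_pos le_rfl, hdiag i i (hx i i)]
    · rw [if_pos hij.le, if_neg (not_le.2 hij)]
  · simp only [Matrix.of_apply]
    split_ifs with hij
    · exact hy i j
    · rw [← B.conj_map, ← hx i j, ← map_sub]
      exact B.quad'.conj_mem (hy j i)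

/-- The action of `galois` on the hermitian matrices over `K'` modulo integral ones. -/
noncomputable def galoisClass : herm ρ' n ⧸ intHerm g' ρ' n →+ herm ρ' n ⧸ intHerm g' ρ' n :=
  hermClassMap B.conj_galois B.galois_mem_maxOrder

/-- The map induced by `ψ` on hermitian matrices modulo integral ones. -/
def baseChangeClass : herm ρ n ⧸ intHerm g ρ n →+ herm ρ' n ⧸ intHerm g' ρ' n :=
  hermClassMap B.conj_map fun x => (B.map_mem_maxOrder_iff x).2

theorem galoisClass_iterate (t : herm ρ' n ⧸ intHerm g' ρ' n) : B.galoisClass^[p] t = t := by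
  induction t using QuotientAddGroup.induction_on with | H x
  have hmk : Function.Semiconj (QuotientAddGroup.mk : herm ρ' n → herm ρ' n ⧸ intHerm g' ρ' n)
    (hermMap B.conj_galois) B.galoisClass := fun _ => rfl
  have hentry (i j : Fin n) : Function.Semiconj (fun y : herm ρ' n => y.1 i j)
    (hermMap B.conj_galois) B.galois := fun _ => rfl
  rw [← hmk.iterate_right p x]
  refine congrArg _ (Subtype.ext (Matrix.ext fun i j => ?_))
  exact ((hentry i j).iterate_right p x).trans (congrFun B.galois_iterate _)

theorem baseChangeClass_injective :
    Function.Injective (B.baseChangeClass : herm ρ n ⧸ intHerm g ρ n → _) := by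
  refine (injective_iff_map_eq_zero _).2 fun t ht => ?_
  induction t using QuotientAddGroup.induction_on with | H x
  refine (QuotientAddGroup.eq_zero_iff x).2 fun i j => ?_
  rw [← B.map_mem_maxOrder_iff]
  exact (QuotientAddGroup.eq_zero_iff (hermMap B.conj_map x)).1 ht i j

theorem range_baseChangeClass : Set.range (B.baseChangeClass : herm ρ n ⧸ intHerm g ρ n → _) =
    Function.fixedPoints B.galoisClass := by
  refine Set.ext fun t => ⟨?_, fun ht => ?_⟩
  · rintro ⟨t, rfl⟩
    induction t using QuotientAddGroup.induction_on with | H x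
    exact congrArg QuotientAddGroup.mk (Subtype.ext (Matrix.ext fun i j => B.galois_map _))
  · induction t using QuotientAddGroup.induction_on with | H x
    obtain ⟨y, hy⟩ := B.exists_herm_sub_map_mem x.2 (mk_eq_mk_iff.1 (Eq.symm ht))
    exact ⟨QuotientAddGroup.mk y, mk_eq_mk_iff.2 hy⟩

variable [IsDiscreteValuationRing g'] [Finite (IsLocalRing.ResidueField g')]
  {ζ : Matrix (Fin n) (Fin n) K} (hζ : ζ ∈ dualLattice g ρ n) (k : ℕ) (c : F)
include hζ

theorem mapsTo_galoisClass_fiber [NeZero p] : Set.MapsTo B.galoisClass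
    (fiber g' ρ' (ζ.map ψ) k (φ c)) (fiber g' ρ' (ζ.map ψ) k (φ c)) := by
  have hζ' := B.map_mem_dualLattice_iff.2 hζ
  intro t ht
  induction t using QuotientAddGroup.induction_on with | H x
  have hfix : (ζ.map ψ).map B.galois = ζ.map ψ := Matrix.ext fun i j => B.galois_map _
  have htrace := descend_trace_map B.conj_galois B.quad' B.quad' B.galois_algebraMap hζ'.1 x.2
  rw [hfix] at htrace
  rw [mk_mem_fiber_iff B.quad' hζ'] at ht
  refine (mk_mem_fiber_iff B.quad' hζ' k _ (hermMap B.conj_galois x)).2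
    ⟨(B.nu_map_galois_eq_pow_iff x.1 k).2 ht.1, ?_⟩
  change descend (ζ.map ψ * x.1.map B.galois).trace - φ c ∈ g'
  rw [htrace, ← B.apply_map c, ← map_sub]
  exact B.map_mem _ ht.2

variable [IsDiscreteValuationRing g] [Finite (IsLocalRing.ResidueField g)]
  (hfrac : ∀ x : Matrix (Fin n) (Fin n) K, ∃ c d, IsReducedFraction g x c d)
include hfrac

theorem baseChangeClass_mem_fiber_iff (t : herm ρ n ⧸ intHerm g ρ n) :
    B.baseChangeClass t ∈ fiber g' ρ' (ζ.map ψ) k (φ c) ↔ t ∈ fiber g ρ ζ k c := by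
  induction t using QuotientAddGroup.induction_on with | H x
  refine (mk_mem_fiber_iff B.quad' (B.map_mem_dualLattice_iff.2 hζ) k _
    (hermMap B.conj_map x)).trans ?_
  change nu g' (x.1.map ψ) = _ ∧ descend (ζ.map ψ * x.1.map ψ).trace - φ c ∈ g' ↔ _
  rw [mk_mem_fiber_iff B.quad hζ, B.nu_map_eq_pow_iff (hfrac _),
    descend_trace_map B.conj_map B.quad B.quad' B.map_algebraMap hζ.1 x.2, ← map_sub, B.mem_iff]

theorem card_fiber_modEq [Fact p.Prime] :
    Nat.card (fiber g' ρ' (ζ.map ψ) k (φ c)) ≡ Nat.card (fiber g ρ ζ k c) [MOD p] := by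
  have := finite_fiber B.quad' (ζ.map ψ) k (φ c)
  have hgalois := B.mapsTo_galoisClass_fiber hζ k c
  have hmem := B.baseChangeClass_mem_fiber_iff hζ k c hfrac
  refine card_modEq_of_range_eq_fixedPoints (f := hgalois.restrict) (fun t => ?_)
    (i := Set.MapsTo.restrict B.baseChangeClass _ _ fun t => (hmem t).2) ?_ ?_
  · exact Subtype.ext ((hgalois.coe_iterate_restrict t p).trans (B.galoisClass_iterate t.1))
  · exact fun t t' htt => Subtype.ext (B.baseChangeClass_injective (congrArg Subtype.val htt))
  · refine Set.ext fun t => ⟨?_, fun ht => ?_⟩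
    · rintro ⟨y, rfl⟩
      exact Subtype.ext (B.range_baseChangeClass.subset ⟨y.1, rfl⟩)
    · obtain ⟨y, hy⟩ := B.range_baseChangeClass.superset (congrArg Subtype.val ht)
      exact ⟨⟨y, (hmem y).1 (hy ▸ t.2)⟩, Subtype.ext hy⟩

end IsQuadraticBaseChange

/-! ### Congruence of the normalized series -/

section IntegralSeries

variable {F K : Type*} [Field F] [CommRing K] [Algebra F K] {g : ValuationSubring F}
  {ρ : K →+* K} {θ : K} {s P : F} {ϖ : g} {n : ℕ}

/-- The factor `f_ζ(t)` as a power series over `ℤ`. -/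
noncomputable def intSeriesF (g : ValuationSubring F) (K : Type*) [CommRing K] [Algebra F K]
    (n : ℕ) : PowerSeries ℤ :=
  ∏ i ∈ Finset.range n, (1 - PowerSeries.C (tau g K i * (resCard g : ℤ) ^ i) * PowerSeries.X)

theorem map_intSeriesF : (intSeriesF g K n).map (Int.castRingHom ℂ) = seriesF g K n := by
  simp [intSeriesF, seriesF, map_prod]

theorem constantCoeff_intSeriesF : PowerSeries.constantCoeff (intSeriesF g K n) = 1 := by
  rw [intSeriesF, map_prod]
  exact Finset.prod_eq_one fun i _ => by simp

theorem constantCoeff_map_intSeriesF {R : Type*} [Ring R] (f : ℤ →+* R) :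
    PowerSeries.constantCoeff ((intSeriesF g K n).map f) = 1 := by
  rw [← PowerSeries.coeff_zero_eq_constantCoeff_apply, PowerSeries.coeff_map,
    PowerSeries.coeff_zero_eq_constantCoeff_apply, constantCoeff_intSeriesF, map_one]

/-- The series `A_ζ(t)` as a power series over `ℤ`, by `coeff_seriesA`. -/
noncomputable def intSeriesA (g : ValuationSubring F) (ρ : K →+* K)
    (ζ : Matrix (Fin n) (Fin n) K) (ϖ : g) : PowerSeries ℤ :=
  PowerSeries.mk fun k =>
    (Nat.card (fiber g ρ ζ k 0) : ℤ) - Nat.card (fiber g ρ ζ k (ϖ : F)⁻¹)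

/-- The series `g_ζ(t)` as a power series over `ℤ`. -/
noncomputable def intSeriesG (g : ValuationSubring F) (ρ : K →+* K)
    (ζ : Matrix (Fin n) (Fin n) K) (ϖ : g) : PowerSeries ℤ :=
  intSeriesA g ρ ζ ϖ * (intSeriesF g K n).invOfUnit 1

theorem intSeriesG_mul_intSeriesF (ζ : Matrix (Fin n) (Fin n) K) :
    intSeriesG g ρ ζ ϖ * intSeriesF g K n = intSeriesA g ρ ζ ϖ := by
  rw [intSeriesG, mul_assoc, PowerSeries.invOfUnit_mul _ _ (by
    rw [constantCoeff_intSeriesF, Units.val_one]), mul_one]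

theorem map_intSeriesG [IsDiscreteValuationRing g] [Finite (IsLocalRing.ResidueField g)]
    (h : IsUnramifiedQuadratic g ρ θ s P) (hϖ : Irreducible ϖ) {χ : AddChar F Circle}
    (hχ : HasConductorOne g χ) {ζ : Matrix (Fin n) (Fin n) K} (hζ : ζ ∈ dualLattice g ρ n) :
    (intSeriesG g ρ ζ ϖ).map (Int.castRingHom ℂ) = seriesG g ρ χ ζ := by
  rw [seriesG, if_pos hζ, ← map_intSeriesF, PowerSeries.eq_mul_inv_iff_mul_eq
    (by rw [constantCoeff_map_intSeriesF]; exact one_ne_zero), ← map_mul,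
    intSeriesG_mul_intSeriesF]
  ext k
  rw [coeff_seriesA h hχ hζ hϖ, PowerSeries.coeff_map, intSeriesA, PowerSeries.coeff_mk]
  simp

theorem smul_mem_dualLattice (h : IsUnramifiedQuadratic g ρ θ s P) (a : g)
    {ζ : Matrix (Fin n) (Fin n) K} (hζ : ζ ∈ dualLattice g ρ n) :
    (a : F) • ζ ∈ dualLattice g ρ n := by
  rw [mem_dualLattice_iff h] at hζ ⊢
  refine ⟨smul_mem_herm h _ hζ.1, fun i j => ?_⟩
  rw [Matrix.smul_apply, Algebra.smul_def]
  exact mul_mem (h.algebraMap_mem_maxOrder_iff.2 a.2) (hζ.2 i j)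

theorem unit_smul_mem_dualLattice_iff (h : IsUnramifiedQuadratic g ρ θ s P) (u : gˣ)
    {ζ : Matrix (Fin n) (Fin n) K} :
    (u : F) • ζ ∈ dualLattice g ρ n ↔ ζ ∈ dualLattice g ρ n := by
  refine ⟨fun hζ => ?_, smul_mem_dualLattice h u⟩
  have hinv := smul_mem_dualLattice h (↑u⁻¹ : g) hζ
  rwa [smul_smul, show ((↑u⁻¹ : g) : F) * ((u : g) : F) = 1 from congrArg Subtype.val u.inv_mul,
    one_smul] at hinv

theorem seriesG_unit_smul (h : IsUnramifiedQuadratic g ρ θ s P) (u : gˣ) (χ : AddChar F Circle)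
    (ζ : Matrix (Fin n) (Fin n) K) :
    seriesG g ρ χ ((u : F) • ζ) = seriesG g ρ (χ.mulShift u) ζ := by
  rw [seriesG, seriesG, unit_smul_mem_dualLattice_iff h]
  split_ifs with hζ
  · rw [seriesA_smul h _ ((mem_dualLattice_iff h).1 hζ).1]
  · rfl

end IntegralSeries

namespace IsQuadraticBaseChange

variable {F F' K K' : Type*} [Field F] [Field F'] [CommRing K] [Algebra F K] [CommRing K']
  [Algebra F' K'] {p : ℕ} [Fact p.Prime] {g : ValuationSubring F} {g' : ValuationSubring F'}
  [IsDiscreteValuationRing g] [IsDiscreteValuationRing g']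
  [Finite (IsLocalRing.ResidueField g')] {φ : F →+* F'} {γ : F' →+* F'} {ϖ : g} {ϖ' : g'}
  {ρ : K →+* K} {ρ' : K' →+* K'} {θ : K} {s P : F} {ψ : K →+* K'} {n : ℕ}
  {ζ : Matrix (Fin n) (Fin n) K}

theorem map_intSeriesF_eq (B : IsQuadraticBaseChange p g g' φ γ ϖ ϖ' ρ ρ' θ s P ψ)
    (hp : Odd p) (n : ℕ) :
    (intSeriesF g' K' n).map (Int.castRingHom (ZMod p)) =
      (intSeriesF g K n).map (Int.castRingHom (ZMod p)) := by
  have hq := (ZMod.natCast_eq_natCast_iff _ _ _).2 B.card_residueField_modEq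
  simp only [intSeriesF, map_prod, map_sub, map_mul, map_one, PowerSeries.map_C,
    PowerSeries.map_X, B.tau_eq hp]
  simp [hq]

variable [Finite (IsLocalRing.ResidueField g)]

theorem map_intSeriesA_eq (B : IsQuadraticBaseChange p g g' φ γ ϖ ϖ' ρ ρ' θ s P ψ)
    (hfrac : ∀ x : Matrix (Fin n) (Fin n) K, ∃ c d, IsReducedFraction g x c d)
    (hζ : ζ ∈ dualLattice g ρ n) :
    (intSeriesA g' ρ' (ζ.map ψ) ϖ').map (Int.castRingHom (ZMod p)) =
      (intSeriesA g ρ ζ ϖ).map (Int.castRingHom (ZMod p)) := by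
  ext k
  have hzero := (ZMod.natCast_eq_natCast_iff _ _ _).2 (B.card_fiber_modEq hζ k 0 hfrac)
  have hinv := (ZMod.natCast_eq_natCast_iff _ _ _).2 (B.card_fiber_modEq hζ k (ϖ : F)⁻¹ hfrac)
  rw [map_zero] at hzero
  rw [map_inv₀, B.map_uniformizer] at hinv
  simp only [intSeriesA, PowerSeries.coeff_map, PowerSeries.coeff_mk, eq_intCast, Int.cast_sub,
    Int.cast_natCast, hzero, hinv]

theorem map_intSeriesG_eq (B : IsQuadraticBaseChange p g g' φ γ ϖ ϖ' ρ ρ' θ s P ψ) (hp : Odd p)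
    (hfrac : ∀ x : Matrix (Fin n) (Fin n) K, ∃ c d, IsReducedFraction g x c d)
    (hζ : ζ ∈ dualLattice g ρ n) :
    (intSeriesG g' ρ' (ζ.map ψ) ϖ').map (Int.castRingHom (ZMod p)) =
      (intSeriesG g ρ ζ ϖ).map (Int.castRingHom (ZMod p)) := by
  have hne : (intSeriesF g K n).map (Int.castRingHom (ZMod p)) ≠ 0 := by
    intro hzero
    have hconst := constantCoeff_map_intSeriesF (g := g) (K := K) (n := n)
      (Int.castRingHom (ZMod p))
    rw [hzero, map_zero] at hconst
    exact zero_ne_one hconst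
  refine mul_right_cancel₀ hne ?_
  conv_lhs => rw [← B.map_intSeriesF_eq hp n]
  rw [← map_mul, ← map_mul, intSeriesG_mul_intSeriesF, intSeriesG_mul_intSeriesF,
    B.map_intSeriesA_eq hfrac hζ]

theorem exists_int_coeff_seriesG (B : IsQuadraticBaseChange p g g' φ γ ϖ ϖ' ρ ρ' θ s P ψ)
    (hp : Odd p) (hfrac : ∀ x : Matrix (Fin n) (Fin n) K, ∃ c d, IsReducedFraction g x c d)
    {χ : AddChar F Circle} (hχ : HasConductorOne g χ) {χ' : AddChar F' Circle}
    (hχ' : HasConductorOne g' χ') (ζ : Matrix (Fin n) (Fin n) K) (u : g'ˣ) (j : ℕ) :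
    ∃ a a' : ℤ, PowerSeries.coeff j (seriesG g ρ χ ζ) = a ∧
      PowerSeries.coeff j (seriesG g' ρ' χ' ((u : F') • ζ.map ψ)) = a' ∧ a ≡ a' [ZMOD p] := by
  rw [seriesG_unit_smul B.quad']
  by_cases hζ : ζ ∈ dualLattice g ρ n
  · refine ⟨PowerSeries.coeff j (intSeriesG g ρ ζ ϖ),
      PowerSeries.coeff j (intSeriesG g' ρ' (ζ.map ψ) ϖ'), ?_, ?_, ?_⟩
    · rw [← map_intSeriesG B.quad B.irreducible hχ hζ, PowerSeries.coeff_map]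
      rfl
    · rw [← map_intSeriesG B.quad' B.irreducible' (hχ'.mulShift u)
        (B.map_mem_dualLattice_iff.2 hζ), PowerSeries.coeff_map]
      rfl
    · have hcoeff := congrArg (PowerSeries.coeff j) (B.map_intSeriesG_eq hp hfrac hζ)
      rw [PowerSeries.coeff_map, PowerSeries.coeff_map] at hcoeff
      exact (ZMod.intCast_eq_intCast_iff _ _ _).1 hcoeff.symm
  · refine ⟨0, 0, ?_, ?_, rfl⟩
    · rw [seriesG, if_neg hζ]; simp
    · rw [seriesG, if_neg (mt B.map_mem_dualLattice_iff.1 hζ)]; simp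

end IsQuadraticBaseChange

/-! ### Completions of number fields -/

section Valued

theorem valued_map_eq_of_denseRange {L M Γ₀ ι : Type*} [Field L] [Field M]
    [LinearOrderedCommGroupWithZero Γ₀] [Valued L Γ₀] [Valued M Γ₀] {f : L →+* M}
    (hf : Continuous f) {i : ι → L} (hi : DenseRange i)
    (hv : ∀ y, Valued.v (f (i y)) = Valued.v (i y)) (x : L) : Valued.v (f x) = Valued.v x := by
  obtain rfl | hx := eq_or_ne x 0
  · simp
  have hfx : (Valued.v (f x) : Γ₀) ≠ 0 := (Valuation.ne_zero_iff _).2 ((map_ne_zero f).2 hx)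
  obtain ⟨_, ⟨hfy, hy⟩, y, rfl⟩ := mem_closure_iff_nhds.1 (hi x) _ (Filter.inter_mem
    (hf.continuousAt (Valued.locally_const hfx))
    (Valued.locally_const ((Valuation.ne_zero_iff _).2 hx)))
  exact hfy.symm.trans ((hv y).trans hy)

open WithZero in
theorem mem_nhds_zero_iff_exists_valued_le_exp {L : Type*} [Field L]
    [Valued L (WithZero (Multiplicative ℤ))]
    (hv : Function.Surjective (Valued.v : L → WithZero (Multiplicative ℤ))) {S : Set L} :
    S ∈ nhds (0 : L) ↔ ∃ m : ℕ, {x : L | Valued.v x ≤ exp (-(m : ℤ))} ⊆ S := by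
  constructor
  · intro hS
    obtain ⟨c, hc⟩ := Valued.mem_nhds_zero.1 hS
    have hne : MonoidWithZeroHom.ValueGroup₀.embedding c.1 ≠ 0 := (map_ne_zero _).2 c.ne_zero
    obtain ⟨m, hm, -⟩ := exists_exp_neg_natCast_lt_and_lt hne hne
    refine ⟨m, fun x hx => hc ?_⟩
    rw [Set.mem_ofPred_eq, Valuation.restrict_lt_iff_lt_embedding]
    exact lt_of_le_of_lt hx hm
  · rintro ⟨m, hm⟩
    obtain ⟨a, ha⟩ := hv (exp (-(m : ℤ)))
    have ha0 : Valued.v.restrict a ≠ 0 := by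
      rw [Ne, Valuation.zero_iff]
      rintro rfl
      rw [map_zero] at ha
      exact exp_ne_zero ha.symm
    refine Filter.mem_of_superset ((Valued.isOpen_closedBall L ha0).mem_nhds (by simp)) ?_
    intro x hx
    refine hm ?_
    rw [Set.mem_ofPred_eq, ← ha]
    exact (Valuation.restrict_le_iff _).1 hx

end Valued

section Completion

variable {F : Type*} [Field F] [NumberField F] {v : HeightOneSpectrum (𝓞 F)}

theorem algebraMap_mem_adicCompletionIntegers_iff {y : F} :
    algebraMap F (v.adicCompletion F) y ∈ v.adicCompletionIntegers F ↔ v.valuation F y ≤ 1 := by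
  rw [← HeightOneSpectrum.valuedAdicCompletion_eq_valuation' v y]
  rfl

theorem exists_valued_sub_algebraMap_lt_one (x : v.adicCompletion F) :
    ∃ y : F, Valued.v (x - algebraMap F (v.adicCompletion F) y) < 1 := by
  have hball := Valued.isOpen_ball (v.adicCompletion F) 1
  simp only [Valuation.restrict_lt_one_iff] at hball
  obtain ⟨y, hy⟩ := (v.denseRange_algebraMap F).exists_mem_open
    (hball.preimage (continuous_sub_left x)) ⟨x, by simp⟩
  exact ⟨y, hy⟩

theorem exists_sub_algebraMap_mem_adicCompletionIntegers (x : v.adicCompletion F) :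
    ∃ y : F, x - algebraMap F _ y ∈ v.adicCompletionIntegers F := by
  obtain ⟨y, hy⟩ := exists_valued_sub_algebraMap_lt_one x
  exact ⟨y, (HeightOneSpectrum.mem_adicCompletionIntegers (𝓞 F) F v).2 hy.le⟩

theorem exists_integer_valued_sub_algebraMap_lt_one (x : v.adicCompletionIntegers F) :
    ∃ a : 𝓞 F, Valued.v (x - algebraMap F (v.adicCompletion F) a : v.adicCompletion F) < 1 := by
  obtain ⟨y, hy⟩ := exists_valued_sub_algebraMap_lt_one (x : v.adicCompletion F)
  have hy_int : v.valuation F y ≤ 1 := by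
    rw [← algebraMap_mem_adicCompletionIntegers_iff]
    simpa using sub_mem x.2 ((HeightOneSpectrum.mem_adicCompletionIntegers (𝓞 F) F v).2 hy.le)
  obtain ⟨a, ha⟩ := v.exists_valuation_sub_lt_of_integer hy_int 1
  have hya : Valued.v (algebraMap F (v.adicCompletion F) (algebraMap (𝓞 F) F a - y)) < 1 :=
    (HeightOneSpectrum.valuedAdicCompletion_eq_valuation' v _).trans_lt (by simpa using ha)
  refine ⟨a, ?_⟩
  rw [show (x : v.adicCompletion F) - algebraMap F _ (a : F) = (x - algebraMap F _ y) -
    algebraMap F (v.adicCompletion F) (algebraMap (𝓞 F) F a - y) by rw [map_sub]; ring]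
  exact (Valuation.map_sub _ _ _).trans_lt (max_lt hy hya)

theorem residue_eq_zero_of_valued_lt_one {z : v.adicCompletionIntegers F}
    (hz : Valued.v (z : v.adicCompletion F) < 1) : IsLocalRing.residue _ z = 0 := by
  rw [IsLocalRing.residue_eq_zero_iff, IsLocalRing.mem_maximalIdeal, mem_nonunits_iff,
    HeightOneSpectrum.adicCompletionIntegers.isUnit_iff_valued_eq_one]
  exact hz.ne

instance finite_residueField_adicCompletionIntegers :
    Finite (IsLocalRing.ResidueField (v.adicCompletionIntegers F)) := by
  have hfinite : Finite (𝓞 F ⧸ v.asIdeal) := v.asIdeal.finiteQuotientOfFreeOfNeBot v.ne_bot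
  let f : 𝓞 F ⧸ v.asIdeal →+* IsLocalRing.ResidueField (v.adicCompletionIntegers F) :=
    Ideal.Quotient.lift _ ((IsLocalRing.residue _).comp (algebraMap _ _)) fun a ha =>
      residue_eq_zero_of_valued_lt_one
        ((HeightOneSpectrum.valuedAdicCompletion_eq_valuation' v _).trans_lt
          ((v.valuation_lt_one_iff_mem _).2 ha))
  refine Finite.of_surjective f fun x => ?_
  obtain ⟨x, rfl⟩ := IsLocalRing.residue_surjective x
  obtain ⟨a, ha⟩ := exists_integer_valued_sub_algebraMap_lt_one x
  have hres : IsLocalRing.residue _ (x - algebraMap (𝓞 F) (v.adicCompletionIntegers F) a) = 0 :=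
    residue_eq_zero_of_valued_lt_one ha
  exact ⟨Ideal.Quotient.mk _ a, (sub_eq_zero.1 (by rwa [map_sub] at hres)).symm⟩

theorem valued_le_exp_neg_one_of_not_isUnit {a : v.adicCompletionIntegers F} (ha : ¬ IsUnit a) :
    Valued.v (a : v.adicCompletion F) ≤ WithZero.exp (-1 : ℤ) := by
  rw [HeightOneSpectrum.adicCompletionIntegers.isUnit_iff_valued_eq_one] at ha
  have hlt : Valued.v (a : v.adicCompletion F) < 1 := lt_of_le_of_ne a.2 ha
  obtain hzero | hzero := eq_or_ne (Valued.v (a : v.adicCompletion F)) 0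
  · rw [hzero]
    exact zero_le
  · rw [← WithZero.log_le_iff_le_exp hzero]
    rw [← WithZero.exp_zero, ← WithZero.log_lt_iff_lt_exp hzero] at hlt
    omega

theorem irreducible_of_valued_eq {x : v.adicCompletionIntegers F}
    (hx : Valued.v (x : v.adicCompletion F) = WithZero.exp (-1 : ℤ)) : Irreducible x := by
  refine ⟨?_, fun a b hab => ?_⟩
  · rw [HeightOneSpectrum.adicCompletionIntegers.isUnit_iff_valued_eq_one, hx,
      ← WithZero.exp_zero, WithZero.exp_inj]
    norm_num
  · by_contra! hcon
    have hle := mul_le_mul' (valued_le_exp_neg_one_of_not_isUnit hcon.1)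
      (valued_le_exp_neg_one_of_not_isUnit hcon.2)
    have hmul : Valued.v (a : v.adicCompletion F) * Valued.v (b : v.adicCompletion F) =
        WithZero.exp (-1 : ℤ) := by
      rw [← map_mul, ← hx, hab]
      rfl
    rw [hmul, ← WithZero.exp_add, WithZero.exp_le_exp] at hle
    omega

end Completion

section Extension

variable (F F' : Type*) [Field F] [NumberField F] [Field F'] [NumberField F'] [Algebra F F']
  (w : HeightOneSpectrum (𝓞 F'))

variable [Algebra.IsUnramifiedAt (𝓞 F) w.asIdeal]

theorem ramificationIdx_under_eq_one :
    (w.under (𝓞 F)).asIdeal.ramificationIdx' w.asIdeal = 1 := by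
  rw [Ideal.ramificationIdx'_eq_ramificationIdx _ _ (w.under (𝓞 F)).ne_bot]
  exact Ideal.ramificationIdx_eq_one _ _

theorem valuation_algebraMap_eq (x : F) :
    w.valuation F' (algebraMap F F' x) = (w.under (𝓞 F)).valuation F x := by
  rw [← HeightOneSpectrum.valuation_liesOver F' (w.under (𝓞 F)) w,
    ramificationIdx_under_eq_one F F' w, pow_one]

theorem valued_completionMap (x : (w.under (𝓞 F)).adicCompletion F) :
    Valued.v (completionMap F F' w x) = Valued.v x := by
  refine valued_map_eq_of_denseRange (continuous_completionMap F F' w)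
    ((w.under (𝓞 F)).denseRange_algebraMap F) (fun y => ?_) x
  rw [completionMap_coe]
  exact ((HeightOneSpectrum.valuedAdicCompletion_eq_valuation' w (algebraMap F F' y)).trans
    (valuation_algebraMap_eq F F' w y)).trans
      (HeightOneSpectrum.valuedAdicCompletion_eq_valuation' _ y).symm

theorem completionMap_mem_iff {x : (w.under (𝓞 F)).adicCompletion F} :
    completionMap F F' w x ∈ w.adicCompletionIntegers F' ↔
      x ∈ (w.under (𝓞 F)).adicCompletionIntegers F := by
  rw [HeightOneSpectrum.mem_adicCompletionIntegers, HeightOneSpectrum.mem_adicCompletionIntegers,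
    valued_completionMap]

theorem isInducing_completionMap : Topology.IsInducing (completionMap F F' w) := by
  refine (IsTopologicalAddGroup.isInducing_iff_nhds_zero (f := completionMap F F' w)).2 ?_
  have hsurj := w.valuedAdicCompletion_surjective F'
  ext S
  rw [Filter.mem_comap, mem_nhds_zero_iff_exists_valued_le_exp
    ((w.under (𝓞 F)).valuedAdicCompletion_surjective F)]
  constructor
  · rintro ⟨m, hm⟩
    refine ⟨{x | Valued.v x ≤ WithZero.exp (-(m : ℤ))},
      (mem_nhds_zero_iff_exists_valued_le_exp hsurj).2 ⟨m, le_rfl⟩, fun x hx => hm ?_⟩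
    rwa [Set.mem_preimage, Set.mem_ofPred_eq, valued_completionMap F F' w] at hx
  · rintro ⟨T, hT, hTS⟩
    obtain ⟨m, hm⟩ := (mem_nhds_zero_iff_exists_valued_le_exp hsurj).1 hT
    refine ⟨m, fun x hx => hTS (hm ?_)⟩
    rwa [Set.mem_ofPred_eq, valued_completionMap F F' w]

theorem isClosed_range_completionMap : IsClosed (Set.range (completionMap F F' w)) :=
  (AddMonoidHom.isUniformInducing_of_isInducing (f := completionMap F F' w)
    (isInducing_completionMap F F' w)).isComplete_range.isClosed

end Extension

/-! ### Automorphisms of completions -/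

section Automorphism

open scoped Pointwise

variable {F F' : Type*} [Field F] [Field F'] [NumberField F'] [Algebra F F']

theorem intValuation_smul {σ : F' ≃ₐ[F] F'} {w w' : HeightOneSpectrum (𝓞 F')}
    (h : σ • w'.asIdeal = w.asIdeal) (r : 𝓞 F') : w.intValuation (σ • r) = w'.intValuation r := by
  have hiff : ∀ n : ℕ, w.intValuation (σ • r) ≤ WithZero.exp (-(n : ℤ)) ↔
      w'.intValuation r ≤ WithZero.exp (-(n : ℤ)) := by
    intro n
    rw [HeightOneSpectrum.intValuation_le_pow_iff_mem,
      HeightOneSpectrum.intValuation_le_pow_iff_mem, ← h, ← smul_pow',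
      Ideal.smul_mem_pointwise_smul_iff]
  obtain rfl | hr := eq_or_ne r 0
  · simp
  have hr' : σ • r ≠ 0 := by rwa [Ne, smul_eq_zero_iff_eq]
  refine le_antisymm ?_ ?_
  · rw [w'.intValuation_eq_exp_neg_multiplicity hr, hiff,
      w'.intValuation_eq_exp_neg_multiplicity hr]
  · rw [w.intValuation_eq_exp_neg_multiplicity hr', ← hiff,
      w.intValuation_eq_exp_neg_multiplicity hr']

theorem valuation_apply_eq {σ : F' ≃ₐ[F] F'} {w w' : HeightOneSpectrum (𝓞 F')}
    (h : σ • w'.asIdeal = w.asIdeal) (x : F') : w.valuation F' (σ x) = w'.valuation F' x := by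
  have hinteger : ∀ r : 𝓞 F', w.valuation F' (σ (algebraMap (𝓞 F') F' r)) =
      w'.valuation F' (algebraMap (𝓞 F') F' r) := by
    intro r
    rw [show σ (algebraMap (𝓞 F') F' r) = algebraMap (𝓞 F') F' (σ • r) from rfl,
      HeightOneSpectrum.valuation_of_algebraMap, HeightOneSpectrum.valuation_of_algebraMap,
      intValuation_smul h]
  obtain ⟨a, b, -, rfl⟩ := IsFractionRing.div_surjective (A := 𝓞 F') x
  rw [map_div₀, map_div₀, map_div₀, hinteger, hinteger]

variable {w : HeightOneSpectrum (𝓞 F')}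

/-- The automorphism `σ` of `F'` as an endomorphism of `F'` with the `w`-adic topology. -/
noncomputable def withValMap (w : HeightOneSpectrum (𝓞 F')) (σ : F' ≃ₐ[F] F') :
    WithVal (w.valuation F') →+* WithVal (w.valuation F') :=
  ((WithVal.equiv (w.valuation F')).symm.toRingHom.comp (σ : F' →+* F')).comp
    (WithVal.equiv (w.valuation F')).toRingHom

theorem continuous_withValMap {σ : F' ≃ₐ[F] F'} (h : σ • w.asIdeal = w.asIdeal) :
    Continuous (withValMap w σ) := by
  refine continuous_of_continuousAt_zero (withValMap w σ) ?_
  rw [ContinuousAt, map_zero]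
  have hsurj : Function.Surjective
      (Valued.v : WithVal (w.valuation F') → WithZero (Multiplicative ℤ)) := fun c => by
    obtain ⟨x, hx⟩ := w.valuation_surjective F' c
    exact ⟨(WithVal.equiv (w.valuation F')).symm x, hx⟩
  intro S hS
  obtain ⟨m, hm⟩ := (mem_nhds_zero_iff_exists_valued_le_exp hsurj).1 hS
  refine (mem_nhds_zero_iff_exists_valued_le_exp hsurj).2 ⟨m, fun x hx => hm ?_⟩
  have hval : Valued.v (withValMap w σ x) = Valued.v x := valuation_apply_eq h _
  rwa [Set.mem_ofPred_eq, hval]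

/-- The continuous extension to `F'_w` of an automorphism of `F'` in the decomposition group of
the prime `w`. -/
noncomputable def completionAut (w : HeightOneSpectrum (𝓞 F')) (σ : F' ≃ₐ[F] F')
    (h : σ • w.asIdeal = w.asIdeal) : w.adicCompletion F' →+* w.adicCompletion F' :=
  ((HeightOneSpectrum.adicCompletion.equiv F' w).symm.toRingHom.comp
    (UniformSpace.Completion.mapRingHom (withValMap w σ) (continuous_withValMap h))).comp
    (HeightOneSpectrum.adicCompletion.equiv F' w).toRingHom

variable {σ : F' ≃ₐ[F] F'} (h : σ • w.asIdeal = w.asIdeal)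

theorem completionAut_coe (x : F') :
    completionAut w σ h (algebraMap F' _ x) = algebraMap F' _ (σ x) := by
  change HeightOneSpectrum.adicCompletion.ofCompletion (UniformSpace.Completion.mapRingHom
    (withValMap w σ) (continuous_withValMap h)
    (((WithVal.equiv (w.valuation F')).symm x : WithVal (w.valuation F')) :
      (w.valuation F').Completion)) = _
  rw [UniformSpace.Completion.mapRingHom_coe (continuous_withValMap h)]
  rfl

theorem continuous_completionAut : Continuous (completionAut w σ h) := by
  refine (HeightOneSpectrum.adicCompletion.continuous_ofCompletion F' w).comp ?_
  exact UniformSpace.Completion.continuous_map.comp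
    (HeightOneSpectrum.adicCompletion.continuous_toCompletion F' _)

theorem valued_completionAut (x : w.adicCompletion F') :
    Valued.v (completionAut w σ h x) = Valued.v x := by
  refine valued_map_eq_of_denseRange (continuous_completionAut h) (w.denseRange_algebraMap F')
    (fun y => ?_) x
  rw [completionAut_coe]
  exact (HeightOneSpectrum.valuedAdicCompletion_eq_valuation' w (σ y)).trans
    ((valuation_apply_eq h y).trans (HeightOneSpectrum.valuedAdicCompletion_eq_valuation' w y).symm)

theorem completionAut_mem {x : w.adicCompletion F'} (hx : x ∈ w.adicCompletionIntegers F') :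
    completionAut w σ h x ∈ w.adicCompletionIntegers F' := by
  rwa [HeightOneSpectrum.mem_adicCompletionIntegers, valued_completionAut]

theorem iterate_completionAut_coe (k : ℕ) (y : F') :
    (completionAut w σ h)^[k] (algebraMap F' _ y) = algebraMap F' _ ((σ ^ k) y) := by
  induction k generalizing y with
  | zero => rfl
  | succ k ih => rw [Function.iterate_succ_apply, completionAut_coe, ih, pow_succ]; rfl

theorem iterate_completionAut {p : ℕ} (hp : σ ^ p = 1) (x : w.adicCompletion F') :
    (completionAut w σ h)^[p] x = x := by
  refine congrFun ((w.denseRange_algebraMap F').equalizer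
    ((continuous_completionAut h).iterate p) continuous_id ?_) x
  funext y
  simp only [Function.comp_apply, iterate_completionAut_coe, hp]
  rfl

theorem completionAut_completionMap [NumberField F]
    (a : (w.under (𝓞 F)).adicCompletion F) :
    completionAut w σ h (completionMap F F' w a) = completionMap F F' w a := by
  refine congrFun (((w.under (𝓞 F)).denseRange_algebraMap F).equalizer
    ((continuous_completionAut h).comp (continuous_completionMap F F' w))
    (continuous_completionMap F F' w) ?_) a
  funext x
  simp only [Function.comp_apply, completionMap_coe]
  rw [completionAut_coe, σ.commutes]

theorem valuation_pow_apply_sub_le_one (h : σ • w.asIdeal = w.asIdeal) {y : F'}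
    (hy : w.valuation F' (σ y - y) ≤ 1) (k : ℕ) : w.valuation F' ((σ ^ k) y - y) ≤ 1 := by
  induction k with
  | zero => simp
  | succ k ih =>
    rw [show (σ ^ (k + 1)) y - y = σ ((σ ^ k) y - y) + (σ y - y) by
      rw [pow_succ', map_sub, AlgEquiv.mul_apply]
      ring]
    refine (Valuation.map_add _ _ _).trans (max_le ?_ hy)
    rwa [valuation_apply_eq h]

end Automorphism

section ConjPrime

open scoped Pointwise

variable {F F' : Type*} [Field F] [Field F'] [Algebra F F']

/-- The prime `σ⁻¹ w` of `F'`. -/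
def conjPrime (w : HeightOneSpectrum (𝓞 F')) (σ : F' ≃ₐ[F] F') : HeightOneSpectrum (𝓞 F') :=
  ⟨σ⁻¹ • w.asIdeal, inferInstance, by
    rw [Ne, ← Ideal.zero_eq_bot, smul_eq_zero_iff_eq]
    exact w.ne_bot⟩

theorem smul_conjPrime (w : HeightOneSpectrum (𝓞 F')) (σ : F' ≃ₐ[F] F') :
    σ • (conjPrime w σ).asIdeal = w.asIdeal :=
  smul_inv_smul σ w.asIdeal

theorem conjPrime_eq_iff {w : HeightOneSpectrum (𝓞 F')} {σ : F' ≃ₐ[F] F'} :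
    conjPrime w σ = w ↔ σ ∈ MulAction.stabilizer (F' ≃ₐ[F] F') w.asIdeal := by
  rw [HeightOneSpectrum.ext_iff, MulAction.mem_stabilizer_iff]
  change σ⁻¹ • w.asIdeal = w.asIdeal ↔ _
  rw [inv_smul_eq_iff, eq_comm]

end ConjPrime

/-! ### Approximation by elements of the ground field -/

section Approximation

open scoped Pointwise

variable {F F' : Type*} [Field F] [Field F'] [NumberField F'] [Algebra F F']

theorem exists_exp_neg_mul_valuation_le_one (u : HeightOneSpectrum (𝓞 F')) (y : F') :
    ∃ N : ℕ, WithZero.exp (-(N : ℤ)) * u.valuation F' y ≤ 1 := by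
  obtain hzero | hzero := eq_or_ne (u.valuation F' y) 0
  · exact ⟨0, by simp [hzero]⟩
  · obtain ⟨N, hN, -⟩ := WithZero.exists_exp_neg_natCast_lt_and_lt (inv_ne_zero hzero)
      (inv_ne_zero hzero)
    refine ⟨N, ?_⟩
    have hmul := mul_le_mul_left hN.le (u.valuation F' y)
    rwa [inv_mul_cancel₀ hzero] at hmul

theorem exists_forall_mem_pow_valuation_mul_le_one {ι : Type*} [Finite ι]
    (c : ι → HeightOneSpectrum (𝓞 F')) (y : F') :
    ∃ M : ℕ, ∀ i, ∀ a ∈ (c i).asIdeal ^ M,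
      (c i).valuation F' (algebraMap (𝓞 F') F' a * y) ≤ 1 := by
  cases nonempty_fintype ι
  choose N hN using fun i => exists_exp_neg_mul_valuation_le_one (c i) y
  refine ⟨Finset.univ.sup N, fun i a ha => ?_⟩
  rw [map_mul, HeightOneSpectrum.valuation_of_algebraMap]
  rw [← HeightOneSpectrum.intValuation_le_pow_iff_mem] at ha
  refine le_trans (mul_le_mul_left (ha.trans ?_) _) (hN i)
  rw [WithZero.exp_le_exp, neg_le_neg_iff, Nat.cast_le]
  exact Finset.le_sup (Finset.mem_univ i)

open Classical in
-- `e` is close to `1` at `w` and close to `0` at the other conjugates of `w`.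
theorem exists_valuation_apply_mul_sub_le_one [FiniteDimensional F F']
    (w : HeightOneSpectrum (𝓞 F')) (y : F') :
    ∃ e : 𝓞 F', ∀ σ : F' ≃ₐ[F] F', w.valuation F' (σ (algebraMap (𝓞 F') F' e * y) -
      if σ ∈ MulAction.stabilizer (F' ≃ₐ[F] F') w.asIdeal then σ y else 0) ≤ 1 := by
  obtain ⟨M, hM⟩ := exists_forall_mem_pow_valuation_mul_le_one (conjPrime (F := F) w) y
  obtain ⟨e, he⟩ := IsDedekindDomain.exists_forall_sub_mem_ideal
    (s := Finset.univ.image (conjPrime (F := F) w)) (fun u => u.asIdeal) (fun _ => M)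
    (fun u _ => u.prime) (fun u _ u' _ hne h => hne (HeightOneSpectrum.ext h))
    (fun u => if u.1 = w then 1 else 0)
  refine ⟨e, fun σ => ?_⟩
  have hσ := hM σ _ (he (conjPrime w σ) (Finset.mem_image_of_mem _ (Finset.mem_univ σ)))
  rw [← valuation_apply_eq (smul_conjPrime w σ)] at hσ
  simp only [conjPrime_eq_iff] at hσ
  split_ifs at hσ ⊢ with hmem
  · rwa [map_sub, map_one, sub_mul, one_mul, map_sub] at hσ
  · rwa [sub_zero] at hσ ⊢

variable [NumberField F] [IsGalois F F']

-- Averaging: `y` is approximated by `tr(e y) / #D`, where `D` is the decomposition group.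
theorem exists_valuation_sub_algebraMap_le_one {w : HeightOneSpectrum (𝓞 F')}
    (hD : (Nat.card (MulAction.stabilizer (F' ≃ₐ[F] F') w.asIdeal) : 𝓞 F') ∉ w.asIdeal) (y : F')
    (hy : ∀ σ ∈ MulAction.stabilizer (F' ≃ₐ[F] F') w.asIdeal, w.valuation F' (σ y - y) ≤ 1) :
    ∃ z : F, w.valuation F' (y - algebraMap F F' z) ≤ 1 := by
  classical
  set D := MulAction.stabilizer (F' ≃ₐ[F] F') w.asIdeal
  obtain ⟨e, he⟩ := exists_valuation_apply_mul_sub_le_one (F := F) w y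
  set t := Algebra.trace F F' (algebraMap (𝓞 F') F' e * y) with ht
  have hsum : w.valuation F' (algebraMap F F' t - Nat.card D * y) ≤ 1 := by
    have hcard : (Nat.card D : F') * y = ∑ σ : F' ≃ₐ[F] F', if σ ∈ D then y else 0 := by
      rw [← Finset.sum_filter, Finset.sum_const, nsmul_eq_mul, Nat.card_eq_fintype_card,
        Fintype.card_subtype]
    rw [ht, trace_eq_sum_automorphisms, hcard, ← Finset.sum_sub_distrib]
    refine Valuation.map_sum_le _ fun σ _ => ?_
    rw [← sub_add_sub_cancel _ (if σ ∈ D then σ y else 0)]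
    refine (Valuation.map_add _ _ _).trans (max_le (he σ) ?_)
    split_ifs with hσ
    · exact hy σ hσ
    · simp
  have hunit : w.valuation F' (Nat.card D : F') = 1 := by
    simpa using (w.valuation_eq_one_iff_notMem (K := F')).2 hD
  have hne : (Nat.card D : F') ≠ 0 := by
    rw [← (w.valuation F').ne_zero_iff, hunit]
    exact one_ne_zero
  refine ⟨t / Nat.card D, ?_⟩
  rw [show y - algebraMap F F' (t / Nat.card D) =
      -((algebraMap F F' t - Nat.card D * y) / (Nat.card D : F')) by
    rw [map_div₀, map_natCast]
    field_simp
    ring, Valuation.map_neg, map_div₀, hunit, div_one]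
  exact hsum

variable {w : HeightOneSpectrum (𝓞 F')} {σ : F' ≃ₐ[F] F'} (h : σ • w.asIdeal = w.asIdeal)

theorem exists_sub_completionMap_mem
    (hgen : ∀ τ ∈ MulAction.stabilizer (F' ≃ₐ[F] F') w.asIdeal, ∃ k : ℕ, σ ^ k = τ)
    (hD : (Nat.card (MulAction.stabilizer (F' ≃ₐ[F] F') w.asIdeal) : 𝓞 F') ∉ w.asIdeal)
    {x : w.adicCompletion F'} (hx : completionAut w σ h x - x ∈ w.adicCompletionIntegers F') :
    ∃ y, x - completionMap F F' w y ∈ w.adicCompletionIntegers F' := by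
  obtain ⟨y, hy⟩ := exists_sub_algebraMap_mem_adicCompletionIntegers x
  have hσy : w.valuation F' (σ y - y) ≤ 1 := by
    rw [← algebraMap_mem_adicCompletionIntegers_iff, map_sub, ← completionAut_coe h]
    have hmem := add_mem (sub_mem hx (completionAut_mem h hy)) hy
    rw [map_sub] at hmem
    convert hmem using 1
    ring
  obtain ⟨z, hz⟩ := exists_valuation_sub_algebraMap_le_one hD y fun τ hτ => by
    obtain ⟨k, rfl⟩ := hgen τ hτ
    exact valuation_pow_apply_sub_le_one h hσy k
  refine ⟨algebraMap F _ z, ?_⟩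
  rw [completionMap_coe]
  rw [← algebraMap_mem_adicCompletionIntegers_iff, map_sub] at hz
  simpa using add_mem hy hz

end Approximation

section CyclicBaseChange

open scoped Pointwise

variable {F F' : Type*} [Field F] [NumberField F] [Field F'] [NumberField F'] [Algebra F F']
  {w : HeightOneSpectrum (𝓞 F')} [Algebra.IsUnramifiedAt (𝓞 F) w.asIdeal]

theorem mem_range_completionMap_of_approx {x : w.adicCompletion F'}
    (happrox : ∀ m : ℕ, ∃ y, Valued.v (x - completionMap F F' w y) ≤ WithZero.exp (-(m : ℤ))) :
    x ∈ Set.range (completionMap F F' w) := by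
  rw [← (isClosed_range_completionMap F F' w).closure_eq, mem_closure_iff_nhds]
  intro T hT
  have hT' : (fun z => x - z) ⁻¹' T ∈ nhds (0 : w.adicCompletion F') := by
    refine (continuous_sub_left x).continuousAt.preimage_mem_nhds ?_
    simpa using hT
  obtain ⟨m, hm⟩ := (mem_nhds_zero_iff_exists_valued_le_exp
    (w.valuedAdicCompletion_surjective F')).1 hT'
  obtain ⟨y, hy⟩ := happrox m
  exact ⟨completionMap F F' w y, by simpa using hm hy, y, rfl⟩

theorem mem_range_completionMap_of_completionAut_eq {σ : F' ≃ₐ[F] F'}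
    (h : σ • w.asIdeal = w.asIdeal)
    (hsub : ∀ x, completionAut w σ h x - x ∈ w.adicCompletionIntegers F' →
      ∃ y, x - completionMap F F' w y ∈ w.adicCompletionIntegers F')
    {x : w.adicCompletion F'} (hx : completionAut w σ h x = x) :
    x ∈ Set.range (completionMap F F' w) := by
  obtain ⟨a, ha⟩ := (w.under (𝓞 F)).valuedAdicCompletion_surjective F (WithZero.exp (-1 : ℤ))
  have ha0 : completionMap F F' w a ≠ 0 := by
    rw [← Valuation.ne_zero_iff Valued.v, valued_completionMap, ha]
    exact WithZero.exp_ne_zero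
  refine mem_range_completionMap_of_approx fun m => ?_
  obtain ⟨y, hy⟩ := hsub (x / completionMap F F' w a ^ m) (by
    rw [map_div₀, map_pow, completionAut_completionMap, hx, sub_self]
    exact zero_mem _)
  refine ⟨a ^ m * y, ?_⟩
  rw [show x - completionMap F F' w (a ^ m * y) =
      completionMap F F' w a ^ m * (x / completionMap F F' w a ^ m - completionMap F F' w y) by
    rw [map_mul, map_pow]
    field_simp, map_mul, map_pow, valued_completionMap, ha, ← WithZero.exp_nsmul]
  refine (mul_le_mul' le_rfl ((HeightOneSpectrum.mem_adicCompletionIntegers (𝓞 F') F' w).1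
    hy)).trans ?_
  simp

variable [IsGalois F F']

theorem exists_isCyclicBaseChange {p : ℕ} (hp : p.Prime) (hdeg : Module.finrank F F' = p)
    (hpw : (p : 𝓞 F') ∉ w.asIdeal) :
    ∃ γ ϖ ϖ', IsCyclicBaseChange p ((w.under (𝓞 F)).adicCompletionIntegers F)
      (w.adicCompletionIntegers F') (completionMap F F' w) γ ϖ ϖ' := by
  have hcard : Nat.card (F' ≃ₐ[F] F') = p := by rw [IsGalois.card_aut_eq_finrank, hdeg]
  have := Fact.mk hp
  have hcyc : IsCyclic (F' ≃ₐ[F] F') := isCyclic_of_prime_card hcard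
  set D := MulAction.stabilizer (F' ≃ₐ[F] F') w.asIdeal
  obtain ⟨⟨σ, hσ⟩, hgen⟩ := IsCyclic.exists_generator (α := D)
  have hpowers : ∀ τ ∈ D, ∃ k : ℕ, σ ^ k = τ := by
    intro τ hτ
    obtain ⟨k, hk⟩ := mem_powers_iff_mem_zpowers.2 (hgen ⟨τ, hτ⟩)
    exact ⟨k, congrArg Subtype.val hk⟩
  have hD : (Nat.card D : 𝓞 F') ∉ w.asIdeal := by
    rcases (Nat.dvd_prime hp).1 (hcard ▸ D.card_subgroup_dvd_card) with hone | hprime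
    · rw [hone, Nat.cast_one]
      exact fun h => w.isPrime.ne_top ((Ideal.eq_top_iff_one _).2 h)
    · rwa [hprime]
  have hsub := fun x => exists_sub_completionMap_mem (x := x) hσ hpowers hD
  obtain ⟨a, ha⟩ := (w.under (𝓞 F)).valuedAdicCompletion_surjective F (WithZero.exp (-1 : ℤ))
  have ha_mem : a ∈ (w.under (𝓞 F)).adicCompletionIntegers F := by
    rw [HeightOneSpectrum.mem_adicCompletionIntegers, ha, ← WithZero.exp_zero,
      WithZero.exp_le_exp]
    norm_num
  exact ⟨completionAut w σ hσ, ⟨a, ha_mem⟩,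
    ⟨completionMap F F' w a, (completionMap_mem_iff F F' w).2 ha_mem⟩,
    irreducible_of_valued_eq ha,
    irreducible_of_valued_eq ((valued_completionMap F F' w a).trans ha), rfl,
    fun _ => completionMap_mem_iff F F' w, completionAut_completionMap hσ,
    iterate_completionAut hσ (by rw [← hcard, pow_card_eq_one']),
    fun x hx => completionAut_mem hσ hx,
    fun x hx => (mem_range_completionMap_of_completionAut_eq hσ hsub hx).imp fun _ => Eq.symm, hsub⟩

end CyclicBaseChange

/-! ### Quadratic extensions -/

section Quadratic

variable {F K : Type*} [Field F] [Field K] [Algebra F K] [Algebra.IsQuadraticExtension F K]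

section Galois

variable [IsGalois F K]

theorem eq_one_or_eq_of_ne_one {ρ : K ≃ₐ[F] K} (hρ : ρ ≠ 1) (σ : K ≃ₐ[F] K) :
    σ = 1 ∨ σ = ρ := by
  have hcard : Nat.card (K ≃ₐ[F] K) = 2 := by
    rw [IsGalois.card_aut_eq_finrank, Algebra.IsQuadraticExtension.finrank_eq_two]
  obtain ⟨a, -, ha⟩ := Nat.card_eq_two_iff' (1 : K ≃ₐ[F] K) |>.1 hcard
  exact or_iff_not_imp_left.2 fun hσ => (ha σ hσ).trans (ha ρ hρ).symm

theorem apply_apply_eq_self (ρ : K ≃ₐ[F] K) (x : K) : ρ (ρ x) = x := by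
  have hcard : Nat.card (K ≃ₐ[F] K) = 2 := by
    rw [IsGalois.card_aut_eq_finrank, Algebra.IsQuadraticExtension.finrank_eq_two]
  have hsq : ρ ^ 2 = 1 := by rw [← hcard, pow_card_eq_one']
  exact congrArg (fun σ : K ≃ₐ[F] K => σ x) hsq

theorem mem_range_algebraMap_of_apply_eq {ρ : K ≃ₐ[F] K} (hρ : ρ ≠ 1) {x : K} (hx : ρ x = x) :
    x ∈ Set.range (algebraMap F K) := by
  refine (IsGalois.mem_range_algebraMap_iff_fixed x).2 fun σ => ?_
  rcases eq_one_or_eq_of_ne_one hρ σ with rfl | rfl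
  · rfl
  · exact hx

end Galois

theorem bijective_coord_tensorProduct (A : Type*) [CommRing A] [Algebra F A] {θ : K}
    (hθ : θ ∉ Set.range (algebraMap F K)) :
    Function.Bijective fun ab : A × A => algebraMap A (A ⊗[F] K) ab.1 +
      algebraMap A (A ⊗[F] K) ab.2 * (1 ⊗ₜ θ) := by
  have hli : LinearIndependent F ![1, θ] := by
    rw [LinearIndependent.pair_iff' one_ne_zero]
    intro a ha
    exact hθ ⟨a, by rw [← ha, Algebra.smul_def, mul_one]⟩
  let b := basisOfLinearIndependentOfCardEqFinrank hli
    (by rw [Fintype.card_fin, Algebra.IsQuadraticExtension.finrank_eq_two])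
  let B := Algebra.TensorProduct.basis A b
  have hB₀ : B 0 = 1 ⊗ₜ 1 := by simp [B, b, Algebra.TensorProduct.basis_apply]
  have hB₁ : B 1 = 1 ⊗ₜ θ := by simp [B, b, Algebra.TensorProduct.basis_apply]
  convert ((finTwoArrowEquiv A).symm.trans B.equivFun.symm.toEquiv).bijective using 1
  ext ab
  simp only [Equiv.trans_apply, LinearEquiv.coe_toEquiv, Module.Basis.equivFun_symm_apply,
    Fin.sum_univ_two, hB₀, hB₁]
  simp [Algebra.smul_def, finTwoArrowEquiv, ← Algebra.TensorProduct.one_def]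

end Quadratic

theorem exists_under_eq {F K : Type*} [Field F] [Field K] [Algebra F K]
    (v : HeightOneSpectrum (𝓞 F)) :
    ∃ w : HeightOneSpectrum (𝓞 K), w.under (𝓞 F) = v := by
  obtain ⟨⟨Q, hQ, hQv⟩⟩ := v.asIdeal.nonempty_primesOver (S := 𝓞 K)
  exact ⟨⟨Q, hQ, Ideal.ne_bot_of_liesOver_of_ne_bot v.ne_bot Q⟩,
    HeightOneSpectrum.ext hQv.over.symm⟩

section UnitDiscriminant

open scoped Pointwise

variable {F K : Type*} [Field F] [NumberField F] [Field K] [NumberField K] [Algebra F K]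

theorem exists_smul_sub_notMem [IsGalois F K] {σ : K ≃ₐ[F] K} (hσ : σ ≠ 1)
    (w : HeightOneSpectrum (𝓞 K)) [Algebra.IsUnramifiedAt (𝓞 F) w.asIdeal] :
    ∃ θ : 𝓞 K, σ • θ - θ ∉ w.asIdeal := by
  have hcard := Ideal.card_inertia_eq_ramificationIdxIn (G := K ≃ₐ[F] K)
    (w.under (𝓞 F)).asIdeal w.asIdeal
  rw [Ideal.ramificationIdxIn_eq_ramificationIdx (w.under (𝓞 F)).asIdeal w.asIdeal (K ≃ₐ[F] K),
    Ideal.ramificationIdx_eq_one] at hcard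
  by_contra! hmem
  have hinertia : σ ∈ Ideal.inertia (K ≃ₐ[F] K) w.asIdeal := hmem
  rw [Subgroup.card_eq_one.1 hcard, Subgroup.mem_bot] at hinertia
  exact hσ hinertia

variable [Algebra.IsQuadraticExtension F K]

theorem exists_algebraMap_eq_of_smul_eq {ρ : K ≃ₐ[F] K} (hρ : ρ ≠ 1) {x : 𝓞 K}
    (hx : ρ • x = x) : ∃ a : 𝓞 F, algebraMap (𝓞 F) (𝓞 K) a = x := by
  refine Algebra.IsInvariant.isInvariant (G := K ≃ₐ[F] K) x fun σ => ?_
  rcases eq_one_or_eq_of_ne_one hρ σ with rfl | rfl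
  · exact one_smul _ x
  · exact hx

theorem exists_discriminant_notMem {ρ : K ≃ₐ[F] K} (hρ : ρ ≠ 1) {v : HeightOneSpectrum (𝓞 F)}
    (hunram : ∀ w : HeightOneSpectrum (𝓞 K), w.under (𝓞 F) = v →
      Algebra.IsUnramifiedAt (𝓞 F) w.asIdeal) :
    ∃ (θ : K) (s P : 𝓞 F), algebraMap F K (algebraMap (𝓞 F) F s) = θ + ρ θ ∧
      algebraMap F K (algebraMap (𝓞 F) F P) = θ * ρ θ ∧ s ^ 2 - 4 * P ∉ v.asIdeal := by
  obtain ⟨w, rfl⟩ := exists_under_eq (K := K) v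
  have := hunram w rfl
  obtain ⟨θ, hθ⟩ := exists_smul_sub_notMem hρ w
  have hρρ : ρ • ρ • θ = θ := Subtype.ext (apply_apply_eq_self ρ θ)
  obtain ⟨s, hs⟩ := exists_algebraMap_eq_of_smul_eq hρ (x := θ + ρ • θ)
    (by rw [smul_add, hρρ, add_comm])
  obtain ⟨P, hP⟩ := exists_algebraMap_eq_of_smul_eq hρ (x := θ * ρ • θ)
    (by rw [smul_mul', hρρ, mul_comm])
  have hdisc : algebraMap (𝓞 F) (𝓞 K) (s ^ 2 - 4 * P) = (ρ • θ - θ) ^ 2 := by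
    rw [map_sub, map_pow, map_mul, hs, hP, map_ofNat]
    ring
  refine ⟨θ, s, P, congrArg Subtype.val hs, congrArg Subtype.val hP, fun hmem => hθ ?_⟩
  replace hmem : algebraMap (𝓞 F) (𝓞 K) (s ^ 2 - 4 * P) ∈ w.asIdeal := hmem
  rw [hdisc] at hmem
  exact w.isPrime.mem_of_pow_mem _ hmem

end UnitDiscriminant

section LocalAlg

variable {F K : Type*} [Field F] [NumberField F] [Field K] [Algebra F K]
  {v : HeightOneSpectrum (𝓞 F)}

theorem localConj_tmul (ρ : K ≃ₐ[F] K) (a : v.adicCompletion F) (k : K) :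
    localConj F ρ v (a ⊗ₜ k) = a ⊗ₜ ρ k :=
  tensorMap_tmul _ _ _ _ _ a k

theorem algebraMap_algebraMap_localAlg (a : F) :
    algebraMap (v.adicCompletion F) (LocalAlg F K v) (algebraMap F _ a) =
      1 ⊗ₜ algebraMap F K a := by
  rw [Algebra.TensorProduct.algebraMap_apply, Algebra.algebraMap_self_apply,
    Algebra.algebraMap_eq_smul_one, TensorProduct.smul_tmul, Algebra.algebraMap_eq_smul_one]

theorem isUnramifiedQuadratic_localAlg [Algebra.IsQuadraticExtension F K] {ρ : K ≃ₐ[F] K}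
    {θ : K} {s P : F} (hs : algebraMap F K s = θ + ρ θ) (hP : algebraMap F K P = θ * ρ θ)
    (hsv : v.valuation F s ≤ 1) (hPv : v.valuation F P ≤ 1)
    (hdisc : v.valuation F (s ^ 2 - 4 * P) = 1) :
    IsUnramifiedQuadratic (v.adicCompletionIntegers F) (localConj F ρ v)
      ((1 : v.adicCompletion F) ⊗ₜ[F] θ) (algebraMap F _ s) (algebraMap F _ P) := by
  have hdisc₀ : s ^ 2 - 4 * P ≠ 0 := by
    rw [← (v.valuation F).ne_zero_iff, hdisc]
    exact one_ne_zero
  have hθ : θ ∉ Set.range (algebraMap F K) := by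
    rintro ⟨a, rfl⟩
    rw [ρ.commutes, ← map_add] at hs
    rw [ρ.commutes, ← map_mul] at hP
    refine hdisc₀ ?_
    rw [(algebraMap F K).injective hs, (algebraMap F K).injective hP]
    ring
  refine ⟨algebraMap_mem_adicCompletionIntegers_iff.2 hsv,
    algebraMap_mem_adicCompletionIntegers_iff.2 hPv,
    ⟨algebraMap F _ (s ^ 2 - 4 * P)⁻¹, ?_, ?_⟩, ?_, ?_, fun a => ?_,
    bijective_coord_tensorProduct _ hθ⟩
  · rw [algebraMap_mem_adicCompletionIntegers_iff, map_inv₀, hdisc, inv_one]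
  · rw [← map_one (algebraMap F (v.adicCompletion F)), ← mul_inv_cancel₀ hdisc₀, map_mul]
    simp only [map_sub, map_mul, map_pow, map_ofNat]
  · rw [algebraMap_algebraMap_localAlg, algebraMap_algebraMap_localAlg, hs, hP,
      Algebra.TensorProduct.tmul_mul_tmul, Algebra.TensorProduct.tmul_mul_tmul,
      mul_one, ← TensorProduct.tmul_sub]
    congr 1
    ring
  · rw [algebraMap_algebraMap_localAlg, hs, localConj_tmul, ← TensorProduct.tmul_sub,
      add_sub_cancel_left]
  · rw [Algebra.TensorProduct.algebraMap_apply, localConj_tmul, map_one]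

end LocalAlg

/-! ### Reduced fractions over a completed quadratic extension -/

section ReducedFraction

variable {R : Type*} [CommRing R]

theorem exists_retraction_ker [IsDomain R] [IsPrincipalIdealRing R] {M N : Type*}
    [AddCommGroup M] [AddCommGroup N] [Module R M] [Module R N] [Module.Finite R M]
    [Module.IsTorsionFree R N] (f : M →ₗ[R] N) :
    ∃ r : M →ₗ[R] LinearMap.ker f, ∀ z : LinearMap.ker f, r z = z := by
  obtain ⟨σ, hσ⟩ := Module.projective_lifting_property f.rangeRestrict
    (LinearMap.id : LinearMap.range f →ₗ[R] LinearMap.range f) f.surjective_rangeRestrict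
  have hfσ (z : M) : f (σ (f.rangeRestrict z)) = f z :=
    congrArg Subtype.val (LinearMap.congr_fun hσ (f.rangeRestrict z))
  refine ⟨(LinearMap.id - σ ∘ₗ f.rangeRestrict).codRestrict (LinearMap.ker f) fun z => ?_,
    fun z => Subtype.ext ?_⟩
  · have hz : f.rangeRestrict z.1 = 0 := Subtype.ext z.2
    rw [LinearMap.codRestrict_apply, LinearMap.sub_apply, LinearMap.comp_apply, hz, map_zero,
      sub_zero, LinearMap.id_apply]
  · rw [LinearMap.mem_ker, LinearMap.sub_apply, map_sub, LinearMap.id_apply, LinearMap.comp_apply,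
      hfσ, sub_self]

variable {L : Type*} [Field L] [Algebra R L] {n : ℕ}

/-- The map `(a, b) ↦ b x - a` on pairs of integral row vectors. The rows of `[c d]`, for a reduced
fraction `x = d⁻¹ c`, are a basis of its kernel. -/
def rowDefect (x : Matrix (Fin n) (Fin n) L) : (Fin n → R) × (Fin n → R) →ₗ[R] (Fin n → L) :=
  ((Matrix.vecMulLinear x).restrictScalars R ∘ₗ (Algebra.linearMap R L).compLeft (Fin n)).coprod
      (-(Algebra.linearMap R L).compLeft (Fin n)) ∘ₗ
    (LinearEquiv.prodComm R (Fin n → R) (Fin n → R)).toLinearMap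

theorem mem_ker_rowDefect {x : Matrix (Fin n) (Fin n) L} {z : (Fin n → R) × (Fin n → R)} :
    z ∈ LinearMap.ker (rowDefect x) ↔ (algebraMap R L ∘ z.2) ᵥ* x = algebraMap R L ∘ z.1 := by
  rw [LinearMap.mem_ker, ← sub_eq_zero (b := algebraMap R L ∘ z.1), sub_eq_add_neg]
  rfl

variable [IsFractionRing R L]

theorem injective_snd_ker_rowDefect (x : Matrix (Fin n) (Fin n) L) :
    Function.Injective
      (LinearMap.snd R _ _ ∘ₗ (LinearMap.ker (rowDefect (R := R) x)).subtype) := by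
  rw [← LinearMap.ker_eq_bot, LinearMap.ker_eq_bot']
  rintro ⟨⟨a, b⟩, hz⟩ (rfl : b = 0)
  refine Subtype.ext (Prod.ext (funext fun i => IsFractionRing.injective R L ?_) rfl)
  simpa [Matrix.vecMul, dotProduct] using (congrFun (mem_ker_rowDefect.1 hz) i).symm

variable [IsDomain R]

-- If `D` is a common denominator of the entries of `x`, then `e ↦ (e (D x), D e)` is injective.
theorem exists_injective_ker_rowDefect (x : Matrix (Fin n) (Fin n) L) :
    ∃ f : (Fin n → R) →ₗ[R] LinearMap.ker (rowDefect (R := R) x), Function.Injective f := by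
  obtain ⟨D, hD⟩ := IsLocalization.exist_integer_multiples_of_finite (nonZeroDivisors R)
    (fun ij : Fin n × Fin n => x ij.1 ij.2)
  choose y hy using hD
  have hDx : (Matrix.of fun i j => y (i, j)).map (algebraMap R L) = (D : R) • x := by
    ext i j
    exact hy (i, j)
  refine ⟨((Matrix.vecMulLinear (Matrix.of fun i j => y (i, j))).prod
    ((D : R) • LinearMap.id)).codRestrict _ fun e => mem_ker_rowDefect.2 ?_, ?_⟩
  · have hleft : algebraMap R L ∘ ((D : R) • e) = (D : R) • (algebraMap R L ∘ e) := by
      ext i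
      simp [Algebra.smul_def]
    have hright : algebraMap R L ∘ (e ᵥ* Matrix.of fun i j => y (i, j)) =
        (algebraMap R L ∘ e) ᵥ* ((D : R) • x) := by
      rw [← hDx]
      exact funext fun j => RingHom.map_vecMul (algebraMap R L) _ e j
    change (algebraMap R L ∘ ((D : R) • e)) ᵥ* x =
      algebraMap R L ∘ (e ᵥ* Matrix.of fun i j => y (i, j))
    rw [hleft, hright, Matrix.smul_vecMul, Matrix.vecMul_smul]
  · rw [← LinearMap.ker_eq_bot, LinearMap.ker_eq_bot']
    intro e he
    have hDe : (D : R) • e = 0 := congrArg (fun z => z.1.2) he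
    exact (smul_eq_zero.1 hDe).resolve_left (nonZeroDivisors.ne_zero D.2)

theorem det_ne_zero_of_isPrimitive {x : Matrix (Fin n) (Fin n) L}
    {c d u w : Matrix (Fin n) (Fin n) R}
    (hdx : d.map (algebraMap R L) * x = c.map (algebraMap R L)) (huw : c * u + d * w = 1) :
    d.det ≠ 0 := by
  intro hdet
  obtain ⟨y, hy₀, hyd⟩ := Matrix.exists_vecMul_eq_zero_iff.2 hdet
  have hmap (e : Matrix (Fin n) (Fin n) R) :
      (algebraMap R L ∘ y) ᵥ* e.map (algebraMap R L) = algebraMap R L ∘ (y ᵥ* e) :=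
    funext fun j => (RingHom.map_vecMul (algebraMap R L) e y j).symm
  have hyc : y ᵥ* c = 0 := by
    refine (IsFractionRing.injective R L).comp_left ?_
    have h₀ : algebraMap R L ∘ (0 : Fin n → R) = 0 := by
      ext
      simp
    change algebraMap R L ∘ (y ᵥ* c) = algebraMap R L ∘ (0 : Fin n → R)
    rw [← hmap, ← hdx, ← Matrix.vecMul_vecMul, hmap, hyd, h₀, Matrix.zero_vecMul]
  refine hy₀ ?_
  rw [← Matrix.vecMul_one y, ← huw, Matrix.vecMul_add, ← Matrix.vecMul_vecMul,
    ← Matrix.vecMul_vecMul, hyd, hyc, Matrix.zero_vecMul, Matrix.zero_vecMul, add_zero]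

variable [IsPrincipalIdealRing R]

theorem finrank_ker_rowDefect (x : Matrix (Fin n) (Fin n) L) :
    Module.finrank R (LinearMap.ker (rowDefect (R := R) x)) = n := by
  obtain ⟨f, hf⟩ := exists_injective_ker_rowDefect (R := R) x
  have hle := LinearMap.finrank_le_finrank_of_injective (injective_snd_ker_rowDefect (R := R) x)
  have hge := LinearMap.finrank_le_finrank_of_injective hf
  rw [Module.finrank_fin_fun] at hle hge
  exact le_antisymm hle hge

-- The kernel of `rowDefect x` is free of rank `n`; a retraction onto it gives the right inverse of
-- `[c d]`.
theorem exists_primitive_fraction (x : Matrix (Fin n) (Fin n) L) :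
    ∃ c d u w : Matrix (Fin n) (Fin n) R,
      d.map (algebraMap R L) * x = c.map (algebraMap R L) ∧ c * u + d * w = 1 := by
  let b := Module.finBasisOfFinrankEq R _ (finrank_ker_rowDefect (R := R) x)
  obtain ⟨r, hr⟩ := exists_retraction_ker (rowDefect (R := R) x)
  refine ⟨Matrix.of fun i => (b i).1.1, Matrix.of fun i => (b i).1.2,
    Matrix.of fun i => b.equivFun (r (Pi.single i 1, 0)),
    Matrix.of fun i => b.equivFun (r (0, Pi.single i 1)), ?_, ?_⟩
  · ext i j
    exact congrFun (mem_ker_rowDefect.1 (b i).2) j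
  · ext k j
    have hk : (b k).1 = ∑ i, (b k).1.1 i • ((Pi.single i 1, 0) : (Fin n → R) × (Fin n → R)) +
        ∑ i, (b k).1.2 i • ((0, Pi.single i 1) : (Fin n → R) × (Fin n → R)) := by
      ext l <;> simp [Prod.fst_sum, Prod.snd_sum, Finset.sum_apply, Pi.single_apply]
    have hrepr := congrArg (fun z => b.equivFun (r z) j) hk
    simp only [hr, map_add, map_sum, map_smul, Module.Basis.equivFun_self, Pi.add_apply,
      Finset.sum_apply, Pi.smul_apply, smul_eq_mul] at hrepr
    rw [Matrix.one_apply, Matrix.add_apply, Matrix.mul_apply, Matrix.mul_apply]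
    exact hrepr.symm

theorem exists_isReducedFraction_map {Fv Kv : Type*} [Field Fv] [CommRing Kv] [Algebra Fv Kv]
    {g : ValuationSubring Fv} (ι : L →+* Kv) (hι : ∀ a : R, ι (algebraMap R L a) ∈ maxOrder g Kv)
    (x : Matrix (Fin n) (Fin n) L) : ∃ c d, IsReducedFraction g (x.map ι) c d := by
  obtain ⟨c, d, u, w, hdx, huw⟩ := exists_primitive_fraction (R := R) x
  let κ : R →+* maxOrder g Kv := (ι.comp (algebraMap R L)).codRestrict _ hι
  have hκ (e : Matrix (Fin n) (Fin n) R) :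
      (e.map κ).map (algebraMap (maxOrder g Kv) Kv) = (e.map (algebraMap R L)).map ι := rfl
  refine ⟨c.map κ, d.map κ, ?_, ?_, u.map κ, w.map κ, ?_⟩
  · have hdet := ((map_ne_zero_iff _ (IsFractionRing.injective R L)).2
      (det_ne_zero_of_isPrimitive hdx huw)).isUnit.map ι
    rwa [RingHom.map_det, RingHom.map_det] at hdet
  · rw [hκ, hκ, ← hdx, Matrix.map_mul]
  · rw [← Matrix.map_mul, ← Matrix.map_mul, ← Matrix.map_add _ (map_add κ), huw,
      Matrix.map_one _ (map_zero κ) (map_one κ)]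

end ReducedFraction

section LocalReducedFraction

variable {F K : Type*} [Field F] [NumberField F] [Field K] [Algebra F K]
  {v : HeightOneSpectrum (𝓞 F)} {ρ : LocalAlg F K v →+* LocalAlg F K v} {θ : K}
  {s P : v.adicCompletion F}
  (h : IsUnramifiedQuadratic (v.adicCompletionIntegers F) ρ ((1 : v.adicCompletion F) ⊗ₜ[F] θ) s P)

include h

theorem one_tmul_algebraMap_mem_maxOrder {a : F} (ha : v.valuation F a ≤ 1) :
    (1 : v.adicCompletion F) ⊗ₜ[F] algebraMap F K a ∈
      maxOrder (v.adicCompletionIntegers F) (LocalAlg F K v) := by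
  rw [← algebraMap_algebraMap_localAlg]
  exact h.algebraMap_mem_maxOrder_iff.2 (algebraMap_mem_adicCompletionIntegers_iff.2 ha)

theorem exists_sub_one_tmul_mem_maxOrder (z : LocalAlg F K v) :
    ∃ y : K, z - 1 ⊗ₜ y ∈ maxOrder (v.adicCompletionIntegers F) (LocalAlg F K v) := by
  obtain ⟨a, b, rfl⟩ := h.exists_coord z
  obtain ⟨a', ha'⟩ := exists_sub_algebraMap_mem_adicCompletionIntegers a
  obtain ⟨b', hb'⟩ := exists_sub_algebraMap_mem_adicCompletionIntegers b
  refine ⟨algebraMap F K a' + algebraMap F K b' * θ, ?_⟩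
  have hcoord : (1 : v.adicCompletion F) ⊗ₜ[F] (algebraMap F K a' + algebraMap F K b' * θ) =
      algebraMap _ (LocalAlg F K v) (algebraMap F (v.adicCompletion F) a') +
      algebraMap _ (LocalAlg F K v) (algebraMap F (v.adicCompletion F) b') * 1 ⊗ₜ θ := by
    rw [algebraMap_algebraMap_localAlg, algebraMap_algebraMap_localAlg, TensorProduct.tmul_add,
      Algebra.TensorProduct.tmul_mul_tmul, one_mul]
  convert h.coord_mem_maxOrder_iff.2 ⟨ha', hb'⟩ using 1
  rw [hcoord, map_sub, map_sub]
  ring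

-- Modulo the maximal order every matrix comes from `K`, which is the field of fractions of the
-- semilocal principal ideal domain `(𝓞 K)_v`.
theorem exists_isReducedFraction_localAlg [NumberField K] {n : ℕ}
    (x : Matrix (Fin n) (Fin n) (LocalAlg F K v)) :
    ∃ c d, IsReducedFraction (v.adicCompletionIntegers F) x c d := by
  let ι : K →ₐ[F] LocalAlg F K v := Algebra.TensorProduct.includeRight
  let M := Algebra.algebraMapSubmonoid (𝓞 K) v.asIdeal.primeCompl
  have hM : M ≤ nonZeroDivisors (𝓞 K) :=
    algebraMapSubmonoid_le_nonZeroDivisors_of_faithfulSMul _ v.asIdeal.primeCompl_le_nonZeroDivisors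
  let R := Localization.subalgebra.ofField K M hM
  have : IsDedekindDomain R := IsLocalization.isDedekindDomain (𝓞 K) hM R
  have : IsPrincipalIdealRing R :=
    IsDedekindDomain.isPrincipalIdealRing_localization_over_prime (𝓞 K) v.asIdeal v.ne_bot
  have hι (a : R) : ι a ∈ maxOrder (v.adicCompletionIntegers F) (LocalAlg F K v) := by
    obtain ⟨_, b, _, ⟨m, hm, rfl⟩, rfl⟩ := a
    have hb : ι b ∈ maxOrder (v.adicCompletionIntegers F) (LocalAlg F K v) :=
      (RingOfIntegers.isIntegral_coe b).map_of_comp_eq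
        (algebraMap ℤ (v.adicCompletionIntegers F)) (ι : K →+* LocalAlg F K v)
        (RingHom.ext_int _ _)
    have hm' : v.valuation F (algebraMap (𝓞 F) F m)⁻¹ ≤ 1 := by
      rw [map_inv₀, (v.valuation_eq_one_iff_notMem (K := F)).2 hm, inv_one]
    change ι (b * (algebraMap F K (algebraMap (𝓞 F) F m))⁻¹) ∈ _
    rw [← map_inv₀, map_mul]
    exact mul_mem hb (one_tmul_algebraMap_mem_maxOrder h hm')
  choose y hy using fun i j => exists_sub_one_tmul_mem_maxOrder h (x i j)
  obtain ⟨c, d, hcd⟩ := exists_isReducedFraction_map (R := R) (ι : K →+* LocalAlg F K v) hι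
    (Matrix.of y)
  let N : Matrix (Fin n) (Fin n) (maxOrder (v.adicCompletionIntegers F) (LocalAlg F K v)) :=
    Matrix.of fun i j => ⟨_, hy i j⟩
  refine ⟨c + d * N, d, ?_⟩
  convert hcd.add N
  ext i j
  exact (add_sub_cancel (ι (y i j)) (x i j)).symm

end LocalReducedFraction

/-! ### Base change of the local algebras -/

section OddDegree

variable {F K F' K' : Type*} [Field F] [Field K] [Field F'] [Field K'] [Algebra F K]
  [Algebra F' K'] [Algebra F F'] [Algebra K K'] [Algebra F K'] [IsScalarTower F F' K']
  [IsScalarTower F K K']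

theorem algebraMap_algebraMap_comm (a : F) :
    algebraMap K K' (algebraMap F K a) = algebraMap F' K' (algebraMap F F' a) := by
  rw [← IsScalarTower.algebraMap_apply, ← IsScalarTower.algebraMap_apply]

variable [Algebra.IsQuadraticExtension F K]

theorem mem_range_algebraMap_of_odd_finrank [FiniteDimensional F F']
    (hodd : Odd (Module.finrank F F')) {k : K}
    (hk : algebraMap K K' k ∈ Set.range (algebraMap F' K')) : k ∈ Set.range (algebraMap F K) := by
  obtain ⟨c, hc⟩ := hk
  have hmin : minpoly F c = minpoly F k := by
    rw [← minpoly.algebraMap_eq (algebraMap F' K').injective c, hc,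
      minpoly.algebraMap_eq (algebraMap K K').injective k]
  have hdvd : (minpoly F k).natDegree ∣ Module.finrank F F' := by
    rw [← hmin]
    exact minpoly.degree_dvd (Algebra.IsIntegral.isIntegral c)
  have hdvd_two : (minpoly F k).natDegree ∣ 2 := by
    rw [← Algebra.IsQuadraticExtension.finrank_eq_two F K]
    exact minpoly.degree_dvd (Algebra.IsIntegral.isIntegral k)
  exact minpoly.natDegree_eq_one_iff.1
    (Nat.eq_one_of_dvd_coprimes hodd.coprime_two_right hdvd hdvd_two)

theorem apply_algebraMap_eq_algebraMap_apply [IsGalois F K] [Algebra.IsQuadraticExtension F' K']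
    [IsGalois F' K'] [FiniteDimensional F F'] {ρ : K ≃ₐ[F] K} (hρ : ρ ≠ 1)
    {ρ' : K' ≃ₐ[F'] K'} (hρ' : ρ' ≠ 1) (hodd : Odd (Module.finrank F F')) (k : K) :
    ρ' (algebraMap K K' k) = algebraMap K K' (ρ k) := by
  have hfix (a : F) : ρ' (algebraMap K K' (algebraMap F K a)) =
      algebraMap K K' (algebraMap F K a) := by
    rw [algebraMap_algebraMap_comm (F' := F'), ρ'.commutes]
  obtain ⟨t, ht⟩ := mem_range_algebraMap_of_apply_eq hρ (x := k + ρ k)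
    (by rw [map_add, apply_apply_eq_self, add_comm])
  obtain ⟨N, hN⟩ := mem_range_algebraMap_of_apply_eq hρ (x := k * ρ k)
    (by rw [map_mul, apply_apply_eq_self, mul_comm])
  have htrace := ht ▸ hfix t
  have hnorm := hN ▸ hfix N
  simp only [map_add, map_mul] at htrace hnorm
  have hroot : (ρ' (algebraMap K K' k) - algebraMap K K' k) *
      (ρ' (algebraMap K K' k) - algebraMap K K' (ρ k)) = 0 := by
    linear_combination ρ' (algebraMap K K' k) * htrace - hnorm
  rcases mul_eq_zero.1 hroot with hfixed | hconj
  · obtain ⟨a, rfl⟩ := mem_range_algebraMap_of_odd_finrank hodd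
      (mem_range_algebraMap_of_apply_eq hρ' (sub_eq_zero.1 hfixed))
    rw [ρ.commutes, hfix]
  · exact sub_eq_zero.1 hconj

end OddDegree

section LocalAlgMap

variable {F K F' K' : Type*} [Field F] [NumberField F] [Field K] [Field F'] [NumberField F']
  [Field K'] [Algebra F K] [Algebra F' K'] [Algebra F F'] [Algebra K K'] [Algebra F K']
  [IsScalarTower F F' K'] [IsScalarTower F K K'] (w : HeightOneSpectrum (𝓞 F'))

variable (F K F' K') in
/-- The homomorphism `K_v → K'_w` for a prime `w` of `F'` above the prime `v` of `F`. -/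
noncomputable def localAlgMap : LocalAlg F K (w.under (𝓞 F)) →+* LocalAlg F' K' w :=
  tensorMap (algebraMap F F') (completionMap F F' w) (algebraMap K K') (completionMap_coe F F' w)
    algebraMap_algebraMap_comm

theorem localAlgMap_tmul (a : (w.under (𝓞 F)).adicCompletion F) (k : K) :
    localAlgMap F K F' K' w (a ⊗ₜ k) = completionMap F F' w a ⊗ₜ algebraMap K K' k :=
  tensorMap_tmul _ _ _ _ _ a k

theorem localAlgMap_one_tmul (k : K) :
    localAlgMap F K F' K' w (1 ⊗ₜ k) = 1 ⊗ₜ algebraMap K K' k := by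
  rw [localAlgMap_tmul, map_one]

theorem localAlgMap_algebraMap (a : (w.under (𝓞 F)).adicCompletion F) :
    localAlgMap F K F' K' w (algebraMap _ _ a) = algebraMap _ _ (completionMap F F' w a) := by
  rw [Algebra.TensorProduct.algebraMap_apply, localAlgMap_tmul, map_one]
  rfl

theorem component_finiteAdelesMap (x : FiniteAdeles F K) :
    component F' K' w (finiteAdelesMap F K F' K' x) =
      localAlgMap F K F' K' w (component F K (w.under (𝓞 F)) x) := by
  induction x using TensorProduct.induction_on with
  | zero => rw [map_zero, map_zero, map_zero, map_zero]
  | add x y hx hy => rw [map_add, map_add, hx, hy, map_add, map_add]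
  | tmul a k =>
    have hmap : finiteAdelesMap F K F' K' (a ⊗ₜ k) = finiteAdeleMap F F' a ⊗ₜ algebraMap K K' k :=
      tensorMap_tmul _ _ _ _ _ a k
    have hcomp : component F K (w.under (𝓞 F)) (a ⊗ₜ k) = a (w.under (𝓞 F)) ⊗ₜ k :=
      tensorMap_tmul _ _ _ _ _ a k
    rw [hmap, hcomp, localAlgMap_tmul]
    exact tensorMap_tmul _ _ _ _ _ _ _

variable {ρ : K ≃ₐ[F] K} {ρ' : K' ≃ₐ[F'] K'}
  (hρρ' : ∀ k, ρ' (algebraMap K K' k) = algebraMap K K' (ρ k))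

include hρρ'

theorem localConj_localAlgMap (x : LocalAlg F K (w.under (𝓞 F))) :
    localConj F' ρ' w (localAlgMap F K F' K' w x) =
      localAlgMap F K F' K' w (localConj F ρ (w.under (𝓞 F)) x) := by
  induction x using TensorProduct.induction_on with
  | zero => rw [map_zero, map_zero, map_zero, map_zero]
  | add x y hx hy => rw [map_add, map_add, hx, hy, map_add, map_add]
  | tmul a k => rw [localAlgMap_tmul, localConj_tmul, localConj_tmul, localAlgMap_tmul, hρρ']

theorem zeta_map {ω : ∀ v : HeightOneSpectrum (𝓞 F), v.adicCompletionIntegers F}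
    {ω' : ∀ w : HeightOneSpectrum (𝓞 F'), w.adicCompletionIntegers F'} {n : ℕ}
    (β : Matrix (Fin n) (Fin n) K) (A : GL (Fin n) (FiniteAdeles F K)) {u : w.adicCompletion F'}
    (hu : (ω' w : w.adicCompletion F') = u * completionMap F F' w (ω (w.under (𝓞 F)))) :
    zeta ρ' ω' (β.map (algebraMap K K'))
        (Matrix.GeneralLinearGroup.map (finiteAdelesMap F K F' K') A) w =
      u • (zeta ρ ω β A (w.under (𝓞 F))).map (localAlgMap F K F' K' w) := by
  have hA : (Matrix.GeneralLinearGroup.map (finiteAdelesMap F K F' K') A).1.map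
      (component F' K' w) =
        (A.1.map (component F K (w.under (𝓞 F)))).map (localAlgMap F K F' K' w) := by
    ext i j
    exact component_finiteAdelesMap w _
  have hadj : adjT (localConj F' ρ' w)
      ((A.1.map (component F K (w.under (𝓞 F)))).map (localAlgMap F K F' K' w)) =
        (adjT (localConj F ρ (w.under (𝓞 F))) (A.1.map (component F K (w.under (𝓞 F))))).map
          (localAlgMap F K F' K' w) := by
    ext i j
    exact localConj_localAlgMap w hρρ' _
  have hβ : (β.map (algebraMap K K')).map
      (Algebra.TensorProduct.includeRight : K' →ₐ[F'] LocalAlg F' K' w) =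
        (β.map (Algebra.TensorProduct.includeRight : K →ₐ[F] LocalAlg F K (w.under (𝓞 F)))).map
          (localAlgMap F K F' K' w) := by
    ext i j
    exact (localAlgMap_one_tmul w _).symm
  rw [zeta, zeta, hA, hadj, hβ, hu, mul_smul, ← Matrix.map_mul, ← Matrix.map_mul]
  congr 1
  ext i j
  rw [Matrix.smul_apply, Matrix.map_apply, Matrix.map_apply, Matrix.smul_apply, Algebra.smul_def,
    Algebra.smul_def, map_mul, localAlgMap_algebraMap]

end LocalAlgMap

section Different

variable {F F' : Type*} [Field F] [NumberField F] [Field F'] [NumberField F'] [Algebra F F']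
  (w : HeightOneSpectrum (𝓞 F')) [Algebra.IsUnramifiedAt (𝓞 F) w.asIdeal]

variable (F) in
theorem map_differentIdeal_eq_top :
    (differentIdeal (𝓞 F) (𝓞 F')).map
      (algebraMap (𝓞 F') (w.adicCompletionIntegers F')) = ⊤ := by
  have hndvd : ¬ w.asIdeal ∣ differentIdeal (𝓞 F) (𝓞 F') :=
    not_dvd_differentIdeal_iff.2 inferInstance
  rw [Ideal.dvd_iff_le, SetLike.not_le_iff_exists] at hndvd
  obtain ⟨x, hx, hxw⟩ := hndvd
  refine Ideal.eq_top_of_isUnit_mem _ (Ideal.mem_map_of_mem _ hx) ?_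
  rw [HeightOneSpectrum.adicCompletionIntegers.isUnit_iff_valued_eq_one]
  exact (HeightOneSpectrum.valuedAdicCompletion_eq_valuation' w (algebraMap (𝓞 F') F' x)).trans
    ((w.valuation_eq_one_iff_notMem (K := F')).2 hxw)

theorem exists_unit_mul_completionMap_eq
    {ω : ∀ v : HeightOneSpectrum (𝓞 F), v.adicCompletionIntegers F} (hω : IsDifferentFamily ω)
    {ω' : ∀ w : HeightOneSpectrum (𝓞 F'), w.adicCompletionIntegers F'}
    (hω' : IsDifferentFamily ω') :
    ∃ u : (w.adicCompletionIntegers F')ˣ, (ω' w : w.adicCompletion F') =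
      ((u : w.adicCompletionIntegers F') : w.adicCompletion F') *
        completionMap F F' w (ω (w.under (𝓞 F))) := by
  let κ : (w.under (𝓞 F)).adicCompletionIntegers F →+* w.adicCompletionIntegers F' :=
    (completionMap F F' w).restrict _ _ (completionMap_mapsTo F F' w)
  have hκ : (algebraMap (𝓞 F') (w.adicCompletionIntegers F')).comp (algebraMap (𝓞 F) (𝓞 F')) =
      κ.comp (algebraMap (𝓞 F) ((w.under (𝓞 F)).adicCompletionIntegers F)) :=
    RingHom.ext fun x => Subtype.ext (completionMap_coe F F' w (algebraMap (𝓞 F) F x)).symm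
  have hspan : Ideal.span {κ (ω (w.under (𝓞 F)))} = Ideal.span {ω' w} := by
    rw [← hω' w, differentIdeal_eq_differentIdeal_mul_differentIdeal ℤ (𝓞 F) (𝓞 F'),
      Ideal.map_mul, map_differentIdeal_eq_top, Ideal.top_mul, Ideal.map_map, hκ,
      ← Ideal.map_map, hω, Ideal.map_span, Set.image_singleton]
  obtain ⟨u, hu⟩ := Ideal.span_singleton_eq_span_singleton.1 hspan
  refine ⟨u, ?_⟩
  rw [← hu, mul_comm]
  rfl

end Different

section SiegelG

variable {F K F' K' : Type*} [Field F] [NumberField F] [Field K] [NumberField K] [Field F']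
  [NumberField F'] [Field K'] [Algebra F K] [Algebra F' K'] [Algebra F F']
  [Algebra K K'] [Algebra F K'] [IsScalarTower F F' K'] [IsScalarTower F K K']
  [Algebra.IsQuadraticExtension F K] [Algebra.IsQuadraticExtension F' K'] [IsGalois F F']
  {p : ℕ} (hp : p.Prime) (hdeg : Module.finrank F F' = p)
  {ρ : K ≃ₐ[F] K} (hρ : ρ ≠ 1) {ρ' : K' ≃ₐ[F'] K'}
  {w : HeightOneSpectrum (𝓞 F')} [Algebra.IsUnramifiedAt (𝓞 F) w.asIdeal]
  (hpw : (p : 𝓞 F') ∉ w.asIdeal)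
  (hK : ∀ w' : HeightOneSpectrum (𝓞 K), w'.under (𝓞 F) = w.under (𝓞 F) →
    Algebra.IsUnramifiedAt (𝓞 F) w'.asIdeal)

include hp hdeg hρ hpw hK

theorem exists_isQuadraticBaseChange
    (hρρ' : ∀ k, ρ' (algebraMap K K' k) = algebraMap K K' (ρ k)) :
    ∃ γ ϖ ϖ' θ s P, IsQuadraticBaseChange p ((w.under (𝓞 F)).adicCompletionIntegers F)
      (w.adicCompletionIntegers F') (completionMap F F' w) γ ϖ ϖ'
      (localConj F ρ (w.under (𝓞 F))) (localConj F' ρ' w) (1 ⊗ₜ[F] θ) s P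
      (localAlgMap F K F' K' w) := by
  obtain ⟨θ, s, P, hs, hP, hdisc⟩ := exists_discriminant_notMem hρ hK
  have hs₁ := (w.under (𝓞 F)).valuation_le_one (K := F) s
  have hP₁ := (w.under (𝓞 F)).valuation_le_one (K := F) P
  have hdisc₁ : (w.under (𝓞 F)).valuation F
      (algebraMap (𝓞 F) F s ^ 2 - 4 * algebraMap (𝓞 F) F P) = 1 := by
    rw [← (w.under (𝓞 F)).valuation_eq_one_iff_notMem (K := F)] at hdisc
    simpa only [map_sub, map_mul, map_pow, map_ofNat] using hdisc
  have hquad' := isUnramifiedQuadratic_localAlg (ρ := ρ') (v := w) (θ := algebraMap K K' θ)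
    (s := algebraMap F F' (algebraMap (𝓞 F) F s)) (P := algebraMap F F' (algebraMap (𝓞 F) F P))
    (by rw [← algebraMap_algebraMap_comm (F := F) (K := K), hs, hρρ', map_add])
    (by rw [← algebraMap_algebraMap_comm (F := F) (K := K), hP, hρρ', map_mul])
    ((valuation_algebraMap_eq F F' w _).trans_le hs₁)
    ((valuation_algebraMap_eq F F' w _).trans_le hP₁) (by
      rw [← hdisc₁, ← valuation_algebraMap_eq F F' w]
      simp only [map_sub, map_mul, map_pow, map_ofNat])
  rw [← localAlgMap_one_tmul (F := F), ← completionMap_coe, ← completionMap_coe] at hquad'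
  obtain ⟨γ, ϖ, ϖ', B⟩ := exists_isCyclicBaseChange hp hdeg hpw
  exact ⟨γ, ϖ, ϖ', θ, _, _, B, isUnramifiedQuadratic_localAlg hs hP hs₁ hP₁ hdisc₁, hquad',
    localAlgMap_algebraMap w⟩

theorem exists_int_coeff_siegelG (hodd : Odd p) (hρ' : ρ' ≠ 1)
    {χ : ∀ v : HeightOneSpectrum (𝓞 F), AddChar (v.adicCompletion F) Circle}
    (hχ : IsCharFamily χ)
    {χ' : ∀ w : HeightOneSpectrum (𝓞 F'), AddChar (w.adicCompletion F') Circle}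
    (hχ' : IsCharFamily χ') {ω : ∀ v : HeightOneSpectrum (𝓞 F), v.adicCompletionIntegers F}
    (hω : IsDifferentFamily ω) {ω' : ∀ w : HeightOneSpectrum (𝓞 F'), w.adicCompletionIntegers F'}
    (hω' : IsDifferentFamily ω') {n : ℕ} (β : Matrix (Fin n) (Fin n) K)
    (A : GL (Fin n) (FiniteAdeles F K)) (j : ℕ) :
    ∃ a a' : ℤ, PowerSeries.coeff j (siegelG ρ χ ω β A (w.under (𝓞 F))) = a ∧
      PowerSeries.coeff j (siegelG ρ' χ' ω' (β.map (algebraMap K K'))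
        (Matrix.GeneralLinearGroup.map (finiteAdelesMap F K F' K') A) w) = a' ∧
      a ≡ a' [ZMOD p] := by
  have := Fact.mk hp
  have hρρ' := apply_algebraMap_eq_algebraMap_apply (F := F) (K := K) (F' := F') (K' := K')
    hρ hρ' (hdeg ▸ hodd)
  obtain ⟨γ, ϖ, ϖ', θ, s, P, B⟩ := exists_isQuadraticBaseChange hp hdeg hρ hpw hK hρρ'
  obtain ⟨u, hu⟩ := exists_unit_mul_completionMap_eq (F := F) w hω hω'
  rw [siegelG, siegelG, zeta_map w hρρ' β A hu]
  exact B.exists_int_coeff_seriesG hodd (exists_isReducedFraction_localAlg B.quad) (hχ _) (hχ' w)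
    (zeta ρ ω β A (w.under (𝓞 F))) u j

end SiegelG

/-! ### Coefficients at powers of a prime -/

section SiegelCoeff

variable {F K : Type*} [Field F] [NumberField F] [Field K] [Algebra F K] (ρ : K ≃ₐ[F] K)
  (χ : ∀ v : HeightOneSpectrum (𝓞 F), AddChar (v.adicCompletion F) Circle)
  (ω : ∀ v : HeightOneSpectrum (𝓞 F), v.adicCompletionIntegers F) {n : ℕ}
  (β : Matrix (Fin n) (Fin n) K) (A : GL (Fin n) (FiniteAdeles F K))

theorem siegelCoeff_one : siegelCoeff ρ χ ω β A 1 = 1 := by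
  refine finprod_eq_one_of_forall_eq_one fun v => ?_
  have : IsEmpty (v.asIdeal ∣ 1) :=
    ⟨fun h => v.isPrime.ne_top (Ideal.isUnit_iff.1 (isUnit_of_dvd_one h))⟩
  exact finprod_of_isEmpty _

variable (v : HeightOneSpectrum (𝓞 F)) {j : ℕ} (hj : j ≠ 0)

include hj

theorem siegelCoeff_prime_pow :
    siegelCoeff ρ χ ω β A (v.asIdeal ^ j) = PowerSeries.coeff j (siegelG ρ χ ω β A v) := by
  have hdvd (v' : HeightOneSpectrum (𝓞 F)) :
      v'.asIdeal ∣ v.asIdeal ^ j ↔ v' ∈ ({v} : Set (HeightOneSpectrum (𝓞 F))) := by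
    rw [v'.prime.dvd_pow_iff_dvd hj, v'.prime.dvd_prime_iff_associated v.prime, associated_iff_eq,
      Set.mem_singleton_iff, HeightOneSpectrum.ext_iff]
  rw [siegelCoeff]
  simp only [hdvd]
  rw [finprod_mem_singleton, multiplicity_pow_self_of_prime v.prime]

end SiegelCoeff

section PrimesOver

variable {F F' : Type*} [Field F] [NumberField F] [Field F'] [NumberField F'] [Algebra F F']

theorem asIdeal_dvd_map_iff {v : HeightOneSpectrum (𝓞 F)} {w : HeightOneSpectrum (𝓞 F')} :
    w.asIdeal ∣ v.asIdeal.map (algebraMap (𝓞 F) (𝓞 F')) ↔ w.under (𝓞 F) = v := by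
  rw [Ideal.dvd_iff_le, Ideal.map_le_iff_le_comap]
  refine ⟨fun h => HeightOneSpectrum.ext ?_, fun h => h ▸ le_rfl⟩
  exact (v.isMaximal.eq_of_le (w.under (𝓞 F)).isPrime.ne_top h).symm

theorem multiplicity_map_under_pow (w : HeightOneSpectrum (𝓞 F'))
    [Algebra.IsUnramifiedAt (𝓞 F) w.asIdeal] (j : ℕ) :
    multiplicity w.asIdeal
      ((w.under (𝓞 F)).asIdeal.map (algebraMap (𝓞 F) (𝓞 F')) ^ j) = j := by
  have hne : (w.under (𝓞 F)).asIdeal.map (algebraMap (𝓞 F) (𝓞 F')) ≠ ⊥ :=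
    Ideal.map_ne_bot_of_ne_bot (w.under (𝓞 F)).ne_bot
  rw [(FiniteMultiplicity.of_prime_left w.prime hne).multiplicity_pow w.prime,
    ← Ideal.IsDedekindDomain.ramificationIdx_eq_multiplicity _ _ hne,
    Ideal.ramificationIdx_eq_one, mul_one]

theorem siegelCoeff_map_pow {K' : Type*} [Field K'] [Algebra F' K'] (ρ' : K' ≃ₐ[F'] K')
    (χ' : ∀ w : HeightOneSpectrum (𝓞 F'), AddChar (w.adicCompletion F') Circle)
    (ω' : ∀ w : HeightOneSpectrum (𝓞 F'), w.adicCompletionIntegers F') {n : ℕ}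
    (β : Matrix (Fin n) (Fin n) K') (A : GL (Fin n) (FiniteAdeles F' K'))
    {v : HeightOneSpectrum (𝓞 F)}
    (hunram : ∀ w : HeightOneSpectrum (𝓞 F'), w.under (𝓞 F) = v →
      Algebra.IsUnramifiedAt (𝓞 F) w.asIdeal) {j : ℕ} (hj : j ≠ 0) :
    siegelCoeff ρ' χ' ω' β A (v.asIdeal.map (algebraMap (𝓞 F) (𝓞 F')) ^ j) =
      ∏ᶠ w ∈ {w : HeightOneSpectrum (𝓞 F') | w.under (𝓞 F) = v},
        PowerSeries.coeff j (siegelG ρ' χ' ω' β A w) := by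
  have hdvd (w : HeightOneSpectrum (𝓞 F')) :
      w.asIdeal ∣ v.asIdeal.map (algebraMap (𝓞 F) (𝓞 F')) ^ j ↔
        w ∈ {w : HeightOneSpectrum (𝓞 F') | w.under (𝓞 F) = v} :=
    (w.prime.dvd_pow_iff_dvd hj).trans asIdeal_dvd_map_iff
  rw [siegelCoeff]
  simp only [hdvd]
  refine finprod_mem_congr rfl fun w hw => ?_
  obtain rfl : w.under (𝓞 F) = v := hw
  have := hunram w rfl
  rw [multiplicity_map_under_pow]

theorem ncard_under_eq_dvd_finrank [IsGalois F F'] (v : HeightOneSpectrum (𝓞 F)) :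
    {w : HeightOneSpectrum (𝓞 F') | w.under (𝓞 F) = v}.ncard ∣ Module.finrank F F' := by
  have himage : HeightOneSpectrum.asIdeal '' {w : HeightOneSpectrum (𝓞 F') | w.under (𝓞 F) = v} =
      v.asIdeal.primesOver (𝓞 F') := by
    ext Q
    constructor
    · rintro ⟨w, rfl, rfl⟩
      exact ⟨w.isPrime, ⟨rfl⟩⟩
    · rintro ⟨hQ, hQv⟩
      exact ⟨⟨Q, hQ, Ideal.ne_bot_of_liesOver_of_ne_bot v.ne_bot Q⟩,
        HeightOneSpectrum.ext hQv.over.symm, rfl⟩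
  rw [← Set.ncard_image_of_injective _ HeightOneSpectrum.asIdeal_injective, himage,
    ← IsGalois.card_aut_eq_finrank,
    ← Ideal.ncard_primesOver_mul_ramificationIdxIn_mul_inertiaDegIn v.asIdeal (𝓞 F') Gal(F'/F)]
  exact dvd_mul_right _ _

end PrimesOver

section Congruence

theorem exists_int_finprod_mem_modEq {ι R : Type*} [CommRing R] {s : Set ι} (hs : s.Finite)
    {f : ι → R} {a m : ℤ} (hf : ∀ i ∈ s, ∃ b : ℤ, f i = b ∧ a ≡ b [ZMOD m]) :
    ∃ b : ℤ, ∏ᶠ i ∈ s, f i = b ∧ a ^ s.ncard ≡ b [ZMOD m] := by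
  induction s, hs using Set.Finite.induction_on with
  | empty => exact ⟨1, by simp, by simp⟩
  | @insert i s hi hs ih =>
    obtain ⟨b, hb, hab⟩ := hf i (Set.mem_insert i s)
    obtain ⟨c, hc, hac⟩ := ih fun k hk => hf k (Set.mem_insert_of_mem i hk)
    refine ⟨b * c, by rw [finprod_mem_insert f hi hs, hb, hc, Int.cast_mul], ?_⟩
    rw [Set.ncard_insert_of_notMem hi hs, pow_succ']
    exact hab.mul hac

theorem pow_modEq_self_of_dvd_prime {p m : ℕ} (hp : p.Prime) (hm : m ∣ p) (a : ℤ) :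
    a ^ m ≡ a [ZMOD p] := by
  rcases (Nat.dvd_prime hp).1 hm with rfl | rfl
  · rw [pow_one]
  · have := Fact.mk hp
    rw [← ZMod.intCast_eq_intCast_iff, Int.cast_pow, ZMod.pow_card]

end Congruence

end SiegelSeries

open SiegelSeries in
theorem mainTheorem11_general
    {p : ℕ} (hp : p.Prime) (hp2 : p ≠ 2)
    {F K F' K' : Type*} [Field F] [NumberField F] [Field K] [NumberField K]
    [Field F'] [NumberField F'] [Field K']
    [Algebra F K] [Algebra F F'] [Algebra F' K'] [Algebra K K'] [Algebra F K']
    [IsScalarTower F F' K'] [IsScalarTower F K K']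
    [Algebra.IsQuadraticExtension F K] [Algebra.IsQuadraticExtension F' K']
    [IsGalois F F'] (hdeg : Module.finrank F F' = p)
    {ρ : K ≃ₐ[F] K} (hρ : ρ ≠ 1) {ρ' : K' ≃ₐ[F'] K'} (hρ' : ρ' ≠ 1)
    {χ : ∀ v : HeightOneSpectrum (𝓞 F), AddChar (v.adicCompletion F) Circle}
    (hχ : IsCharFamily χ)
    {χ' : ∀ w : HeightOneSpectrum (𝓞 F'), AddChar (w.adicCompletion F') Circle}
    (hχ' : IsCharFamily χ')
    {ω : ∀ v : HeightOneSpectrum (𝓞 F), v.adicCompletionIntegers F}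
    (hω : IsDifferentFamily ω)
    {ω' : ∀ w : HeightOneSpectrum (𝓞 F'), w.adicCompletionIntegers F'}
    (hω' : IsDifferentFamily ω')
    {n : ℕ} {β : Matrix (Fin n) (Fin n) K} (_hβ : adjT (ρ : K →+* K) β = β)
    (A : GL (Fin n) (FiniteAdeles F K))
    {𝔮 : HeightOneSpectrum (𝓞 F)} (h𝔮p : (p : 𝓞 F) ∉ 𝔮.asIdeal)
    (h𝔮F' : ∀ w : HeightOneSpectrum (𝓞 F'), w.under (𝓞 F) = 𝔮 →
      Algebra.IsUnramifiedAt (𝓞 F) w.asIdeal)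
    (h𝔮K : ∀ w : HeightOneSpectrum (𝓞 K), w.under (𝓞 F) = 𝔮 →
      Algebra.IsUnramifiedAt (𝓞 F) w.asIdeal) (j : ℕ) :
    ∃ a a' : ℤ,
      siegelCoeff ρ χ ω β A (𝔮.asIdeal ^ j) = a ∧
      siegelCoeff ρ' χ' ω' (β.map (algebraMap K K'))
        (Matrix.GeneralLinearGroup.map (finiteAdelesMap F K F' K') A)
        ((𝔮.asIdeal.map (algebraMap (𝓞 F) (𝓞 F'))) ^ j) = a' ∧
      a ≡ a' [ZMOD p] := by
  rcases eq_or_ne j 0 with rfl | hj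
  · exact ⟨1, 1, by rw [pow_zero, siegelCoeff_one, Int.cast_one],
      by rw [pow_zero, siegelCoeff_one, Int.cast_one], rfl⟩
  rw [siegelCoeff_prime_pow ρ χ ω β A 𝔮 hj, siegelCoeff_map_pow ρ' χ' ω' _ _ h𝔮F' hj]
  have hlocal (w : HeightOneSpectrum (𝓞 F')) (hw : w.under (𝓞 F) = 𝔮) :
      ∃ a a' : ℤ, PowerSeries.coeff j (siegelG ρ χ ω β A 𝔮) = a ∧
        PowerSeries.coeff j (siegelG ρ' χ' ω' (β.map (algebraMap K K'))
          (Matrix.GeneralLinearGroup.map (finiteAdelesMap F K F' K') A) w) = a' ∧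
        a ≡ a' [ZMOD p] := by
    subst hw
    have := h𝔮F' w rfl
    have hpw : (p : 𝓞 F') ∉ w.asIdeal := map_natCast (algebraMap (𝓞 F) (𝓞 F')) p ▸ h𝔮p
    exact exists_int_coeff_siegelG hp hdeg hρ hpw h𝔮K (hp.odd_of_ne_two hp2) hρ' hχ hχ' hω hω' β A j
  obtain ⟨w₀, hw₀⟩ := exists_under_eq (K := F') 𝔮
  obtain ⟨a, -, ha, -, -⟩ := hlocal w₀ hw₀
  have hdvd : {w : HeightOneSpectrum (𝓞 F') | w.under (𝓞 F) = 𝔮}.ncard ∣ p :=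
    hdeg ▸ ncard_under_eq_dvd_finrank 𝔮
  obtain ⟨a', ha', hpow⟩ := exists_int_finprod_mem_modEq (a := a)
    (Set.finite_of_ncard_ne_zero (ne_zero_of_dvd_ne_zero hp.ne_zero hdvd)) fun w hw => by
      obtain ⟨b, b', hb, hb', hmod⟩ := hlocal w hw
      obtain rfl : a = b := Int.cast_injective (ha.symm.trans hb)
      exact ⟨b', hb', hmod⟩
  exact ⟨a, a', ha, ha', (pow_modEq_self_of_dvd_prime hp hdvd a).symm.trans hpow⟩

open SiegelSeries in
theorem mainTheorem11
    (p : ℕ) (hp : p.Prime) (hp2 : p ≠ 2)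
    (F K F' K' : Type*) [Field F] [NumberField F] [Field K] [NumberField K]
    [Field F'] [NumberField F'] [Field K'] [NumberField K']
    [Algebra F K] [Algebra F F'] [Algebra F' K'] [Algebra K K'] [Algebra F K']
    [IsScalarTower F F' K'] [IsScalarTower F K K']
    -- `F` and `F'` are totally real, `K` is a CM field with maximal totally real subfield `F`
    [IsTotallyReal F] [IsTotallyReal F'] [IsTotallyComplex K]
    [Algebra.IsQuadraticExtension F K]
    -- `K' = F' K`, which is equivalent to `[K' : F'] = 2` as `F'` is totally real and `K` is not
    [Algebra.IsQuadraticExtension F' K']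
    -- `F'/F` is Galois of degree `p` and unramified outside `p`
    [IsGalois F F'] (hdeg : Module.finrank F F' = p)
    (hunram : ∀ w : HeightOneSpectrum (𝓞 F'), (p : 𝓞 F') ∉ w.asIdeal →
      Algebra.IsUnramifiedAt (𝓞 F) w.asIdeal)
    -- the nontrivial automorphisms of `K/F` and `K'/F'`
    (ρ : K ≃ₐ[F] K) (hρ : ρ ≠ 1) (ρ' : K' ≃ₐ[F'] K') (hρ' : ρ' ≠ 1)
    -- a finite set of primes of `F` that contains those above `p` and those ramified in `K`
    (S : Finset (HeightOneSpectrum (𝓞 F)))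
    (hSp : ∀ v : HeightOneSpectrum (𝓞 F), (p : 𝓞 F) ∈ v.asIdeal → v ∈ S)
    (hSK : ∀ w : HeightOneSpectrum (𝓞 K), ¬ Algebra.IsUnramifiedAt (𝓞 F) w.asIdeal →
      w.under (𝓞 F) ∈ S)
    -- the local additive characters and generators of the local differents over `F` and `F'`
    (χ : ∀ v : HeightOneSpectrum (𝓞 F), AddChar (v.adicCompletion F) Circle)
    (hχ : IsCharFamily χ)
    (χ' : ∀ w : HeightOneSpectrum (𝓞 F'), AddChar (w.adicCompletion F') Circle)
    (hχ' : IsCharFamily χ')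
    (ω : ∀ v : HeightOneSpectrum (𝓞 F), v.adicCompletionIntegers F)
    (hω : IsDifferentFamily ω)
    (ω' : ∀ w : HeightOneSpectrum (𝓞 F'), w.adicCompletionIntegers F')
    (hω' : IsDifferentFamily ω')
    (n : ℕ) (β : Matrix (Fin n) (Fin n) K) (hβ : IsPosDefHermitian ρ β)
    (A : GL (Fin n) (Adeles F K))
    (𝔮 : HeightOneSpectrum (𝓞 F)) (h𝔮 : 𝔮 ∉ S) (j : ℕ) :
    ∃ a a' : ℤ,
      siegelCoeff ρ χ ω β (Matrix.GeneralLinearGroup.map (finitePart F K) A)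
        (𝔮.asIdeal ^ j) = a ∧
      siegelCoeff ρ' χ' ω' (β.map (algebraMap K K'))
        (Matrix.GeneralLinearGroup.map ((finiteAdelesMap F K F' K').comp (finitePart F K)) A)
        ((𝔮.asIdeal.map (algebraMap (𝓞 F) (𝓞 F'))) ^ j) = a' ∧
      a ≡ a' [ZMOD p] := by
  have hp𝔮 : (p : 𝓞 F) ∉ 𝔮.asIdeal := fun hmem => h𝔮 (hSp 𝔮 hmem)
  refine mainTheorem11_general hp hp2 hdeg hρ hρ' hχ hχ' hω hω' hβ.1
    (Matrix.GeneralLinearGroup.map (finitePart F K) A) hp𝔮 ?_ ?_ j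
  · rintro w rfl
    exact hunram w (map_natCast (algebraMap (𝓞 F) (𝓞 F')) p ▸ hp𝔮)
  · rintro w rfl
    exact not_imp_comm.1 (hSK w) h𝔮
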